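/- **Setting.** Let $g\ge 1$ and let $f(x)=c\prod_{k=1}^{2g+2}(x-e_k)$ be a complex polynomial with $c\neq 0$ and distinct roots $e_1,\dots,e_{2g+2}$; put $g(z)=c\prod_{k=1}^{2g+2}(1-e_kz)$. Let $X$ be the hyperelliptic curve obtained by gluing the affine curves $C_0=\{y^2=f(x)\}$ and $C_0'=\{w^2=g(z)\}$ in $\mathbb C^2$ along $(x,y)\mapsto(z,w)=(1/x,\,y/x^{g+1})$ (for $x\ne 0$), with its structure of Riemann surface, and let $P_k\in X$ be the Weierstrass point $(x,y)=(e_k,0)$, $1\le k\le 2g+2$. For $B=(b_{ij})\in M_n(\mathbb C)$ put $$\mathfrak p(B)(x,y)=\sum_{i,j=1}^{n}b_{ij}x^{i-1}y^{j-1},\qquad \widetilde{\mathfrak p(B)}(x,y)=(xy)^{n-1}\,\mathfrak p(B)(x^{-1},y^{-1}).$$ Let $H\in M_g(\mathbb C)$ be a positive definite Hermitian matrix and $\sigma_H=\mathfrak p(H)$. The canonical metric on $X$ is $$ds_H^2=\frac{\sigma_H(x,\bar x)}{|y|^2}\,dx\otimes d\bar x\ \text{ on } C_0,\qquad ds_H^2=\frac{\widetilde\sigma_H(z,\bar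 z)}{|w|^2}\,dz\otimes d\bar z\ \text{ on } C_0'.$$ Let $\Delta_H$ be its Laplace operator and $dA_H$ its area measure: if $ds_H^2=\rho\,d\zeta\otimes d\bar\zeta$ in a holomorphic coordinate $\zeta=\xi+i\eta$, then $\Delta_H=\frac{4}{\rho}\frac{\partial^2}{\partial\zeta\,\partial\bar\zeta}$ and $dA_H=\rho\,d\xi\,d\eta$. **Theorem.** Let $A\in M_{g+2}(\mathbb C)$ be a positive definite Hermitian matrix such that $u=\mathfrak p(A)$ satisfies $$u\,u_{xy}-u_x\,u_y=\sigma_H\,u\quad\text{in }\mathbb C[x,y].$$ Then $u(x,\bar x)$ and $\widetilde u(z,\bar z)$ do not vanish on $C_0$ and $C_0'$ respectively, and $$\varphi=\begin{cases}\dfrac{4|f(x)|}{u(x,\bar x)}&\text{on }C_0,\\[2ex]\dfrac{4|g(z)|}{\widetilde u(z,\bar z)}&\text{on }C_0'\end{cases}$$ is a well-defined, smooth, nonnegative real function on $X$ whose zero set is exactly $\{P_1,\dots,P_{2g+2}\}$. Moreover $\psi=\log\varphi$ is smooth on $X\setminus\{P_1,\dots,P_{2g+2}\}$, satisfies $\Delta_H\psi+e^{\psi}=0$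 pointwise there, and solves $$\Delta_H\psi+e^{\psi}=4\pi\sum_{k=1}^{2g+2}\delta_{P_k}$$ on $X$ in the sense of distributions: $\psi$ is integrable with respect to $dA_H$, and for every $\eta\in C^\infty(X,\mathbb C)$ the functions $\psi\,\Delta_H\eta$ and $e^\psi\eta$ are integrable and $$\int_X\psi\,\Delta_H\eta\,dA_H+\int_X e^{\psi}\eta\,dA_H=4\pi\sum_{k=1}^{2g+2}\eta(P_k).$$ -/

import Mathlib

open scoped Manifold ContDiff ComplexConjugate ComplexOrder Polynomial Topology

noncomputable section

namespace MeanField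

/-! ### Polynomials in two variables attached to matrices -/

/-- The polynomial `p(A)(x, y) = ∑ a_{i+1,j+1} x^i y^j` in `ℂ[x, y]` of an `n × n` matrix `A`
(rows and columns are indexed from `0` by `Fin n`). -/
def matPoly {n : ℕ} (A : Matrix (Fin n) (Fin n) ℂ) : MvPolynomial (Fin 2) ℂ :=
  ∑ i : Fin n, ∑ j : Fin n,
    MvPolynomial.C (A i j) * MvPolynomial.X 0 ^ (i : ℕ) * MvPolynomial.X 1 ^ (j : ℕ)

/-- The reversed polynomial `(x y)^(n-1) p(A)(1/x, 1/y) = ∑ a_{i+1,j+1} x^(n-1-i) y^(n-1-j)`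
of an `n × n` matrix `A`. -/
def matPolyRev {n : ℕ} (A : Matrix (Fin n) (Fin n) ℂ) : MvPolynomial (Fin 2) ℂ :=
  ∑ i : Fin n, ∑ j : Fin n,
    MvPolynomial.C (A i j) * MvPolynomial.X 0 ^ (n - 1 - (i : ℕ)) *
      MvPolynomial.X 1 ^ (n - 1 - (j : ℕ))

/-- The value `q(x, x̄)` of a polynomial `q ∈ ℂ[x, y]`. -/
def evalConj (q : MvPolynomial (Fin 2) ℂ) (x : ℂ) : ℂ :=
  MvPolynomial.eval ![x, conj x] q

/-- `u` solves `u u_{xy} - u_x u_y = σ u` in `ℂ[x, y]`. -/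
def SolvesPDE (σ u : MvPolynomial (Fin 2) ℂ) : Prop :=
  u * MvPolynomial.pderiv 0 (MvPolynomial.pderiv 1 u)
    - MvPolynomial.pderiv 0 u * MvPolynomial.pderiv 1 u = σ * u

/-! ### Smooth affine plane curves `y ^ 2 = F x` -/

/-- The affine plane curve `y ^ 2 = F x` in `ℂ²`, with the subspace topology. -/
abbrev AffineCurve (F : ℂ[X]) : Type := {p : ℂ × ℂ // p.2 ^ 2 = F.eval p.1}

namespace AffineCurve

variable {F : ℂ[X]}

theorem sqrt_mul_sq {y a : ℂ} (hy : y ≠ 0) : (y * (a / y ^ 2) ^ ((2 : ℂ)⁻¹)) ^ 2 = a := by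
  have h : ((a / y ^ 2) ^ ((2 : ℂ)⁻¹)) ^ 2 = a / y ^ 2 := by
    exact Complex.cpow_nat_inv_pow (a / y ^ 2) (n := 2) two_ne_zero
  rw [mul_pow, h]
  field_simp

/-- The coordinate `x` near a point `p = (x₀, y₀)` with `y₀ ≠ 0`: it is defined on
`{(x, y) | Re (y / y₀) > 0}`, and its inverse is `x ↦ (x, y₀ √(F x / y₀ ^ 2))`. -/
def xChart (p : AffineCurve F) (hp : p.1.2 ≠ 0) : OpenPartialHomeomorph (AffineCurve F) ℂ where
  toFun q := q.1.1
  invFun x := ⟨(x, p.1.2 * (F.eval x / p.1.2 ^ 2) ^ ((2 : ℂ)⁻¹)), sqrt_mul_sq hp⟩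
  source := {q | 0 < (q.1.2 / p.1.2).re}
  target := {x | F.eval x / p.1.2 ^ 2 ∈ Complex.slitPlane}
  map_source' := by
    rintro ⟨⟨x, y⟩, hq⟩ h
    simp only [Set.mem_ofPred_eq] at h hq ⊢
    rw [← hq, ← div_pow, Complex.mem_slitPlane_iff]
    by_cases hi : (y / p.1.2).im = 0
    · left
      simp [pow_two, hi, h]
    · right
      rw [pow_two, Complex.mul_im]
      have := mul_ne_zero h.ne' hi
      intro h0
      apply this
      linarith
  map_target' := by
    intro x h
    simp only [Set.mem_ofPred_eq] at h ⊢
    rw [mul_div_cancel_left₀ _ hp]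
    have h0 := Complex.slitPlane_ne_zero h
    rw [Complex.cpow_def_of_ne_zero h0, Complex.exp_re]
    refine mul_pos (Real.exp_pos _) (Real.cos_pos_of_mem_Ioo ?_)
    have h1 := Complex.mem_slitPlane_iff_arg.1 h
    have h2 := Complex.neg_pi_lt_arg (F.eval x / p.1.2 ^ 2)
    have h3 := lt_of_le_of_ne (Complex.arg_le_pi (F.eval x / p.1.2 ^ 2)) h1.1
    have h4 : (Complex.log (F.eval x / p.1.2 ^ 2) * (2 : ℂ)⁻¹).im
        = Complex.arg (F.eval x / p.1.2 ^ 2) / 2 := by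
      have : (2 : ℂ)⁻¹ = ((2⁻¹ : ℝ) : ℂ) := by push_cast; rfl
      rw [this, Complex.im_mul_ofReal, Complex.log_im]
      ring
    rw [h4]
    constructor <;> linarith
  left_inv' := by
    rintro ⟨⟨x, y⟩, hq⟩ h
    simp only [Set.mem_ofPred_eq] at h hq
    refine Subtype.ext (Prod.ext rfl ?_)
    simp only
    rw [← hq, ← div_pow]
    have h5 : ((y / p.1.2) ^ 2) ^ ((2 : ℂ)⁻¹) = y / p.1.2 := by
      have := Complex.pow_cpow_nat_inv (x := y / p.1.2) (n := 2) two_ne_zero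
        (by
          have := (abs_lt.1 (Complex.abs_arg_lt_pi_div_two_iff.2 (Or.inl h))).1
          push_cast; linarith)
        (by
          have := (abs_lt.1 (Complex.abs_arg_lt_pi_div_two_iff.2 (Or.inl h))).2
          push_cast; linarith)
      simpa using this
    rw [h5]
    field_simp
  right_inv' := by
    intro x _
    rfl
  open_source := by
    refine isOpen_lt continuous_const (Complex.continuous_re.comp ?_)
    fun_prop
  open_target := by
    refine Complex.isOpen_slitPlane.preimage (f := fun x : ℂ => F.eval x / p.1.2 ^ 2) ?_
    fun_prop
  continuousOn_toFun := by fun_prop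
  continuousOn_invFun := by
    refine Topology.IsInducing.subtypeVal.continuousOn_iff.2 ?_
    refine continuousOn_id.prodMk (continuousOn_const.mul ?_)
    refine ContinuousOn.cpow ?_ continuousOn_const (fun x hx => hx)
    fun_prop

/-- A local inverse of `F` at a point `x₀` with `F' x₀ ≠ 0`, on a neighbourhood of `x₀` on which
`F'` does not vanish. -/
def localHomeo (F : ℂ[X]) (x₀ : ℂ) (h : F.derivative.eval x₀ ≠ 0) :
    OpenPartialHomeomorph ℂ ℂ :=
  (((F.hasStrictDerivAt x₀).hasStrictFDerivAt_equiv h).toOpenPartialHomeomorph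
    (fun x => F.eval x)).restrOpen {x | F.derivative.eval x ≠ 0}
      (isOpen_ne_fun (by fun_prop) continuous_const)

theorem localHomeo_coe (x₀ : ℂ) (h : F.derivative.eval x₀ ≠ 0) :
    (localHomeo F x₀ h : ℂ → ℂ) = fun x => F.eval x := rfl

theorem eval_localHomeo_symm (x₀ : ℂ) (h : F.derivative.eval x₀ ≠ 0) {a : ℂ}
    (ha : a ∈ (localHomeo F x₀ h).target) : F.eval ((localHomeo F x₀ h).symm a) = a :=
  (localHomeo F x₀ h).right_inv ha

theorem mem_localHomeo_source (x₀ : ℂ) (h : F.derivative.eval x₀ ≠ 0) :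
    x₀ ∈ (localHomeo F x₀ h).source :=
  ⟨((F.hasStrictDerivAt x₀).hasStrictFDerivAt_equiv h).mem_toOpenPartialHomeomorph_source, h⟩

theorem localHomeo_source_subset (x₀ : ℂ) (h : F.derivative.eval x₀ ≠ 0) :
    (localHomeo F x₀ h).source ⊆ {x | F.derivative.eval x ≠ 0} :=
  fun _ hx => hx.2

open Classical in
/-- The coordinate `y` near a point `p = (x₀, y₀)` with `F' x₀ ≠ 0`; its inverse is
`y ↦ (F⁻¹ (y ^ 2), y)`, where `F⁻¹` is a local inverse of `F` at `x₀`. -/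
def yChart (p : AffineCurve F) (hp : F.derivative.eval p.1.1 ≠ 0) :
    OpenPartialHomeomorph (AffineCurve F) ℂ where
  toFun q := q.1.2
  invFun y :=
    if h : y ^ 2 ∈ (localHomeo F p.1.1 hp).target then
      ⟨((localHomeo F p.1.1 hp).symm (y ^ 2), y), (eval_localHomeo_symm _ hp h).symm⟩
    else p
  source := {q | q.1.1 ∈ (localHomeo F p.1.1 hp).source}
  target := {y | y ^ 2 ∈ (localHomeo F p.1.1 hp).target}
  map_source' := by
    rintro ⟨⟨x, y⟩, hq⟩ h
    simp only [Set.mem_ofPred_eq] at h hq ⊢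
    rw [hq]
    exact (localHomeo F p.1.1 hp).map_source h
  map_target' := by
    intro y h
    simp only [Set.mem_ofPred_eq] at h ⊢
    rw [dif_pos h]
    exact (localHomeo F p.1.1 hp).map_target h
  left_inv' := by
    rintro ⟨⟨x, y⟩, hq⟩ h
    simp only [Set.mem_ofPred_eq] at h hq
    have h1 : y ^ 2 ∈ (localHomeo F p.1.1 hp).target := by
      rw [hq]
      exact (localHomeo F p.1.1 hp).map_source h
    simp only [dif_pos h1]
    refine Subtype.ext (Prod.ext ?_ rfl)
    simp only [hq]
    exact (localHomeo F p.1.1 hp).left_inv h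
  right_inv' := by
    intro y h
    simp only [Set.mem_ofPred_eq] at h
    simp only [dif_pos h]
  open_source := (localHomeo F p.1.1 hp).open_source.preimage
    (f := fun q : AffineCurve F => q.1.1) (by fun_prop)
  open_target := (localHomeo F p.1.1 hp).open_target.preimage
    (f := fun y : ℂ => y ^ 2) (by fun_prop)
  continuousOn_toFun := by fun_prop
  continuousOn_invFun := by
    refine Topology.IsInducing.subtypeVal.continuousOn_iff.2 ?_
    have h1 : ContinuousOn (fun y : ℂ => ((localHomeo F p.1.1 hp).symm (y ^ 2), y))
        {y | y ^ 2 ∈ (localHomeo F p.1.1 hp).target} :=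
      (ContinuousOn.comp (g := (localHomeo F p.1.1 hp).symm) (f := fun y : ℂ => y ^ 2)
        (localHomeo F p.1.1 hp).continuousOn_symm (by fun_prop) (fun y hy => hy)).prodMk
        continuousOn_id
    refine h1.congr ?_
    intro y hy
    simp only [Set.mem_ofPred_eq] at hy
    simp only [Function.comp, dif_pos hy]

/-- The polynomial `F` has only simple zeros, i.e. the curve `y ^ 2 = F x` is smooth. -/
def IsSmooth (F : ℂ[X]) : Prop := ∀ x, F.eval x = 0 → F.derivative.eval x ≠ 0

theorem IsSmooth.deriv_ne_zero (hF : IsSmooth F) (p : AffineCurve F) (hp : p.1.2 = 0) :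
    F.derivative.eval p.1.1 ≠ 0 :=
  hF _ (by rw [← p.2, hp]; simp)

open Classical in
/-- The preferred holomorphic coordinate of a smooth curve `y ^ 2 = F x` at `p`: the function `x`
if `y ≠ 0` at `p`, and the function `y` otherwise. -/
def chart (hF : IsSmooth F) (p : AffineCurve F) : OpenPartialHomeomorph (AffineCurve F) ℂ :=
  if h : p.1.2 = 0 then yChart p (hF.deriv_ne_zero p h) else xChart p h

theorem mem_chart_source (hF : IsSmooth F) (p : AffineCurve F) : p ∈ (chart hF p).source := by
  unfold chart
  split_ifs with h
  · exact mem_localHomeo_source _ _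
  · change 0 < (p.1.2 / p.1.2).re
    rw [div_self h]
    simp

theorem chart_coe (hF : IsSmooth F) (p : AffineCurve F) :
    (chart hF p : AffineCurve F → ℂ) = (fun q => q.1.1) ∨
      (chart hF p : AffineCurve F → ℂ) = (fun q => q.1.2) := by
  unfold chart
  split_ifs with h
  · exact Or.inr rfl
  · exact Or.inl rfl

theorem contDiffOn_chart_symm (hF : IsSmooth F) (p : AffineCurve F) :
    ContDiffOn ℂ ω (fun t => ((chart hF p).symm t).1) (chart hF p).target := by
  unfold chart
  split_ifs with h
  · have h1 : ContDiffOn ℂ ω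
        (fun y : ℂ => ((localHomeo F p.1.1 (hF.deriv_ne_zero p h)).symm (y ^ 2), y))
        {y | y ^ 2 ∈ (localHomeo F p.1.1 (hF.deriv_ne_zero p h)).target} := by
      refine ContDiffOn.prodMk ?_ contDiffOn_id
      have h2 : ContDiffOn ℂ ω (localHomeo F p.1.1 (hF.deriv_ne_zero p h)).symm
          (localHomeo F p.1.1 (hF.deriv_ne_zero p h)).target := by
        intro a ha
        refine ContDiffAt.contDiffWithinAt ?_
        have h3 := localHomeo_source_subset _ _
          ((localHomeo F p.1.1 (hF.deriv_ne_zero p h)).map_target ha)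
        exact OpenPartialHomeomorph.contDiffAt_symm_deriv _ h3 ha (F.hasDerivAt _)
          F.differentiable.contDiff.contDiffAt
      exact h2.comp (by fun_prop) (fun y hy => hy)
    refine h1.congr ?_
    intro y hy
    exact congrArg Subtype.val (dif_pos hy)
  · change ContDiffOn ℂ ω (fun x => (x, p.1.2 * (F.eval x / p.1.2 ^ 2) ^ ((2 : ℂ)⁻¹)))
      {x | F.eval x / p.1.2 ^ 2 ∈ Complex.slitPlane}
    refine contDiffOn_id.prodMk (contDiffOn_const.mul ?_)
    intro x hx
    have hF' : AnalyticAt ℂ (fun x => F.eval x / p.1.2 ^ 2) x :=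
      (F.differentiable.analyticAt x).div_const
    exact (hF'.cpow analyticAt_const hx).contDiffAt.contDiffWithinAt

end AffineCurve

/-! ### The hyperelliptic curve -/

/-- The data of a hyperelliptic equation `y ^ 2 = f x`, where
`f x = c ∏ (x - e_k)` is a polynomial of degree `2g + 2` with distinct roots `e_k`. -/
structure HyperellipticData (g : ℕ) where
  /-- the leading coefficient `c` -/
  lead : ℂ
  lead_ne_zero : lead ≠ 0
  /-- the roots `e_1, …, e_{2g+2}` -/
  root : Fin (2 * g + 2) → ℂ
  root_injective : Function.Injective root

namespace HyperellipticData

variable {g : ℕ} (D : HyperellipticData g)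

/-- The polynomial `f x = c ∏ (x - e_k)`. -/
def f : ℂ[X] := Polynomial.C D.lead * ∏ k, (Polynomial.X - Polynomial.C (D.root k))

/-- The polynomial `g z = c ∏ (1 - e_k z)` of the second affine curve. -/
def gPoly : ℂ[X] := Polynomial.C D.lead * ∏ k, (1 - Polynomial.C (D.root k) * Polynomial.X)

theorem isSmooth_of_separable {F : ℂ[X]} (h : F.Separable) : AffineCurve.IsSmooth F := by
  intro x hx
  simpa using h.aeval_derivative_ne_zero (x := x) (by simpa using hx)

theorem isSmooth_f : AffineCurve.IsSmooth D.f := by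
  refine isSmooth_of_separable (Polynomial.Separable.unit_mul
    (Polynomial.isUnit_C.2 (isUnit_iff_ne_zero.2 D.lead_ne_zero)) ?_)
  exact Polynomial.separable_prod_X_sub_C_iff.2 D.root_injective

theorem isSmooth_gPoly : AffineCurve.IsSmooth D.gPoly := by
  refine isSmooth_of_separable (Polynomial.Separable.unit_mul
    (Polynomial.isUnit_C.2 (isUnit_iff_ne_zero.2 D.lead_ne_zero)) ?_)
  refine Polynomial.separable_prod ?_ ?_
  · intro i j hij
    have hne : D.root j - D.root i ≠ 0 := sub_ne_zero.2 (fun h => hij (D.root_injective h).symm)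
    refine ⟨Polynomial.C (D.root j / (D.root j - D.root i)),
      -Polynomial.C (D.root i / (D.root j - D.root i)), ?_⟩
    have h1 : Polynomial.C (D.root j / (D.root j - D.root i))
        - Polynomial.C (D.root i / (D.root j - D.root i)) = (1 : ℂ[X]) := by
      rw [← Polynomial.C_sub, ← sub_div, div_self hne, Polynomial.C_1]
    have h2 : Polynomial.C (D.root j / (D.root j - D.root i)) * Polynomial.C (D.root i)
        = Polynomial.C (D.root i / (D.root j - D.root i)) * Polynomial.C (D.root j) := by
      rw [← Polynomial.C_mul, ← Polynomial.C_mul]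
      congr 1
      ring
    linear_combination h1 - Polynomial.X * h2
  · intro i
    refine ⟨1, -Polynomial.X, ?_⟩
    simp

/-- The affine curve `C₀ : y ^ 2 = f x`. -/
abbrev C₀ : Type := AffineCurve D.f

/-- The affine curve `C₀' : w ^ 2 = g z`. -/
abbrev C₁ : Type := AffineCurve D.gPoly

/-- The gluing relation on `C₀ ⊔ C₀'`: a point `(x, y)` of `C₀` with `x ≠ 0` is identified with
the point `(1 / x, y / x ^ (g + 1))` of `C₀'`. -/
def Glue : D.C₀ ⊕ D.C₁ → D.C₀ ⊕ D.C₁ → Prop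
  | .inl p, .inl p' => p = p'
  | .inl p, .inr q => p.1.1 ≠ 0 ∧ q.1 = (1 / p.1.1, p.1.2 / p.1.1 ^ (g + 1))
  | .inr q, .inl p => p.1.1 ≠ 0 ∧ q.1 = (1 / p.1.1, p.1.2 / p.1.1 ^ (g + 1))
  | .inr q, .inr q' => q = q'

theorem flip_pair {n : ℕ} {a b c d : ℂ} (h : a ≠ 0 ∧ (c, d) = (1 / a, b / a ^ n)) :
    c ≠ 0 ∧ (a, b) = (1 / c, d / c ^ n) := by
  obtain ⟨ha, hc⟩ := h
  obtain ⟨rfl, rfl⟩ := Prod.mk.inj hc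
  refine ⟨one_div_ne_zero ha, Prod.ext ?_ ?_⟩
  · simp
  · simp only [div_pow, one_pow]
    field_simp

theorem glue_equivalence : Equivalence D.Glue where
  refl := by
    rintro (p | q) <;> rfl
  symm := by
    rintro (p | q) (p' | q') h
    · exact Eq.symm h
    · exact h
    · exact h
    · exact Eq.symm h
  trans := by
    rintro (p | q) (p' | q') (p'' | q'') h h'
    · exact Eq.trans h h'
    · cases (show p = p' from h); exact h'
    · refine Subtype.ext ?_
      exact (flip_pair h).2.trans (flip_pair h').2.symm
    · cases (show q' = q'' from h'); exact h
    · cases (show p' = p'' from h'); exact h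
    · exact Subtype.ext (h.2.trans h'.2.symm)
    · cases (show q = q' from h); exact h'
    · exact Eq.trans h h'

/-- The gluing relation as a setoid. -/
def glueSetoid : Setoid (D.C₀ ⊕ D.C₁) := ⟨D.Glue, D.glue_equivalence⟩

/-- The hyperelliptic curve `X = C₀ ∪ C₀'`, glued along `(x, y) ↦ (1 / x, y / x ^ (g + 1))`. -/
def Curve : Type := Quotient D.glueSetoid

instance : TopologicalSpace D.Curve :=
  inferInstanceAs (TopologicalSpace (Quotient D.glueSetoid))

instance : MeasurableSpace D.Curve := borel _

instance : BorelSpace D.Curve := ⟨rfl⟩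

/-- The inclusion `C₀ → X`. -/
def ι₀ (p : D.C₀) : D.Curve := Quotient.mk D.glueSetoid (.inl p)

/-- The inclusion `C₀' → X`. -/
def ι₁ (q : D.C₁) : D.Curve := Quotient.mk D.glueSetoid (.inr q)

theorem ι₀_injective : Function.Injective D.ι₀ := fun _ _ h => Quotient.exact h

theorem ι₁_injective : Function.Injective D.ι₁ := fun _ _ h => Quotient.exact h

theorem ι₀_eq_ι₁ {p : D.C₀} {q : D.C₁} :
    D.ι₀ p = D.ι₁ q ↔ p.1.1 ≠ 0 ∧ q.1 = (1 / p.1.1, p.1.2 / p.1.1 ^ (g + 1)) :=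
  Quotient.eq (r := D.glueSetoid)

theorem ι₀_eq_ι₁' {p : D.C₀} {q : D.C₁} :
    D.ι₀ p = D.ι₁ q ↔ q.1.1 ≠ 0 ∧ p.1 = (1 / q.1.1, q.1.2 / q.1.1 ^ (g + 1)) :=
  D.ι₀_eq_ι₁.trans ⟨fun h => flip_pair h, fun h => flip_pair h⟩

theorem ι_surjective (P : D.Curve) : (∃ p, D.ι₀ p = P) ∨ ∃ q, D.ι₁ q = P := by
  induction P using Quotient.inductionOn with
  | h a => cases a with
    | inl p => exact Or.inl ⟨p, rfl⟩
    | inr q => exact Or.inr ⟨q, rfl⟩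

theorem continuous_ι₀ : Continuous D.ι₀ := continuous_quotient_mk'.comp continuous_inl

theorem continuous_ι₁ : Continuous D.ι₁ := continuous_quotient_mk'.comp continuous_inr

theorem eval_gPoly {x : ℂ} (hx : x ≠ 0) :
    D.gPoly.eval (1 / x) = D.f.eval x / x ^ (2 * g + 2) := by
  have h : ∀ k, 1 - D.root k * (1 / x) = (x - D.root k) / x := fun k => by field_simp
  simp [f, gPoly, Polynomial.eval_prod, -one_div, h, Finset.prod_div_distrib, mul_div_assoc]

theorem flip_mem₀ {x y : ℂ} (hx : x ≠ 0) (h : y ^ 2 = D.f.eval x) :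
    (y / x ^ (g + 1)) ^ 2 = D.gPoly.eval (1 / x) := by
  rw [D.eval_gPoly hx, ← h, div_pow]
  ring

theorem flip_mem₁ {z w : ℂ} (hz : z ≠ 0) (h : w ^ 2 = D.gPoly.eval z) :
    (w / z ^ (g + 1)) ^ 2 = D.f.eval (1 / z) := by
  have h1 := D.eval_gPoly (one_div_ne_zero hz)
  rw [one_div_one_div, ← h] at h1
  rw [div_pow, h1, one_div_pow, ← pow_mul]
  field_simp
  ring

theorem isOpen_flip {F G : ℂ[X]} {n : ℕ} (h : ∀ q : AffineCurve G, q.1.1 ≠ 0 →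
      (q.1.2 / q.1.1 ^ n) ^ 2 = F.eval (1 / q.1.1)) {U : Set (AffineCurve F)} (hU : IsOpen U) :
    IsOpen {q : AffineCurve G | ∃ p ∈ U, q.1.1 ≠ 0 ∧ p.1 = (1 / q.1.1, q.1.2 / q.1.1 ^ n)} := by
  obtain ⟨V, hV, rfl⟩ := isOpen_induced_iff.1 hU
  have ho : IsOpen {q : AffineCurve G | q.1.1 ≠ 0} := isOpen_ne_fun (by fun_prop) continuous_const
  have hc : ContinuousOn (fun q : AffineCurve G => (1 / q.1.1, q.1.2 / q.1.1 ^ n))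
      {q | q.1.1 ≠ 0} := by
    refine ContinuousOn.prodMk ?_ ?_
    · exact continuousOn_const.div (by fun_prop) (fun q hq => hq)
    · exact ContinuousOn.div (by fun_prop) (by fun_prop) (fun q hq => pow_ne_zero n hq)
  convert hc.isOpen_inter_preimage ho hV using 1
  ext q
  constructor
  · rintro ⟨p, hp, hq, hpq⟩
    refine ⟨hq, ?_⟩
    have hp' : p.1 ∈ V := hp
    rw [hpq] at hp'
    exact hp'
  · rintro ⟨hq, hm⟩
    exact ⟨⟨_, h q hq⟩, hm, hq, rfl⟩

theorem isOpenEmbedding_ι₀ : Topology.IsOpenEmbedding D.ι₀ := by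
  refine .of_continuous_injective_isOpenMap D.continuous_ι₀ D.ι₀_injective ?_
  intro U hU
  refine isOpen_coinduced.2 (isOpen_sum_iff.2 ⟨?_, ?_⟩)
  · convert hU using 1
    exact Set.preimage_image_eq U D.ι₀_injective
  · convert isOpen_flip (n := g + 1) (fun q hq => D.flip_mem₁ hq q.2) hU using 1
    ext q
    exact exists_congr fun p => and_congr_right fun _ => D.ι₀_eq_ι₁'

theorem isOpenEmbedding_ι₁ : Topology.IsOpenEmbedding D.ι₁ := by
  refine .of_continuous_injective_isOpenMap D.continuous_ι₁ D.ι₁_injective ?_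
  intro U hU
  refine isOpen_coinduced.2 (isOpen_sum_iff.2 ⟨?_, ?_⟩)
  · convert isOpen_flip (n := g + 1) (fun p hp => D.flip_mem₀ hp p.2) hU using 1
    ext p
    exact exists_congr fun q => and_congr_right fun _ => eq_comm.trans D.ι₀_eq_ι₁
  · convert hU using 1
    exact Set.preimage_image_eq U D.ι₁_injective

/-- The holomorphic coordinate of `X` at a point of `C₀` (the function `x` or `y`). -/
def chart₀ (p : D.C₀) : OpenPartialHomeomorph D.Curve ℂ :=
  (AffineCurve.chart D.isSmooth_f p).lift_openEmbedding D.isOpenEmbedding_ι₀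

/-- The holomorphic coordinate of `X` at a point of `C₀'` (the function `z` or `w`). -/
def chart₁ (q : D.C₁) : OpenPartialHomeomorph D.Curve ℂ :=
  (AffineCurve.chart D.isSmooth_gPoly q).lift_openEmbedding D.isOpenEmbedding_ι₁

open Classical in
/-- A representative of a point of `X` in `C₀`, or in `C₀'` if the point is not in `C₀`. -/
def rep (P : D.Curve) : D.C₀ ⊕ D.C₁ :=
  if h : ∃ p, D.ι₀ p = P then .inl h.choose else .inr ((D.ι_surjective P).resolve_left h).choose

theorem mk_rep (P : D.Curve) : Sum.elim D.ι₀ D.ι₁ (D.rep P) = P := by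
  unfold rep
  split_ifs with h
  · exact h.choose_spec
  · exact ((D.ι_surjective P).resolve_left h).choose_spec

theorem rep_ι₀ (p : D.C₀) : D.rep (D.ι₀ p) = .inl p := by
  have h : ∃ p', D.ι₀ p' = D.ι₀ p := ⟨p, rfl⟩
  unfold rep
  rw [dif_pos h]
  exact congrArg _ (D.ι₀_injective h.choose_spec)

/-- The atlas of holomorphic coordinates of `X`. -/
instance : ChartedSpace ℂ D.Curve where
  atlas := Set.range D.chart₀ ∪ Set.range D.chart₁
  chartAt P := Sum.elim D.chart₀ D.chart₁ (D.rep P)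
  mem_chart_source P := by
    have h := D.mk_rep P
    rcases hr : D.rep P with p | q
    · rw [hr] at h
      exact ⟨p, AffineCurve.mem_chart_source _ p, h⟩
    · rw [hr] at h
      exact ⟨q, AffineCurve.mem_chart_source _ q, h⟩
  chart_mem_atlas P := by
    rcases D.rep P with p | q
    · exact Or.inl ⟨p, rfl⟩
    · exact Or.inr ⟨q, rfl⟩

theorem chartAt_ι₀ (p : D.C₀) : chartAt ℂ (D.ι₀ p) = D.chart₀ p := by
  change Sum.elim D.chart₀ D.chart₁ (D.rep (D.ι₀ p)) = _
  rw [D.rep_ι₀]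
  rfl

theorem contDiffOn_coord {F : ℂ[X]} (hF : AffineCurve.IsSmooth F) {c : ℂ → ℂ × ℂ} {s : Set ℂ}
    (hc : ContDiffOn ℂ ω c s) (p : AffineCurve F) {e : AffineCurve F → ℂ}
    (he : e = AffineCurve.chart hF p) {d : ℂ → ℂ}
    (hd : ∀ t ∈ s, ∃ q : AffineCurve F, q.1 = c t ∧ d t = e q) : ContDiffOn ℂ ω d s := by
  subst he
  rcases AffineCurve.chart_coe hF p with h | h
  · refine (contDiff_fst.comp_contDiffOn hc).congr fun t ht => ?_
    obtain ⟨q, hq, hdq⟩ := hd t ht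
    rw [hdq, h, Function.comp, ← hq]
  · refine (contDiff_snd.comp_contDiffOn hc).congr fun t ht => ?_
    obtain ⟨q, hq, hdq⟩ := hd t ht
    rw [hdq, h, Function.comp, ← hq]

theorem contDiffOn_flip {n : ℕ} {c : ℂ → ℂ × ℂ} {s : Set ℂ} (hc : ContDiffOn ℂ ω c s)
    (h : ∀ t ∈ s, (c t).1 ≠ 0) :
    ContDiffOn ℂ ω (fun t => (1 / (c t).1, (c t).2 / (c t).1 ^ n)) s := by
  have h1 := contDiff_fst.comp_contDiffOn hc
  have h2 := contDiff_snd.comp_contDiffOn hc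
  exact (contDiffOn_const.div h1 h).prodMk (h2.div (h1.pow n) fun t ht => pow_ne_zero n (h t ht))

theorem mem_transition {e e' : OpenPartialHomeomorph D.Curve ℂ} {t : ℂ}
    (h : t ∈ (e.symm ≫ₕ e').source) : t ∈ e.target ∧ e.symm t ∈ e'.source := by
  simpa using h

/-- The coordinate changes are holomorphic, i.e. `X` is a Riemann surface. -/
instance isManifold : IsManifold 𝓘(ℂ, ℂ) ω D.Curve := by
  refine isManifold_of_contDiffOn _ _ _ ?_
  rintro e e' (⟨p, rfl⟩ | ⟨p, rfl⟩) (⟨p', rfl⟩ | ⟨p', rfl⟩) <;>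
    simp only [modelWithCornersSelf_coe, modelWithCornersSelf_coe_symm, Function.comp_id,
      Function.id_comp, Set.preimage_id, Set.range_id, Set.inter_univ]
  · refine contDiffOn_coord D.isSmooth_f ((AffineCurve.contDiffOn_chart_symm D.isSmooth_f p).mono
      fun t ht => (D.mem_transition ht).1) p' rfl ?_
    intro t ht
    exact ⟨_, rfl, OpenPartialHomeomorph.lift_openEmbedding_apply _ D.isOpenEmbedding_ι₀⟩
  · have key : ∀ t ∈ ((D.chart₀ p).symm ≫ₕ D.chart₁ p').source, ∃ q : D.C₁,
        D.ι₀ ((AffineCurve.chart D.isSmooth_f p).symm t) = D.ι₁ q := by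
      intro t ht
      obtain ⟨q, -, hq⟩ := (D.mem_transition ht).2
      exact ⟨q, hq.symm⟩
    refine contDiffOn_coord D.isSmooth_gPoly (contDiffOn_flip (n := g + 1)
      ((AffineCurve.contDiffOn_chart_symm D.isSmooth_f p).mono fun t ht => (D.mem_transition ht).1) ?_) p' rfl ?_
    · intro t ht
      obtain ⟨q, hq⟩ := key t ht
      exact (D.ι₀_eq_ι₁.1 hq).1
    · intro t ht
      obtain ⟨q, hq⟩ := key t ht
      refine ⟨q, (D.ι₀_eq_ι₁.1 hq).2, ?_⟩
      change D.chart₁ p' (D.ι₀ ((AffineCurve.chart D.isSmooth_f p).symm t)) = _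
      rw [hq]
      exact OpenPartialHomeomorph.lift_openEmbedding_apply _ D.isOpenEmbedding_ι₁
  · have key : ∀ t ∈ ((D.chart₁ p).symm ≫ₕ D.chart₀ p').source, ∃ q : D.C₀,
        D.ι₀ q = D.ι₁ ((AffineCurve.chart D.isSmooth_gPoly p).symm t) := by
      intro t ht
      obtain ⟨q, -, hq⟩ := (D.mem_transition ht).2
      exact ⟨q, hq⟩
    refine contDiffOn_coord D.isSmooth_f (contDiffOn_flip (n := g + 1)
      ((AffineCurve.contDiffOn_chart_symm D.isSmooth_gPoly p).mono fun t ht => (D.mem_transition ht).1) ?_) p' rfl ?_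
    · intro t ht
      obtain ⟨q, hq⟩ := key t ht
      exact (D.ι₀_eq_ι₁'.1 hq).1
    · intro t ht
      obtain ⟨q, hq⟩ := key t ht
      refine ⟨q, (D.ι₀_eq_ι₁'.1 hq).2, ?_⟩
      change D.chart₀ p' (D.ι₁ ((AffineCurve.chart D.isSmooth_gPoly p).symm t)) = _
      rw [← hq]
      exact OpenPartialHomeomorph.lift_openEmbedding_apply _ D.isOpenEmbedding_ι₀
  · refine contDiffOn_coord D.isSmooth_gPoly
      ((AffineCurve.contDiffOn_chart_symm D.isSmooth_gPoly p).mono fun t ht => (D.mem_transition ht).1) p' rfl ?_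
    intro t ht
    exact ⟨_, rfl, OpenPartialHomeomorph.lift_openEmbedding_apply _ D.isOpenEmbedding_ι₁⟩

/-- The Weierstrass points `P_k`, `(x(P_k), y(P_k)) = (e_k, 0)`. -/
def weierstrassPoint (k : Fin (2 * g + 2)) : D.Curve :=
  D.ι₀ ⟨(D.root k, 0), by
    simp [f, Polynomial.eval_prod, Finset.prod_eq_zero (Finset.mem_univ k)]⟩

/-! ### The canonical metric -/

open Classical in
/-- On a curve `y ^ 2 = F x`, the density `ρ` of the metric `ds² = s(x, x̄) / |y|² dx ⊗ dx̄` with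
respect to the preferred holomorphic coordinate `ζ` at a point, i.e. `ds² = ρ dζ ⊗ dζ̄` there.
Where `y ≠ 0`, `ζ = x`. Where `y = 0`, `ζ = y` and `dx = (2 y / F' x) dy`,
so that `ds² = 4 s(x, x̄) / |F' x|² dy ⊗ dȳ`. -/
def affineDensity (F : ℂ[X]) (s : MvPolynomial (Fin 2) ℂ) (p : AffineCurve F) : ℝ :=
  if p.1.2 = 0 then 4 * (evalConj s p.1.1).re / ‖F.derivative.eval p.1.1‖ ^ 2
  else (evalConj s p.1.1).re / ‖p.1.2‖ ^ 2

/-- The density of the canonical metric `ds_H²`, which is `σ_H(x, x̄) / |y|² dx ⊗ dx̄` on `C₀` and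
`σ̃_H(z, z̄) / |w|² dz ⊗ dz̄` on `C₀'`, with respect to the preferred coordinate at a point. -/
def density (H : Matrix (Fin g) (Fin g) ℂ) (P : D.Curve) : ℝ :=
  Sum.elim (affineDensity D.f (matPoly H)) (affineDensity D.gPoly (matPolyRev H)) (D.rep P)

/-- The Laplace operator `Δ_H` of the canonical metric: if `ds_H² = ρ dζ ⊗ dζ̄` in a holomorphic
coordinate `ζ = ξ + i η`, then `Δ_H = ρ⁻¹ (∂²/∂ξ² + ∂²/∂η²) = (4 / ρ) ∂²/∂ζ∂ζ̄`. -/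
def laplace {V : Type} [NormedAddCommGroup V] [NormedSpace ℝ V]
    (H : Matrix (Fin g) (Fin g) ℂ) (v : D.Curve → V) (P : D.Curve) : V :=
  (D.density H P)⁻¹ • Laplacian.laplacian (v ∘ (chartAt ℂ P).symm) (chartAt ℂ P P)

/-- The branch `x ↦ (x, √(f x))` (principal square root) of the double cover `x : C₀ → ℂ`. -/
def upperSheet (x : ℂ) : D.Curve :=
  D.ι₀ ⟨(x, (D.f.eval x) ^ ((2 : ℂ)⁻¹)),
    Complex.cpow_nat_inv_pow (D.f.eval x) (n := 2) two_ne_zero⟩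

/-- The other branch `x ↦ (x, -√(f x))` of the double cover `x : C₀ → ℂ`. -/
def lowerSheet (x : ℂ) : D.Curve :=
  D.ι₀ ⟨(x, -(D.f.eval x) ^ ((2 : ℂ)⁻¹)), by
    rw [neg_sq]; exact Complex.cpow_nat_inv_pow (D.f.eval x) (n := 2) two_ne_zero⟩

theorem measurable_upperSheet : Measurable D.upperSheet := by
  refine D.continuous_ι₀.measurable.comp (Measurable.subtype_mk ?_)
  exact measurable_id.prodMk (D.f.continuous.measurable.pow_const _)

theorem measurable_lowerSheet : Measurable D.lowerSheet := by
  refine D.continuous_ι₀.measurable.comp (Measurable.subtype_mk ?_)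
  exact measurable_id.prodMk (D.f.continuous.measurable.pow_const _).neg

/-- The area measure of the canonical metric. Outside a finite set (the Weierstrass points and the
points at infinity), `X` is the union of the two sheets of the cover `x : C₀ → ℂ`; on both sheets
`x` is a local coordinate in which the area element is `σ_H(x, x̄) / |f x|` times the
Lebesgue measure. -/
def area (H : Matrix (Fin g) (Fin g) ℂ) : MeasureTheory.Measure D.Curve :=
  let ν : MeasureTheory.Measure ℂ := MeasureTheory.volume.withDensity
    fun x => ENNReal.ofReal ((evalConj (matPoly H) x).re / ‖D.f.eval x‖)
  ν.map D.upperSheet + ν.map D.lowerSheet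

/-- `ψ` solves the mean field equation `Δ_H ψ + e^ψ = 4π ∑ δ_{P_k}` in the sense of distributions:
`ψ` is integrable and
`∫ ψ Δ_H η dA + ∫ e^ψ η dA = 4π ∑ η(P_k)` for all test functions `η ∈ C^∞(X)`. -/
def SolvesMeanField (H : Matrix (Fin g) (Fin g) ℂ) (ψ : D.Curve → ℝ) : Prop :=
  MeasureTheory.Integrable ψ (D.area H) ∧
  ∀ η : D.Curve → ℂ, ContMDiff 𝓘(ℝ, ℂ) 𝓘(ℝ, ℂ) ∞ η →
    MeasureTheory.Integrable (fun P => ψ P • D.laplace H η P) (D.area H) ∧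
    MeasureTheory.Integrable (fun P => Real.exp (ψ P) • η P) (D.area H) ∧
    ∫ P, ψ P • D.laplace H η P ∂(D.area H) + ∫ P, Real.exp (ψ P) • η P ∂(D.area H)
      = 4 * Real.pi * ∑ k, η (D.weierstrassPoint k)

end HyperellipticData

end MeanField

end

/-!
The function `4 |f| / u` is invariant under the hyperelliptic involution, so `ψ = log φ` is
`Ψ(x) = log (4 |f x| / u(x, x̄))` in the coordinate `x`, and the whole theorem lives on the plane.

*Pointwise equation.* Evaluating polynomials at `(x, x̄)` turns the formal derivatives into `∂` and
`∂̄`, and the algebraic equation for `u` says `Δ log u(x, x̄) = 4 σ_H(x, x̄) / u(x, x̄)`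
(`laplacian_log_evalConj`). Since `log |f|` is harmonic away from the branch points, this is
`ΔΨ = -(σ_H / |f|) e^Ψ`, which is the mean field equation because `σ_H / |f|` is the density of the
metric (`laplace_log_phi_add_exp`). The reversed polynomial satisfies the analogous equation by the
substitution `z = 1 / x`, extended to `z = 0` by continuity
(`laplacian_log_evalConj_matPolyRev`). Positive definiteness makes `u(x, x̄)` and
its reversal positive, because `u(x, x̄)` is the value of the Hermitian form `A` at a vector of
powers of `x`. In the coordinate `y` at a Weierstrass point `|f| = |y|²`, so `φ` is smooth there.

*Distributional equation.* Up to a null set `X` is the union of two copies of the plane, each with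
area element `(σ_H / |f|) dx`. On each of them `Δ_H η dA_H = Δη dx`, so with the trace
`N(x) = η(x, y) + η(x, -y)` of a test function `η` (`sheetSum`) the left-hand side becomes
`∫ (Ψ ΔN - N ΔΨ) dx`, the integral over the plane of the divergence of `Ψ ∇N - N ∇Ψ`
(`greenField`). The divergence theorem with cut-off functions (`integral_divergence_eq`) collects
one residue from each root `e` of `f`: there `Ψ = log |x - e| + O(1)`, while `∇N` is at most of size
`|f|^{-1/2}` (`exists_sqrt_mul_norm_fderiv_sheetSum_le`), so the field looks like
`-N(e) ∇ log |x - e|` and contributes `2π N(e) = 4π η(P)`. There is no contribution from infinity: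
`Ψ` is bounded there, and `∇Ψ` and `∇N` are `O(|x|⁻²)`.

The integrals converge because `|f|⁻¹` and `|f|⁻¹ log |f|` are integrable near simple zeros and
`σ_H / |f|` decays like `|x|⁻⁴` (`integrable_log_mul_weight`), and because `Δ_H η` is bounded
(`exists_bound_laplace`): the metric is smooth and nondegenerate on the compact surface `X`.
-/

namespace MeanField

open Laplacian

/-! ### The Laplacian on the complex plane -/

section Laplacian

variable {V : Type*} [NormedAddCommGroup V] [NormedSpace ℝ V]

theorem laplacian_eq_fderiv_fderiv (h : ℂ → V) (x : ℂ) :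
    Δ h x = fderiv ℝ (fderiv ℝ h) x 1 1 + fderiv ℝ (fderiv ℝ h) x Complex.I Complex.I := by
  rw [InnerProductSpace.laplacian_eq_iteratedFDeriv_complexPlane]
  simp [iteratedFDeriv_two_apply]

theorem fderiv_fderiv_apply {h : ℂ → V} {x : ℂ} (hh : ContDiffAt ℝ 2 h x) (v w : ℂ) :
    fderiv ℝ (fun y => fderiv ℝ h y v) x w = fderiv ℝ (fderiv ℝ h) x w v := by
  have h1 : DifferentiableAt ℝ (fderiv ℝ h) x :=
    (hh.fderiv_right (m := 1) (by norm_num)).differentiableAt (by norm_num)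
  rw [fderiv_clm_apply h1 (by fun_prop)]
  simp

theorem laplacian_eq_sum_fderiv {h : ℂ → V} {x : ℂ} (hh : ContDiffAt ℝ 2 h x) :
    Δ h x = fderiv ℝ (fun y => fderiv ℝ h y 1) x 1
      + fderiv ℝ (fun y => fderiv ℝ h y Complex.I) x Complex.I := by
  rw [laplacian_eq_fderiv_fderiv, fderiv_fderiv_apply hh, fderiv_fderiv_apply hh]

theorem continuousAt_laplacian {h : ℂ → V} {x : ℂ} (hh : ContDiffAt ℝ 2 h x) :
    ContinuousAt (Δ h) x := by
  have h2 : ContinuousAt (fderiv ℝ (fderiv ℝ h)) x :=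
    ((hh.fderiv_right (m := 1) (by norm_num)).fderiv_right (m := 0)
      (by norm_num)).continuousAt
  have : Δ h = fun y => fderiv ℝ (fderiv ℝ h) y 1 1
      + fderiv ℝ (fderiv ℝ h) y Complex.I Complex.I :=
    funext fun y => laplacian_eq_fderiv_fderiv h y
  rw [this]
  fun_prop

/-- The chain rule for the differential of a composition with a holomorphic function. -/
theorem fderiv_comp_holomorphic {M : ℂ → V} {a : ℂ → ℂ} {t : ℂ}
    (hM : DifferentiableAt ℝ M (a t)) (ha : DifferentiableAt ℂ a t) (v : ℂ) :
    fderiv ℝ (M ∘ a) t v = fderiv ℝ M (a t) (deriv a t * v) := by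
  rw [fderiv_comp t hM (ha.restrictScalars ℝ), ContinuousLinearMap.comp_apply,
    ha.fderiv_restrictScalars ℝ]
  simp [mul_comm]

theorem norm_fderiv_comp_holomorphic {M : ℂ → V} {a : ℂ → ℂ} {t : ℂ}
    (hM : DifferentiableAt ℝ M (a t)) (ha : DifferentiableAt ℂ a t) :
    ‖fderiv ℝ (M ∘ a) t‖ = ‖deriv a t‖ * ‖fderiv ℝ M (a t)‖ := by
  rcases eq_or_ne (deriv a t) 0 with h0 | h0
  · have : fderiv ℝ (M ∘ a) t = 0 := by
      ext v
      rw [fderiv_comp_holomorphic hM ha]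
      simp [h0]
    simp [this, h0]
  refine le_antisymm (ContinuousLinearMap.opNorm_le_bound _ (by positivity) fun v => ?_) ?_
  · rw [fderiv_comp_holomorphic hM ha]
    refine (ContinuousLinearMap.le_opNorm _ _).trans (le_of_eq ?_)
    rw [norm_mul]
    ring
  · rw [← le_div_iff₀' (norm_pos_iff.2 h0)]
    refine ContinuousLinearMap.opNorm_le_bound _ (by positivity) fun v => ?_
    have := (fderiv ℝ (M ∘ a) t).le_opNorm (v / deriv a t)
    rw [fderiv_comp_holomorphic hM ha, mul_div_cancel₀ _ h0, norm_div] at this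
    refine this.trans (le_of_eq ?_)
    ring

/-- The Laplacian is conformally covariant: for holomorphic `a`,
`Δ (M ∘ a) = |a'|² (Δ M) ∘ a`. -/
theorem laplacian_comp_holomorphic {M : ℂ → V} {a : ℂ → ℂ} {t : ℂ}
    (hM : ContDiffAt ℝ 2 M (a t)) (ha : AnalyticAt ℂ a t) :
    Δ (M ∘ a) t = ‖deriv a t‖ ^ 2 • Δ M (a t) := by
  have hMc : ContDiffAt ℝ 2 (M ∘ a) t :=
    hM.comp t (ha.contDiffAt.restrict_scalars ℝ)
  have hev : ∀ᶠ s in 𝓝 t, ∀ v, fderiv ℝ (M ∘ a) s v = fderiv ℝ M (a s) (deriv a s * v) := by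
    filter_upwards [ha.eventually_analyticAt,
      ha.continuousAt.eventually (hM.eventually (by simp))] with s hs hs' v
    exact fderiv_comp_holomorphic (hs'.differentiableAt (by norm_num)) hs.differentiableAt v
  have hD : DifferentiableAt ℝ (fderiv ℝ M) (a t) :=
    (hM.fderiv_right (m := 1) (by norm_num)).differentiableAt (by norm_num)
  have hD' : DifferentiableAt ℝ (fun s => fderiv ℝ M (a s)) t :=
    hD.comp t (ha.differentiableAt.restrictScalars ℝ)
  have hd : DifferentiableAt ℂ (deriv a) t := ha.deriv.differentiableAt
  have key : ∀ v, fderiv ℝ (fun s => fderiv ℝ (M ∘ a) s v) t v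
      = fderiv ℝ (fderiv ℝ M) (a t) (deriv a t * v) (deriv a t * v)
        + fderiv ℝ M (a t) (deriv (deriv a) t * v * v) := by
    intro v
    have e1 : (fun s => fderiv ℝ (M ∘ a) s v) =ᶠ[𝓝 t]
        fun s => fderiv ℝ M (a s) (deriv a s * v) := hev.mono fun s hs => hs v
    have hdv : DifferentiableAt ℝ (fun s => deriv a s * v) t :=
      (hd.mul_const v).restrictScalars ℝ
    rw [e1.fderiv_eq, fderiv_clm_apply hD' hdv]
    have e2 : fderiv ℝ (fun s => deriv a s * v) t v = deriv (deriv a) t * v * v := by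
      rw [(hd.mul_const v).fderiv_restrictScalars ℝ]
      simp [deriv_mul_const_field]
      ring
    have e3 : fderiv ℝ (fun s => fderiv ℝ M (a s)) t v
        = fderiv ℝ (fderiv ℝ M) (a t) (deriv a t * v) :=
      fderiv_comp_holomorphic (M := fderiv ℝ M) hD ha.differentiableAt v
    simp only [add_apply, ContinuousLinearMap.comp_apply,
      ContinuousLinearMap.flip_apply, e2, e3]
    abel
  rw [laplacian_eq_sum_fderiv hMc, key, key, laplacian_eq_fderiv_fderiv]
  set B := fderiv ℝ (fderiv ℝ M) (a t)
  set L := fderiv ℝ M (a t)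
  have h1 : L (deriv (deriv a) t * 1 * 1) + L (deriv (deriv a) t * Complex.I * Complex.I) = 0 := by
    rw [← map_add]
    convert map_zero L using 2
    rw [mul_assoc _ Complex.I, Complex.I_mul_I]
    ring
  have h2 : deriv a t * 1 = (deriv a t).re • (1 : ℂ) + (deriv a t).im • Complex.I := by
    apply Complex.ext <;> simp
  have h3 : deriv a t * Complex.I = (-(deriv a t).im) • (1 : ℂ) + (deriv a t).re • Complex.I := by
    apply Complex.ext <;> simp
  have h4 : ‖deriv a t‖ ^ 2 = (deriv a t).re ^ 2 + (deriv a t).im ^ 2 := by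
    rw [Complex.sq_norm, Complex.normSq_apply]; ring
  rw [add_add_add_comm, h1, add_zero, h2, h3, h4]
  simp only [map_add, map_smul, add_apply, smul_apply]
  module

end Laplacian

/-! ### The functions `x ↦ u(x, x̄)` -/

section EvalConj

variable (q : MvPolynomial (Fin 2) ℂ)

theorem pderiv_one_zero : MvPolynomial.pderiv 1 (MvPolynomial.pderiv 0 q)
    = MvPolynomial.pderiv 0 (MvPolynomial.pderiv 1 q) := by
  have h : ⁅MvPolynomial.pderiv (R := ℂ) (1 : Fin 2), MvPolynomial.pderiv (R := ℂ) (0 : Fin 2)⁆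
      = 0 := by
    refine MvPolynomial.derivation_ext fun i => ?_
    fin_cases i <;> simp [Derivation.commutator_apply]
  have := congrArg (fun L : Derivation ℂ (MvPolynomial (Fin 2) ℂ) (MvPolynomial (Fin 2) ℂ) => L q) h
  simpa [Derivation.commutator_apply, sub_eq_zero] using this

theorem hasFDerivAt_evalConj (x : ℂ) :
    HasFDerivAt (𝕜 := ℝ) (evalConj q)
      (evalConj (MvPolynomial.pderiv 0 q) x • (1 : ℂ →L[ℝ] ℂ)
        + evalConj (MvPolynomial.pderiv 1 q) x • (Complex.conjCLE : ℂ →L[ℝ] ℂ)) x := by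
  induction q using MvPolynomial.induction_on with
  | C a =>
    have : evalConj (MvPolynomial.C a) = fun _ => a := by ext; simp [evalConj]
    rw [this]
    refine (hasFDerivAt_const (𝕜 := ℝ) a x).congr_fderiv ?_
    ext v
    simp [evalConj]
  | add p q hp hq =>
    have : evalConj (p + q) = fun y => evalConj p y + evalConj q y := by ext; simp [evalConj]
    rw [this]
    refine (hp.add hq).congr_fderiv ?_
    ext v
    simp [evalConj]
    ring
  | mul_X p i hp =>
    have h0 : HasFDerivAt (𝕜 := ℝ) (evalConj (MvPolynomial.X i))
        (if i = 0 then (1 : ℂ →L[ℝ] ℂ) else (Complex.conjCLE : ℂ →L[ℝ] ℂ)) x := by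
      fin_cases i
      · have : evalConj (MvPolynomial.X 0) = id := by ext; simp [evalConj]
        simpa [this] using! hasFDerivAt_id (𝕜 := ℝ) x
      · have : evalConj (MvPolynomial.X 1) = Complex.conjCLE := by ext; simp [evalConj]
        simpa [this] using! Complex.conjCLE.hasFDerivAt (x := x)
    have : evalConj (p * MvPolynomial.X i)
        = fun y => evalConj p y * evalConj (MvPolynomial.X i) y := by ext; simp [evalConj]
    rw [this]
    refine (hp.mul h0).congr_fderiv ?_
    ext v
    fin_cases i <;> simp [evalConj] <;> ring

theorem contDiff_evalConj {n : ℕ∞} : ContDiff ℝ n (evalConj q) := by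
  induction q using MvPolynomial.induction_on with
  | C a =>
    have : evalConj (MvPolynomial.C a) = fun _ => a := by ext; simp [evalConj]
    rw [this]; fun_prop
  | add p q hp hq =>
    have : evalConj (p + q) = fun y => evalConj p y + evalConj q y := by ext; simp [evalConj]
    rw [this]; fun_prop
  | mul_X p i hp =>
    have h0 : ContDiff ℝ n (evalConj (MvPolynomial.X i)) := by
      fin_cases i
      · have : evalConj (MvPolynomial.X 0) = id := by ext; simp [evalConj]
        simpa [this] using! contDiff_id
      · have : evalConj (MvPolynomial.X 1) = Complex.conjCLE := by ext; simp [evalConj]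
        simpa [this] using! Complex.conjCLE.contDiff
    have : evalConj (p * MvPolynomial.X i)
        = fun y => evalConj p y * evalConj (MvPolynomial.X i) y := by ext; simp [evalConj]
    rw [this]
    exact hp.mul h0

theorem re_evalConj_pos {q : MvPolynomial (Fin 2) ℂ} (h : ∀ x, 0 < evalConj q x) (x : ℂ) :
    0 < (evalConj q x).re := (Complex.lt_def.1 (h x)).1

theorem ofReal_re_evalConj {q : MvPolynomial (Fin 2) ℂ} (h : ∀ x, 0 < evalConj q x) (x : ℂ) :
    ((evalConj q x).re : ℂ) = evalConj q x :=
  (Complex.eq_re_of_ofReal_le (r := 0) (by simpa using (h x).le)).symm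

theorem contDiff_re_evalConj {n : ℕ∞} : ContDiff ℝ n (fun x => (evalConj q x).re) :=
  Complex.reCLM.contDiff.comp (contDiff_evalConj q)

theorem contDiff_log_evalConj {q : MvPolynomial (Fin 2) ℂ} (h : ∀ x, 0 < evalConj q x) {n : ℕ∞} :
    ContDiff ℝ n (fun x => Real.log (evalConj q x).re) :=
  (contDiff_re_evalConj q).log fun x => (re_evalConj_pos h x).ne'

/-- If `u` solves `u u_{xy} - u_x u_y = σ u` and `u(x, x̄)` is positive, then
`Δ log u(x, x̄) = 4 σ(x, x̄) / u(x, x̄)`. -/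
theorem laplacian_log_evalConj {σ u : MvPolynomial (Fin 2) ℂ} (h : SolvesPDE σ u)
    (hpos : ∀ x, 0 < evalConj u x) (x : ℂ) :
    Δ (fun y => Real.log (evalConj u y).re) x
      = 4 * (evalConj σ x).re / (evalConj u x).re := by
  have hre := ofReal_re_evalConj hpos
  have hre0 : ∀ y, (evalConj u y).re ≠ 0 := fun y => (re_evalConj_pos hpos y).ne'
  have hu0 : ∀ y, evalConj u y ≠ 0 := fun y => (hpos y).ne'
  have hc : ContDiff ℝ 2 (fun y => Real.log (evalConj u y).re) :=
    contDiff_log_evalConj hpos (n := 2)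
  -- the derivatives are computed as complex numbers, in terms of the formal derivatives of `u`
  have hd : ∀ y v, ((fderiv ℝ (fun y => Real.log (evalConj u y).re) y v : ℝ) : ℂ)
      = (evalConj (MvPolynomial.pderiv 0 u) y * v
          + evalConj (MvPolynomial.pderiv 1 u) y * conj v) / evalConj u y := by
    intro y v
    have h1 : HasFDerivAt (𝕜 := ℝ) (fun y => (evalConj u y).re) _ y :=
      Complex.reCLM.hasFDerivAt.comp y (hasFDerivAt_evalConj u y)
    have h2 : HasFDerivAt (𝕜 := ℝ) (fun y => ((evalConj u y).re : ℂ)) _ y :=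
      Complex.ofRealCLM.hasFDerivAt.comp y h1
    have h3 := hasFDerivAt_evalConj u y
    rw [← funext hre] at h3
    have h4 := congrArg (fun L : ℂ →L[ℝ] ℂ => L v) (h2.unique h3)
    simp only [add_apply, smul_apply,
      one_apply_eq_self, smul_eq_mul, ContinuousLinearEquiv.coe_coe,
      ContinuousLinearMap.comp_apply] at h4
    rw [(h1.log (hre0 y)).fderiv, smul_apply, smul_eq_mul, Complex.ofReal_mul,
      Complex.ofReal_inv, hre, inv_mul_eq_div]
    congr 1
  have hd2 : ∀ v, ((fderiv ℝ (fun y => fderiv ℝ (fun y => Real.log (evalConj u y).re) y v) x v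
      : ℝ) : ℂ) = fderiv ℝ (fun y => (evalConj (MvPolynomial.pderiv 0 u) y * v
          + evalConj (MvPolynomial.pderiv 1 u) y * conj v) / evalConj u y) x v := by
    intro v
    have h1 : DifferentiableAt ℝ (fun y => fderiv ℝ (fun y => Real.log (evalConj u y).re) y v) x :=
      ((hc.fderiv_right (m := 1) (by norm_num)).clm_apply contDiff_const).differentiable
        (by norm_num) x
    have h2 := Complex.ofRealCLM.hasFDerivAt.comp x h1.hasFDerivAt
    have h3 : Complex.ofRealCLM ∘ (fun y => fderiv ℝ (fun y => Real.log (evalConj u y).re) y v)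
      = fun y => (evalConj (MvPolynomial.pderiv 0 u) y * v
          + evalConj (MvPolynomial.pderiv 1 u) y * conj v) / evalConj u y :=
      funext fun y => hd y v
    rw [h3] at h2
    rw [h2.fderiv]
    rfl
  have hq : ∀ v, HasFDerivAt (𝕜 := ℝ) (fun y => (evalConj (MvPolynomial.pderiv 0 u) y * v
          + evalConj (MvPolynomial.pderiv 1 u) y * conj v) * (evalConj u y)⁻¹) _ x := fun v =>
    (((hasFDerivAt_evalConj (MvPolynomial.pderiv 0 u) x).mul_const v).add
      ((hasFDerivAt_evalConj (MvPolynomial.pderiv 1 u) x).mul_const (conj v))).mul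
      ((hasFDerivAt_inv' (hu0 x)).comp x (hasFDerivAt_evalConj u x))
  have hpde : evalConj u x * evalConj (MvPolynomial.pderiv 0 (MvPolynomial.pderiv 1 u)) x
      - evalConj (MvPolynomial.pderiv 0 u) x * evalConj (MvPolynomial.pderiv 1 u) x
      = evalConj σ x * evalConj u x := by
    have := congrArg (MvPolynomial.eval ![x, conj x]) h
    simpa [evalConj] using this
  have hcomm : MvPolynomial.pderiv 1 (MvPolynomial.pderiv 0 u)
      = MvPolynomial.pderiv 0 (MvPolynomial.pderiv 1 u) := pderiv_one_zero u
  have main : ((Δ (fun y => Real.log (evalConj u y).re) x : ℝ) : ℂ)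
      = 4 * evalConj σ x / evalConj u x := by
    rw [laplacian_eq_sum_fderiv hc.contDiffAt, Complex.ofReal_add, hd2, hd2]
    have hux := hu0 x
    simp only [div_eq_mul_inv]
    rw [(hq 1).fderiv, (hq Complex.I).fderiv]
    simp only [add_apply, smul_apply, hcomm, one_apply_eq_self, smul_eq_mul,
      ContinuousLinearEquiv.coe_coe, map_one, ContinuousLinearMap.comp_apply, neg_apply,
      ContinuousLinearMap.mulLeftRight_apply, Pi.add_apply, Complex.conjCLE_apply, Complex.conj_I]
    field_simp
    rw [Complex.I_sq]
    linear_combination 4 * hpde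
  rw [← hre x] at main
  simpa [Complex.div_ofReal_re] using congrArg Complex.re main

theorem evalConj_matPoly {n : ℕ} (A : Matrix (Fin n) (Fin n) ℂ) (x : ℂ) :
    evalConj (matPoly A) x = ∑ i : Fin n, ∑ j : Fin n, A i j * x ^ (i : ℕ) * conj x ^ (j : ℕ) := by
  simp [evalConj, matPoly]

theorem matPolyRev_eq_matPoly {n : ℕ} (A : Matrix (Fin n) (Fin n) ℂ) :
    matPolyRev A = matPoly (A.submatrix Fin.rev Fin.rev) := by
  unfold matPolyRev matPoly
  rw [← Equiv.sum_comp Fin.revPerm]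
  refine Finset.sum_congr rfl fun i _ => ?_
  rw [← Equiv.sum_comp Fin.revPerm]
  refine Finset.sum_congr rfl fun j _ => ?_
  have h : ∀ i : Fin n, n - 1 - (n - ((i : ℕ) + 1)) = i := fun i => by omega
  simp [h]

theorem evalConj_matPoly_pos {n : ℕ} [NeZero n] {A : Matrix (Fin n) (Fin n) ℂ} (hA : A.PosDef)
    (x : ℂ) : 0 < evalConj (matPoly A) x := by
  have hv : (fun j : Fin n => conj x ^ (j : ℕ)) ≠ 0 := fun h => by
    simpa using congrFun h 0
  convert hA.dotProduct_mulVec_pos hv using 1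
  rw [evalConj_matPoly]
  simp only [dotProduct, Matrix.mulVec, Finset.mul_sum]
  refine Finset.sum_congr rfl fun i _ => Finset.sum_congr rfl fun j _ => ?_
  simp
  ring

theorem evalConj_matPolyRev_pos {n : ℕ} [NeZero n] {A : Matrix (Fin n) (Fin n) ℂ} (hA : A.PosDef)
    (x : ℂ) : 0 < evalConj (matPolyRev A) x := by
  rw [matPolyRev_eq_matPoly]
  exact evalConj_matPoly_pos (hA.submatrix Fin.rev_injective) x

theorem evalConj_matPolyRev {n : ℕ} (A : Matrix (Fin n) (Fin n) ℂ) {z : ℂ} (hz : z ≠ 0) :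
    evalConj (matPolyRev A) z
      = ((‖z‖ ^ (2 * (n - 1)) : ℝ) : ℂ) * evalConj (matPoly A) z⁻¹ := by
  have hz' : conj z ≠ 0 := by simpa using hz
  have h1 : ((‖z‖ ^ (2 * (n - 1)) : ℝ) : ℂ) = z ^ (n - 1) * conj z ^ (n - 1) := by
    rw [← mul_pow, Complex.mul_conj, pow_mul, Complex.sq_norm]
    push_cast
    rfl
  rw [h1, evalConj_matPoly]
  simp only [evalConj, matPolyRev, map_sum, map_mul, MvPolynomial.eval_C, map_pow,
    MvPolynomial.eval_X, Finset.mul_sum]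
  refine Finset.sum_congr rfl fun i _ => Finset.sum_congr rfl fun j _ => ?_
  have hi : (i : ℕ) ≤ n - 1 := by omega
  have hj : (j : ℕ) ≤ n - 1 := by omega
  simp only [Matrix.cons_val_zero, Matrix.cons_val_one]
  rw [pow_sub₀ _ hz hi, pow_sub₀ _ hz' hj, map_inv₀, inv_pow, inv_pow]
  ring

theorem re_evalConj_matPolyRev {n : ℕ} (A : Matrix (Fin n) (Fin n) ℂ) {z : ℂ} (hz : z ≠ 0) :
    (evalConj (matPolyRev A) z).re = ‖z‖ ^ (2 * (n - 1)) * (evalConj (matPoly A) z⁻¹).re := by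
  rw [evalConj_matPolyRev A hz, Complex.re_ofReal_mul]

/-- The reversed polynomials satisfy the same Liouville type equation: away from `0` this is the
conformal covariance of the Laplacian under `z ↦ 1 / z`, and it extends to `0` by continuity. -/
theorem laplacian_log_evalConj_matPolyRev {g : ℕ} (hg : 1 ≤ g) {H : Matrix (Fin g) (Fin g) ℂ}
    {A : Matrix (Fin (g + 2)) (Fin (g + 2)) ℂ} (hA : A.PosDef)
    (h : SolvesPDE (matPoly H) (matPoly A)) (z : ℂ) :
    Δ (fun y => Real.log (evalConj (matPolyRev A) y).re) z
      = 4 * (evalConj (matPolyRev H) z).re / (evalConj (matPolyRev A) z).re := by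
  have hp := evalConj_matPoly_pos hA
  have hpr := evalConj_matPolyRev_pos hA
  have hne : ∀ z : ℂ, z ≠ 0 → Δ (fun y => Real.log (evalConj (matPolyRev A) y).re) z
      = 4 * (evalConj (matPolyRev H) z).re / (evalConj (matPolyRev A) z).re := by
    intro z hz
    have hinv : AnalyticAt ℂ (fun y : ℂ => y⁻¹) z := analyticAt_inv hz
    have hc : ContDiffAt ℝ 2 (fun x => Real.log (evalConj (matPoly A) x).re) z⁻¹ :=
      (contDiff_log_evalConj hp (n := 2)).contDiffAt
    have hlog : InnerProductSpace.HarmonicAt (fun y : ℂ => Real.log ‖y‖) z :=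
      analyticAt_id.harmonicAt_log_norm hz
    have e : (fun y => Real.log (evalConj (matPolyRev A) y).re) =ᶠ[𝓝 z]
        ((2 * ((g : ℝ) + 1)) • (fun y : ℂ => Real.log ‖y‖))
          + (fun x => Real.log (evalConj (matPoly A) x).re) ∘ (fun y : ℂ => y⁻¹) := by
      filter_upwards [isOpen_ne.mem_nhds hz] with y hy
      rw [re_evalConj_matPolyRev A hy, Real.log_mul (pow_ne_zero _ (norm_ne_zero_iff.2 hy))
        (re_evalConj_pos hp _).ne', Real.log_pow]
      simp
    have hsm : ContDiffAt ℝ 2 ((2 * ((g : ℝ) + 1)) • (fun y : ℂ => Real.log ‖y‖)) z :=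
      ContDiffAt.const_smul (2 * ((g : ℝ) + 1)) hlog.1
    rw [(InnerProductSpace.laplacian_congr_nhds e).eq_of_nhds,
      hsm.laplacian_add (hc.comp z (hinv.contDiffAt.restrict_scalars ℝ)),
      laplacian_comp_holomorphic hc hinv, laplacian_log_evalConj h hp,
      InnerProductSpace.laplacian_smul _ hlog.1, hlog.2.eq_of_nhds,
      re_evalConj_matPolyRev A hz, re_evalConj_matPolyRev H hz]
    have h0 : ‖z‖ ≠ 0 := norm_ne_zero_iff.2 hz
    have h1 := (re_evalConj_pos hp z⁻¹).ne'
    obtain ⟨m, rfl⟩ : ∃ m, g = m + 1 := ⟨g - 1, by omega⟩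
    simp only [deriv_inv, norm_neg, norm_inv, norm_pow, smul_eq_mul, Pi.zero_apply, mul_zero,
      zero_add, Nat.add_sub_cancel]
    have e1 : m + 1 + 2 - 1 = m + 2 := by omega
    rw [e1]
    field_simp
    ring
  have hcl : Continuous (Δ (fun y => Real.log (evalConj (matPolyRev A) y).re)) :=
    continuous_iff_continuousAt.2 fun x =>
      continuousAt_laplacian (contDiff_log_evalConj hpr (n := 2)).contDiffAt
  have hcr : Continuous fun z => 4 * (evalConj (matPolyRev H) z).re
      / (evalConj (matPolyRev A) z).re := by
    have := (contDiff_re_evalConj (matPolyRev H) (n := 0)).continuous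
    have := (contDiff_re_evalConj (matPolyRev A) (n := 0)).continuous
    exact Continuous.div (by fun_prop) (by fun_prop) fun x => (re_evalConj_pos hpr x).ne'
  exact congrFun (Continuous.ext_on (dense_compl_singleton (0 : ℂ)) hcl hcr hne) z

end EvalConj

/-! ### The divergence theorem on the punctured plane -/

section Divergence

open MeasureTheory Filter

/-- A smooth cut-off function, equal to `1` on the unit disc and to `0` outside the disc of
radius `2`. -/
noncomputable def cutoff : ContDiffBump (0 : ℂ) := ⟨1, 2, one_pos, one_lt_two⟩

theorem contDiff_cutoff : ContDiff ℝ 1 cutoff := cutoff.contDiff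

theorem cutoff_eq_one {t : ℂ} (ht : ‖t‖ ≤ 1) : cutoff t = 1 :=
  cutoff.one_of_mem_closedBall (by simpa [cutoff] using ht)

theorem cutoff_eq_zero {t : ℂ} (ht : 2 ≤ ‖t‖) : cutoff t = 0 :=
  cutoff.zero_of_le_dist (by simpa [cutoff] using ht)

theorem abs_cutoff_le_one (t : ℂ) : |cutoff t| ≤ 1 :=
  abs_le.2 ⟨by linarith [cutoff.nonneg' t], cutoff.le_one⟩

theorem continuous_fderiv_cutoff (v : ℂ) : Continuous fun t => fderiv ℝ cutoff t v :=
  (contDiff_cutoff.continuous_fderiv (by norm_num)).clm_apply continuous_const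

theorem fderiv_cutoff_of_lt_one {t : ℂ} (ht : ‖t‖ < 1) : fderiv ℝ cutoff t = 0 := by
  have : (cutoff : ℂ → ℝ) =ᶠ[𝓝 t] fun _ => 1 := by
    filter_upwards [(isOpen_lt continuous_norm continuous_const).mem_nhds ht] with s hs
    exact cutoff_eq_one (le_of_lt hs)
  rw [this.fderiv_eq]
  simp

theorem fderiv_cutoff_of_two_lt {t : ℂ} (ht : 2 < ‖t‖) : fderiv ℝ cutoff t = 0 := by
  have : (cutoff : ℂ → ℝ) =ᶠ[𝓝 t] fun _ => 0 := by
    filter_upwards [(isOpen_lt continuous_const continuous_norm).mem_nhds ht] with s hs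
    exact cutoff_eq_zero (le_of_lt hs)
  rw [this.fderiv_eq]
  simp

theorem re_one_div_polar {r : ℝ} (hr : 0 < r) (θ : ℝ) :
    ((1 / (r * (Real.cos θ + Real.sin θ * Complex.I)) : ℂ)).re = Real.cos θ / r := by
  have h1 : ((1 / (r * (Real.cos θ + Real.sin θ * Complex.I)) : ℂ))
      = (Real.cos θ - Real.sin θ * Complex.I) / r := by
    have hr' : (r : ℂ) ≠ 0 := by exact_mod_cast hr.ne'
    have h2 : ((Real.cos θ : ℂ) + Real.sin θ * Complex.I)
        * (Real.cos θ - Real.sin θ * Complex.I) = 1 := by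
      have := Real.cos_sq_add_sin_sq θ
      have h3 : (Real.cos θ : ℂ) ^ 2 + (Real.sin θ : ℂ) ^ 2 = 1 := by exact_mod_cast this
      linear_combination h3 - (Real.sin θ : ℂ) ^ 2 * Complex.I_sq
    have h4 : ((Real.cos θ : ℂ) + Real.sin θ * Complex.I) ≠ 0 := left_ne_zero_of_mul_eq_one h2
    rw [div_eq_div_iff (mul_ne_zero hr' h4) hr']
    linear_combination (-(r : ℂ)) * h2
  rw [h1, Complex.div_ofReal_re]
  simp [Complex.cos_ofReal_re]

theorem re_I_div_polar {r : ℝ} (hr : 0 < r) (θ : ℝ) :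
    ((Complex.I / (r * (Real.cos θ + Real.sin θ * Complex.I)) : ℂ)).re = Real.sin θ / r := by
  have h1 : ((Complex.I / (r * (Real.cos θ + Real.sin θ * Complex.I)) : ℂ))
      = (Real.sin θ + Real.cos θ * Complex.I) / r := by
    have hr' : (r : ℂ) ≠ 0 := by exact_mod_cast hr.ne'
    have h2 : ((Real.cos θ : ℂ) + Real.sin θ * Complex.I)
        * (Real.cos θ - Real.sin θ * Complex.I) = 1 := by
      have := Real.cos_sq_add_sin_sq θ
      have h3 : (Real.cos θ : ℂ) ^ 2 + (Real.sin θ : ℂ) ^ 2 = 1 := by exact_mod_cast this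
      linear_combination h3 - (Real.sin θ : ℂ) ^ 2 * Complex.I_sq
    have h4 : ((Real.cos θ : ℂ) + Real.sin θ * Complex.I) ≠ 0 := left_ne_zero_of_mul_eq_one h2
    rw [div_eq_div_iff (mul_ne_zero hr' h4) hr']
    linear_combination (-(r : ℂ)) * Complex.I * h2
      + (-(r : ℂ) * Real.sin θ * (Real.cos θ + Real.sin θ * Complex.I)) * Complex.I_sq
  rw [h1, Complex.div_ofReal_re]
  simp [Complex.sin_ofReal_re]

/-- The flux of `∇ log ‖t‖` through a circle about the origin is `2 π`, in the form
`∫ ∇χ · ∇ log ‖t‖ = -2 π` for the cut-off function `χ`. -/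
theorem integral_fderiv_cutoff_mul :
    ∫ t : ℂ, (fderiv ℝ cutoff t 1 * (1 / t).re
      + fderiv ℝ cutoff t Complex.I * (Complex.I / t).re) = -(2 * Real.pi) := by
  rw [← Complex.integral_comp_polarCoord_symm]
  set G : ℝ × ℝ → ℝ := fun p => fderiv ℝ cutoff (p.1 * (Real.cos p.2 + Real.sin p.2 * Complex.I))
    (Real.cos p.2 + Real.sin p.2 * Complex.I) with hG
  have e1 : ∀ p ∈ polarCoord.target, p.1 • (fderiv ℝ cutoff (Complex.polarCoord.symm p) 1
      * (1 / Complex.polarCoord.symm p).re + fderiv ℝ cutoff (Complex.polarCoord.symm p) Complex.I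
        * (Complex.I / Complex.polarCoord.symm p).re) = G p := by
    rintro ⟨r, θ⟩ hp
    have hr : 0 < r := hp.1
    have h1 : ((Real.cos θ + Real.sin θ * Complex.I : ℂ))
        = Real.cos θ • (1 : ℂ) + Real.sin θ • Complex.I := by simp
    simp only [hG]
    rw [Complex.polarCoord_symm_apply, re_one_div_polar hr, re_I_div_polar hr]
    nth_rw 4 [h1]
    rw [map_add, map_smul, map_smul]
    simp only [smul_eq_mul]
    field_simp
  have hGc : Continuous G := by
    refine Continuous.clm_apply (f := fun p : ℝ × ℝ => fderiv ℝ cutoff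
      (p.1 * (Real.cos p.2 + Real.sin p.2 * Complex.I))) ?_ (by fun_prop)
    exact (contDiff_cutoff.continuous_fderiv (by norm_num)).comp (by fun_prop)
  have hnorm : ∀ r θ : ℝ, ‖(r * (Real.cos θ + Real.sin θ * Complex.I) : ℂ)‖ = |r| := by
    intro r θ
    rw [norm_mul, Complex.ofReal_cos, Complex.ofReal_sin, Complex.norm_cos_add_sin_mul_I, mul_one,
      Complex.norm_real, Real.norm_eq_abs]
  have htgt : polarCoord.target = Set.Ioi (0 : ℝ) ×ˢ Set.Ioo (-Real.pi) Real.pi := rfl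
  have hGi : IntegrableOn G (Set.Ioi (0 : ℝ) ×ˢ Set.Ioo (-Real.pi) Real.pi) := by
    have h1 : IntegrableOn G (Set.Icc (0 : ℝ) 2 ×ˢ Set.Icc (-Real.pi) Real.pi) :=
      hGc.continuousOn.integrableOn_compact (isCompact_Icc.prod isCompact_Icc)
    refine h1.of_forall_sdiff_eq_zero (measurableSet_Ioi.prod measurableSet_Ioo) ?_
    rintro ⟨r, θ⟩ ⟨⟨hr, hθ⟩, hn⟩
    have hr' : 0 < r := hr
    have : 2 < r := by
      by_contra h
      exact hn ⟨⟨hr'.le, not_lt.1 h⟩, ⟨hθ.1.le, hθ.2.le⟩⟩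
    simp only [hG]
    rw [fderiv_cutoff_of_two_lt (by rw [hnorm]; exact this.trans_le (le_abs_self r))]
    simp
  rw [setIntegral_congr_fun (by exact measurableSet_Ioi.prod measurableSet_Ioo) e1, htgt]
  rw [Measure.volume_eq_prod] at hGi ⊢
  have e2 : ∀ θ, ∫ r in Set.Ioi (0 : ℝ), G (r, θ) = -1 := by
    intro θ
    have hd : ∀ r ∈ Set.Ici (0 : ℝ), HasDerivAt
        (fun r : ℝ => cutoff (r * (Real.cos θ + Real.sin θ * Complex.I))) (G (r, θ)) r := by
      intro r _
      have h1 : HasDerivAt (fun r : ℝ => (r * (Real.cos θ + Real.sin θ * Complex.I) : ℂ))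
          (Real.cos θ + Real.sin θ * Complex.I) r := by
        simpa using (Complex.ofRealCLM.hasDerivAt (x := r)).mul_const
          (Real.cos θ + Real.sin θ * Complex.I : ℂ)
      exact ((contDiff_cutoff.differentiable (by norm_num)) _).hasFDerivAt.comp_hasDerivAt r h1
    have hlim : Tendsto (fun r : ℝ => cutoff (r * (Real.cos θ + Real.sin θ * Complex.I)))
        atTop (𝓝 0) := by
      refine tendsto_const_nhds.congr' ?_
      filter_upwards [eventually_ge_atTop 2] with r hr
      rw [cutoff_eq_zero (by rw [hnorm]; exact hr.trans (le_abs_self r))]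
    have hi : IntegrableOn (fun r => G (r, θ)) (Set.Ioi 0) := by
      have hcθ : Continuous fun r => G (r, θ) := hGc.comp (by fun_prop)
      have h1 : IntegrableOn (fun r => G (r, θ)) (Set.Icc 0 2) :=
        hcθ.continuousOn.integrableOn_compact isCompact_Icc
      refine h1.of_forall_sdiff_eq_zero measurableSet_Ioi ?_
      rintro r ⟨hr, hn⟩
      have hr' : 0 < r := hr
      have : 2 < r := by
        by_contra h
        exact hn ⟨hr'.le, not_lt.1 h⟩
      simp only [hG]
      rw [fderiv_cutoff_of_two_lt (by rw [hnorm]; exact this.trans_le (le_abs_self r))]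
      simp
    rw [integral_Ioi_of_hasDerivAt_of_tendsto' hd hi hlim]
    simp [cutoff_eq_one]
  rw [IntegrableOn, ← Measure.prod_restrict] at hGi
  rw [← Measure.prod_restrict, integral_prod_symm _ hGi]
  simp only [e2]
  have := Real.pi_pos
  simp [max_eq_left (by positivity : 0 ≤ Real.pi + Real.pi), two_mul]

/-- Rescaling a test function `β` that lives on an annulus: if `s_n V(e + s_n t) → L t` boundedly
on the annulus, then `∫ s_n⁻¹ β((x - e) / s_n) V(x) dx → ∫ β L`. -/
theorem tendsto_integral_rescale {β : ℂ → ℝ} (hβ : Continuous β)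
    (hβ1 : ∀ t, ‖t‖ < 1 → β t = 0) (hβ2 : ∀ t, 2 < ‖t‖ → β t = 0) {s : ℕ → ℝ}
    (hs : ∀ᶠ n in atTop, 0 < s n) (e : ℂ) {V L : ℂ → ℂ} {C : ℝ}
    (hcont : ∀ᶠ n in atTop, ∀ t : ℂ, 1 / 2 < ‖t‖ → ‖t‖ < 3 → ContinuousAt V (e + s n * t))
    (hlim : ∀ t ≠ 0, Tendsto (fun n => (s n : ℂ) * V (e + s n * t)) atTop (𝓝 (L t)))
    (hb : ∀ᶠ n in atTop, ∀ t : ℂ, 1 ≤ ‖t‖ → ‖t‖ ≤ 2 → ‖(s n : ℂ) * V (e + s n * t)‖ ≤ C) :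
    (∀ᶠ n in atTop, Integrable fun x : ℂ => ((s n)⁻¹ * β ((s n)⁻¹ • (x - e))) • V x) ∧
      Tendsto (fun n => ∫ x : ℂ, ((s n)⁻¹ * β ((s n)⁻¹ • (x - e))) • V x) atTop
        (𝓝 (∫ t, β t • L t)) := by
  set F : ℕ → ℂ → ℂ := fun n t => β t • ((s n : ℂ) * V (e + s n * t)) with hF
  have hFc : ∀ᶠ n in atTop, Continuous (F n) := by
    filter_upwards [hcont] with n hn
    refine continuous_iff_continuousAt.2 fun t => ?_
    by_cases h1 : 1 / 2 < ‖t‖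
    · by_cases h2 : ‖t‖ < 3
      · refine hβ.continuousAt.smul (continuousAt_const.mul ?_)
        exact ContinuousAt.comp (f := fun t => e + s n * t) (hn t h1 h2) (by fun_prop)
      · refine (continuousAt_const (y := (0 : ℂ))).congr ?_
        filter_upwards [(isOpen_lt continuous_const continuous_norm).mem_nhds
          (show 2 < ‖t‖ by linarith)] with t' ht'
        simp [hF, hβ2 t' ht']
    · refine (continuousAt_const (y := (0 : ℂ))).congr ?_
      filter_upwards [(isOpen_lt continuous_norm continuous_const).mem_nhds
        (show ‖t‖ < 1 by linarith)] with t' ht'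
      simp [hF, hβ1 t' ht']
  have hFi : ∀ᶠ n in atTop, Integrable (F n) := by
    filter_upwards [hFc] with n hn
    refine hn.integrable_of_hasCompactSupport
      (HasCompactSupport.intro (isCompact_closedBall 0 2) fun t ht => ?_)
    simp [hF, hβ2 t (by simpa using ht)]
  have hrw : ∀ᶠ n in atTop, (fun x : ℂ => ((s n)⁻¹ * β ((s n)⁻¹ • (x - e))) • V x)
      = fun x => ((s n)⁻¹ ^ 2) • F n ((s n)⁻¹ • (x - e)) := by
    filter_upwards [hs] with n hn
    funext x
    have hn' : (s n : ℂ) ≠ 0 := by exact_mod_cast hn.ne'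
    have : e + s n * ((s n)⁻¹ • (x - e)) = x := by
      rw [Complex.real_smul]
      push_cast
      field_simp
      ring
    simp only [hF]
    rw [this]
    generalize β _ = b
    simp only [Complex.real_smul]
    push_cast
    field_simp
  constructor
  · filter_upwards [hFi, hrw, hs] with n hn hr hsn
    rw [hr]
    exact ((hn.comp_smul (inv_ne_zero hsn.ne')).comp_sub_right e).smul ((s n)⁻¹ ^ 2)
  · have hint : ∀ᶠ n in atTop, ∫ t, F n t
        = ∫ x : ℂ, ((s n)⁻¹ * β ((s n)⁻¹ • (x - e))) • V x := by
      filter_upwards [hrw, hs] with n hr hsn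
      rw [hr, integral_smul, integral_sub_right_eq_self (fun x => F n ((s n)⁻¹ • x)) e,
        Measure.integral_comp_smul]
      rw [Complex.finrank_real_complex, abs_of_pos (by positivity), smul_smul]
      have : (s n)⁻¹ ^ 2 * ((s n)⁻¹ ^ 2)⁻¹ = 1 := mul_inv_cancel₀ (by positivity)
      rw [this, one_smul]
    refine Tendsto.congr' hint ?_
    refine tendsto_integral_filter_of_dominated_convergence (fun t => |β t| * C) ?_ ?_ ?_ ?_
    · filter_upwards [hFi] with n hn using hn.aestronglyMeasurable
    · filter_upwards [hb] with n hn
      refine Eventually.of_forall fun t => ?_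
      simp only [hF]
      rw [norm_smul, Real.norm_eq_abs]
      by_cases h1 : 1 ≤ ‖t‖
      · by_cases h2 : ‖t‖ ≤ 2
        · exact mul_le_mul_of_nonneg_left (hn t h1 h2) (abs_nonneg _)
        · simp [hβ2 t (not_le.1 h2)]
      · simp [hβ1 t (not_le.1 h1)]
    · refine Integrable.mul_const ?_ C
      refine hβ.abs.integrable_of_hasCompactSupport
        (HasCompactSupport.intro (isCompact_closedBall 0 2) fun t ht => ?_)
      simp [hβ2 t (by simpa using ht)]
    · refine Eventually.of_forall fun t => ?_
      rcases eq_or_ne t 0 with rfl | ht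
      · simp [hF, hβ1 0 (by simp)]
      · exact (hlim t ht).const_smul (β t)

theorem integrable_smul_of_tsupport {k : ℂ → ℝ} (hk : Continuous k) (hc : HasCompactSupport k)
    {E : Type*} [NormedAddCommGroup E] [NormedSpace ℝ E] {G : ℂ → E}
    (hG : ∀ x ∈ tsupport k, ContinuousAt G x) : Integrable fun x => k x • G x := by
  refine Continuous.integrable_of_hasCompactSupport (continuous_iff_continuousAt.2 fun x => ?_)
    hc.smul_right
  by_cases hx : x ∈ tsupport k
  · exact hk.continuousAt.smul (hG x hx)
  · refine (continuousAt_const (y := (0 : E))).congr ?_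
    filter_upwards [notMem_tsupport_iff_eventuallyEq.1 hx] with y hy
    simp [hy]

/-- The cut-off function which removes discs of radius comparable to `1 / n` about the points of
`S`, and the exterior of a disc of radius comparable to `n`. -/
noncomputable def puncturedCutoff (S : Finset ℂ) (n : ℕ) (x : ℂ) : ℝ :=
  cutoff ((n : ℝ)⁻¹ • x) - ∑ e ∈ S, cutoff ((n : ℝ) • (x - e))

theorem contDiff_puncturedCutoff (S : Finset ℂ) (n : ℕ) : ContDiff ℝ 1 (puncturedCutoff S n) := by
  refine ContDiff.sub (contDiff_cutoff.comp (by fun_prop)) (ContDiff.sum fun e _ => ?_)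
  exact contDiff_cutoff.comp (by fun_prop)

theorem abs_puncturedCutoff_le (S : Finset ℂ) (n : ℕ) (x : ℂ) :
    |puncturedCutoff S n x| ≤ 1 + S.card := by
  refine (abs_sub _ _).trans (add_le_add (abs_cutoff_le_one _) ?_)
  refine (Finset.abs_sum_le_sum_abs _ _).trans ?_
  simpa using Finset.sum_le_card_nsmul S _ 1 fun e _ => abs_cutoff_le_one ((n : ℝ) • (x - e))

theorem hasCompactSupport_puncturedCutoff (S : Finset ℂ) {n : ℕ} (hn : 0 < n) :
    HasCompactSupport (puncturedCutoff S n) := by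
  have hn' : (0 : ℝ) < n := by exact_mod_cast hn
  refine HasCompactSupport.sub ?_ ?_
  · refine HasCompactSupport.intro (isCompact_closedBall 0 (2 * n)) fun x hx => ?_
    refine cutoff_eq_zero ?_
    rw [norm_smul, norm_inv, Real.norm_natCast, ← div_eq_inv_mul, le_div_iff₀ hn']
    simpa using (not_le.1 (by simpa using hx)).le
  · refine HasCompactSupport.intro (K := ⋃ e ∈ S, Metric.closedBall e 2)
      (S.isCompact_biUnion fun e _ => isCompact_closedBall e 2) fun x hx => ?_
    refine Finset.sum_eq_zero fun e he => cutoff_eq_zero ?_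
    have h1 : 2 < ‖x - e‖ := by
      by_contra h
      refine hx (Set.mem_biUnion he ?_)
      simpa [dist_eq_norm] using h
    have h2 : (1 : ℝ) ≤ n := by exact_mod_cast hn
    rw [norm_smul, Real.norm_natCast]
    nlinarith

theorem puncturedCutoff_eventually (S : Finset ℂ) : ∀ᶠ n : ℕ in atTop,
    ∀ x ∈ tsupport (puncturedCutoff S n), x ∉ S := by
  have h1 : ∀ᶠ n : ℕ in atTop, ∀ e ∈ S, ‖e‖ < n :=
    (Finset.eventually_all S).2 fun e _ => tendsto_natCast_atTop_atTop.eventually_gt_atTop ‖e‖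
  have h2 : ∀ᶠ n : ℕ in atTop, ∀ e ∈ S, ∀ e' ∈ S, e ≠ e' → 2 < ‖(n : ℝ) • (e - e')‖ := by
    refine (Finset.eventually_all S).2 fun e _ => (Finset.eventually_all S).2 fun e' _ => ?_
    by_cases h : e = e'
    · simp [h]
    have h3 : 0 < ‖e - e'‖ := norm_pos_iff.2 (sub_ne_zero.2 h)
    filter_upwards [(tendsto_natCast_atTop_atTop.atTop_mul_const h3).eventually_gt_atTop 2]
      with n hn _
    rwa [norm_smul, Real.norm_natCast]
  filter_upwards [h1, h2, eventually_gt_atTop 0] with n hn1 hn2 hn0 x hx hxS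
  have hn' : (0 : ℝ) < n := by exact_mod_cast hn0
  refine notMem_tsupport_iff_eventuallyEq.2 ?_ hx
  have e1 : ∀ᶠ y in 𝓝 x, ‖(n : ℝ)⁻¹ • y‖ < 1 := by
    refine Continuous.tendsto (f := fun y : ℂ => ‖(n : ℝ)⁻¹ • y‖) (by fun_prop) x
      |>.eventually_lt_const ?_
    rw [norm_smul, norm_inv, Real.norm_natCast, ← div_eq_inv_mul, div_lt_one hn']
    exact hn1 x hxS
  have e2 : ∀ᶠ y in 𝓝 x, ‖(n : ℝ) • (y - x)‖ < 1 := by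
    refine Continuous.tendsto (f := fun y : ℂ => ‖(n : ℝ) • (y - x)‖) (by fun_prop) x
      |>.eventually_lt_const ?_
    simp
  have e3 : ∀ᶠ y in 𝓝 x, ∀ e ∈ S, x ≠ e → 2 < ‖(n : ℝ) • (y - e)‖ := by
    refine (Finset.eventually_all S).2 fun e he => ?_
    by_cases h : x = e
    · simp [h]
    refine (Continuous.tendsto (f := fun y : ℂ => ‖(n : ℝ) • (y - e)‖) (by fun_prop) x
      |>.eventually_const_lt (hn2 x hxS e he h)).mono fun y hy _ => hy
  filter_upwards [e1, e2, e3] with y h1 h2 h3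
  rw [puncturedCutoff, cutoff_eq_one h1.le, Finset.sum_eq_single_of_mem x hxS fun e he hne =>
    cutoff_eq_zero (h3 e he hne.symm).le, cutoff_eq_one h2.le]
  simp

theorem tendsto_puncturedCutoff (S : Finset ℂ) {x : ℂ} (hx : x ∉ S) :
    Tendsto (fun n => puncturedCutoff S n x) atTop (𝓝 1) := by
  refine tendsto_const_nhds.congr' ?_
  have h1 : ∀ᶠ n : ℕ in atTop, ∀ e ∈ S, 2 < ‖(n : ℝ) • (x - e)‖ := by
    refine (Finset.eventually_all S).2 fun e he => ?_
    have h3 : 0 < ‖x - e‖ := norm_pos_iff.2 (sub_ne_zero.2 fun h => hx (h ▸ he))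
    filter_upwards [(tendsto_natCast_atTop_atTop.atTop_mul_const h3).eventually_gt_atTop 2]
      with n hn
    rwa [norm_smul, Real.norm_natCast]
  filter_upwards [h1, tendsto_natCast_atTop_atTop.eventually_gt_atTop ‖x‖, eventually_gt_atTop 0]
    with n hn hnx hn0
  have hn' : (0 : ℝ) < n := by exact_mod_cast hn0
  rw [puncturedCutoff, Finset.sum_eq_zero fun e he => cutoff_eq_zero (hn e he).le, cutoff_eq_one]
  · simp
  · rw [norm_smul, norm_inv, Real.norm_natCast, ← div_eq_inv_mul]
    exact ((div_lt_one hn').2 hnx).le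

theorem fderiv_puncturedCutoff (S : Finset ℂ) (n : ℕ) (x v : ℂ) :
    fderiv ℝ (puncturedCutoff S n) x v = (n : ℝ)⁻¹ * fderiv ℝ cutoff ((n : ℝ)⁻¹ • (x - 0)) v
      - ∑ e ∈ S, ((n : ℝ)⁻¹)⁻¹ * fderiv ℝ cutoff (((n : ℝ)⁻¹)⁻¹ • (x - e)) v := by
  have hd := contDiff_cutoff.differentiable (by norm_num)
  have h1 : ∀ (r : ℝ) (e : ℂ), HasFDerivAt (fun y => cutoff (r • (y - e)))
      (r • fderiv ℝ cutoff (r • (x - e))) x := by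
    intro r e
    have h2 : HasFDerivAt (fun y : ℂ => r • (y - e)) (r • ContinuousLinearMap.id ℝ ℂ) x :=
      ((hasFDerivAt_id x).sub_const e).const_smul r
    refine ((hd (r • (x - e))).hasFDerivAt.comp x h2).congr_fderiv ?_
    ext w
    simp
  have h3 := (h1 (n : ℝ)⁻¹ 0).sub (HasFDerivAt.fun_sum fun e (_ : e ∈ S) => h1 n e)
  have h4 : puncturedCutoff S n = (fun y => cutoff ((n : ℝ)⁻¹ • (y - 0)))
      - fun y => ∑ e ∈ S, cutoff ((n : ℝ) • (y - e)) := by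
    funext y
    simp [puncturedCutoff]
  rw [h4, h3.fderiv]
  simp [inv_inv]

/-- The contribution of one component of a vector field to the boundary terms of the divergence
theorem on the punctured plane. -/
theorem tendsto_integral_fderiv_puncturedCutoff (S : Finset ℂ) {V : ℂ → ℂ} (c : ℂ → ℂ) (v : ℂ)
    (hv : ‖v‖ ≤ 1)
    (hV : ∀ x ∉ S, ContinuousAt V x)
    (hVc : ∀ e ∈ S, Tendsto (fun x => (x - e) * (V x - c e * (v / (x - e)).re)) (𝓝[≠] e) (𝓝 0))
    (hVi : Tendsto (fun x => x * V x) (cocompact ℂ) (𝓝 0)) :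
    Tendsto (fun n => ∫ x, fderiv ℝ (puncturedCutoff S n) x v • V x) atTop
      (𝓝 (-∑ e ∈ S, c e * ∫ t : ℂ, fderiv ℝ cutoff t v * (v / t).re)) := by
  have hβ1 : ∀ t : ℂ, ‖t‖ < 1 → fderiv ℝ cutoff t v = 0 := fun t ht => by
    simp [fderiv_cutoff_of_lt_one ht]
  have hβ2 : ∀ t : ℂ, 2 < ‖t‖ → fderiv ℝ cutoff t v = 0 := fun t ht => by
    simp [fderiv_cutoff_of_two_lt ht]
  -- the outer boundary
  have hout := tendsto_integral_rescale (continuous_fderiv_cutoff v) hβ1 hβ2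
    (s := fun n => (n : ℝ)) (V := V) (L := fun _ => 0) (C := 1)
    ((eventually_gt_atTop 0).mono fun n hn => by exact_mod_cast hn) 0
    (by
      have : ∀ᶠ n : ℕ in atTop, ∀ e ∈ S, 2 * ‖e‖ < n := (Finset.eventually_all S).2 fun e _ =>
        tendsto_natCast_atTop_atTop.eventually_gt_atTop _
      filter_upwards [this] with n hn t ht _
      refine hV _ fun hmem => ?_
      have := hn _ hmem
      simp only [zero_add, norm_mul, Complex.ofReal_natCast, Complex.norm_natCast] at this
      have hn0 : (0 : ℝ) ≤ n := n.cast_nonneg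
      nlinarith)
    (by
      intro t ht
      have h1 : Tendsto (fun n : ℕ => (n : ℂ) * t) atTop (cocompact ℂ) := by
        rw [← Metric.cobounded_eq_cocompact, tendsto_norm_atTop_iff_cobounded.symm]
        simpa using tendsto_natCast_atTop_atTop.atTop_mul_const (norm_pos_iff.2 ht)
      have h2 := (hVi.comp h1).const_mul t⁻¹
      rw [mul_zero] at h2
      refine h2.congr fun n => ?_
      simp
      field_simp)
    (by
      have h1 : ∀ᶠ x in cocompact ℂ, ‖x * V x‖ < 1 := by
        simpa using hVi.norm.eventually_lt_const (by simp)
      rw [← Metric.cobounded_eq_cocompact, ← comap_norm_atTop, eventually_comap,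
        eventually_atTop] at h1
      obtain ⟨R, hR⟩ := h1
      filter_upwards [tendsto_natCast_atTop_atTop.eventually_ge_atTop R] with n hn t ht _
      have h2 := hR ‖(n : ℂ) * t‖ (by
        rw [norm_mul, Complex.norm_natCast]
        have hn0 : (0 : ℝ) ≤ n := n.cast_nonneg
        nlinarith) _ rfl
      simp only [Complex.ofReal_natCast, zero_add]
      rw [norm_mul, norm_mul] at h2
      rw [norm_mul]
      have : 0 ≤ ‖(n : ℂ)‖ * ‖V (n * t)‖ := by positivity
      nlinarith)
  -- the boundaries at the punctures
  have hin : ∀ e ∈ S, _ := fun e he => tendsto_integral_rescale (continuous_fderiv_cutoff v)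
    hβ1 hβ2 (s := fun n => (n : ℝ)⁻¹) (V := V) (L := fun t => c e * (v / t).re) (C := 1 + ‖c e‖)
    ((eventually_gt_atTop 0).mono fun n hn => by positivity) e
    (by
      have : ∀ᶠ n : ℕ in atTop, ∀ e' ∈ S, e' ≠ e → 3 < ‖e' - e‖ * n := by
        refine (Finset.eventually_all S).2 fun e' _ => ?_
        by_cases h : e' = e
        · simp [h]
        have h3 : 0 < ‖e' - e‖ := norm_pos_iff.2 (sub_ne_zero.2 h)
        filter_upwards [(tendsto_natCast_atTop_atTop.const_mul_atTop h3).eventually_gt_atTop 3]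
          with n hn _ using hn
      filter_upwards [this, eventually_gt_atTop 0] with n hn hn0 t ht1 ht3
      have hn' : (0 : ℝ) < n := by exact_mod_cast hn0
      have hnc : (n : ℂ) ≠ 0 := by exact_mod_cast hn0.ne'
      have ht0 : t ≠ 0 := norm_pos_iff.1 (by linarith)
      refine hV _ fun hmem => ?_
      have := hn _ hmem (by simp [hnc, ht0])
      simp only [add_sub_cancel_left, norm_mul, Complex.ofReal_inv, Complex.ofReal_natCast,
        norm_inv, Complex.norm_natCast] at this
      field_simp at this
      linarith)
    (by
      intro t ht
      have h1 : Tendsto (fun n : ℕ => e + ((n : ℝ)⁻¹ : ℝ) * t) atTop (𝓝[≠] e) := by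
        refine tendsto_nhdsWithin_iff.2 ⟨?_, ?_⟩
        · have := ((Complex.continuous_ofReal.tendsto 0).comp
            (tendsto_inv_atTop_nhds_zero_nat (𝕜 := ℝ))).mul_const t |>.const_add e
          simpa using this
        · filter_upwards [eventually_gt_atTop 0] with n hn
          have hnc : (n : ℂ) ≠ 0 := by exact_mod_cast hn.ne'
          simp [ht, hnc]
      have h2 := (((hVc e he).comp h1).const_mul t⁻¹).add_const (c e * (v / t).re)
      rw [mul_zero, zero_add] at h2
      refine h2.congr' ?_
      filter_upwards [eventually_gt_atTop 0] with n hn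
      have hnc : (n : ℂ) ≠ 0 := by exact_mod_cast hn.ne'
      have h3 : (v / (((n : ℝ)⁻¹ : ℝ) * t)).re = n * (v / t).re := by
        rw [show v / (((n : ℝ)⁻¹ : ℝ) * t) = ((n : ℝ) : ℂ) * (v / t) by
          push_cast; field_simp, Complex.re_ofReal_mul]
      simp only [Function.comp_apply, add_sub_cancel_left]
      rw [h3]
      push_cast
      field_simp
      ring)
    (by
      have h1 : ∀ᶠ x in 𝓝[≠] e, ‖(x - e) * (V x - c e * (v / (x - e)).re)‖ < 1 := by
        simpa using (hVc e he).norm.eventually_lt_const (by simp)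
      rw [eventually_nhdsWithin_iff, Metric.eventually_nhds_iff] at h1
      obtain ⟨ε, hε, h1⟩ := h1
      filter_upwards [tendsto_natCast_atTop_atTop.eventually_gt_atTop (2 / ε),
        eventually_gt_atTop 0] with n hn hn0 t ht1 ht2
      have hn' : (0 : ℝ) < n := by exact_mod_cast hn0
      have hnc : (n : ℂ) ≠ 0 := by exact_mod_cast hn0.ne'
      have ht0 : t ≠ 0 := norm_pos_iff.1 (by linarith)
      set x := e + (((n : ℝ)⁻¹ : ℝ) : ℂ) * t with hx
      have hxe : x - e = (((n : ℝ)⁻¹ : ℝ) : ℂ) * t := by rw [hx]; ring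
      have hxne : x - e ≠ 0 := by rw [hxe]; simp [hnc, ht0]
      have hxn : ‖x - e‖ = (n : ℝ)⁻¹ * ‖t‖ := by simp [hxe]
      have h2 := h1 (y := x) (by
        rw [dist_eq_norm, hxn, inv_mul_lt_iff₀ hn']
        rw [div_lt_iff₀ hε] at hn
        linarith) (sub_ne_zero.1 hxne)
      have h3 : ‖(x - e) * V x‖ ≤ 1 + ‖c e‖ := by
        have h4 : (x - e) * V x = (x - e) * (V x - c e * (v / (x - e)).re)
          + (x - e) * (c e * (v / (x - e)).re) := by ring
        rw [h4]
        refine (norm_add_le _ _).trans (add_le_add h2.le ?_)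
        rw [norm_mul, norm_mul, Complex.norm_real]
        have h5 : ‖(v / (x - e)).re‖ ≤ 1 / ‖x - e‖ := by
          refine (Complex.abs_re_le_norm _).trans ?_
          rw [norm_div]
          gcongr
        have h6 : 0 < ‖x - e‖ := norm_pos_iff.2 hxne
        calc ‖x - e‖ * (‖c e‖ * ‖(v / (x - e)).re‖)
            ≤ ‖x - e‖ * (‖c e‖ * (1 / ‖x - e‖)) := by gcongr
          _ = ‖c e‖ := by field_simp
      rw [norm_mul, hxn] at h3
      rw [norm_mul, Complex.norm_real, Real.norm_of_nonneg (by positivity)]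
      refine le_trans ?_ h3
      have : 0 ≤ (n : ℝ)⁻¹ * ‖V x‖ := by positivity
      nlinarith)
  have hall : ∀ᶠ n : ℕ in atTop, ∀ e ∈ S, Integrable fun x : ℂ =>
      (((n : ℝ)⁻¹)⁻¹ * fderiv ℝ cutoff (((n : ℝ)⁻¹)⁻¹ • (x - e)) v) • V x :=
    (Finset.eventually_all S).2 fun e he => (hin e he).1
  have hlim := hout.2.sub (tendsto_finsetSum S fun e he => (hin e he).2)
  have hval : ∀ e, ∫ t : ℂ, fderiv ℝ cutoff t v • (c e * ((v / t).re : ℂ))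
      = c e * ∫ t : ℂ, fderiv ℝ cutoff t v * (v / t).re := by
    intro e
    rw [← integral_complex_ofReal, ← integral_const_mul]
    refine integral_congr_ae (Eventually.of_forall fun t => ?_)
    simp only [Complex.real_smul]
    push_cast
    ring
  simp only [hval, smul_zero, integral_zero, zero_sub] at hlim
  refine hlim.congr' ?_
  filter_upwards [hout.1, hall] with n h1 h2
  rw [← integral_finsetSum S h2, ← integral_sub h1 (integrable_finsetSum S h2)]
  refine integral_congr_ae (Eventually.of_forall fun x => ?_)
  simp only [fderiv_puncturedCutoff, sub_smul, Finset.sum_smul]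

/-- The divergence theorem for a vector field `V ∂_x + W ∂_y` on the plane, punctured at a finite
set, which looks like a multiple of `∇ log ‖x - e‖` near each puncture `e` and decays at
infinity. -/
theorem integral_divergence_eq (S : Finset ℂ) {V W : ℂ → ℂ} (c : ℂ → ℂ)
    (hV : ∀ x ∉ S, ContDiffAt ℝ 1 V x) (hW : ∀ x ∉ S, ContDiffAt ℝ 1 W x)
    (hVc : ∀ e ∈ S, Tendsto (fun x => (x - e) * (V x - c e * (1 / (x - e)).re)) (𝓝[≠] e) (𝓝 0))
    (hWc : ∀ e ∈ S, Tendsto (fun x => (x - e) * (W x - c e * (Complex.I / (x - e)).re))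
      (𝓝[≠] e) (𝓝 0))
    (hVi : Tendsto (fun x => x * V x) (cocompact ℂ) (𝓝 0))
    (hWi : Tendsto (fun x => x * W x) (cocompact ℂ) (𝓝 0))
    (hint : Integrable fun x => fderiv ℝ V x 1 + fderiv ℝ W x Complex.I) :
    ∫ x, (fderiv ℝ V x 1 + fderiv ℝ W x Complex.I) =
      -(2 * Real.pi) * ∑ e ∈ S, c e := by
  have hfd : ∀ {V : ℂ → ℂ} (v : ℂ), (∀ x ∉ S, ContDiffAt ℝ 1 V x) → ∀ x ∉ S,
      ContinuousAt (fun y => fderiv ℝ V y v) x := fun v hV x hx =>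
    ((hV x hx).fderiv_right (m := 0) (by norm_num)).continuousAt.clm_apply continuousAt_const
  -- integration by parts against the cut-off functions
  have hparts : ∀ᶠ n : ℕ in atTop,
      ∫ x, puncturedCutoff S n x • (fderiv ℝ V x 1 + fderiv ℝ W x Complex.I)
        = -(∫ x, fderiv ℝ (puncturedCutoff S n) x 1 • V x)
          - ∫ x, fderiv ℝ (puncturedCutoff S n) x Complex.I • W x := by
    filter_upwards [puncturedCutoff_eventually S, eventually_gt_atTop 0] with n hn hn0
    have hk := contDiff_puncturedCutoff S n
    have hcs := hasCompactSupport_puncturedCutoff S hn0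
    have hone : ∀ {V : ℂ → ℂ} (v : ℂ), (∀ x ∉ S, ContDiffAt ℝ 1 V x) →
        Integrable (fun x => puncturedCutoff S n x • fderiv ℝ V x v) ∧
        ∫ x, puncturedCutoff S n x • fderiv ℝ V x v
          = -∫ x, fderiv ℝ (puncturedCutoff S n) x v • V x := by
      intro V v hV
      have h1 := integrable_smul_of_tsupport hk.continuous hcs
        (fun x hx => hfd v hV x (hn x hx))
      refine ⟨h1, integral_smul_fderiv_eq_neg_fderiv_smul_of_integrable ?_ h1 ?_ ?_ ?_⟩
      · refine integrable_smul_of_tsupport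
          ((hk.continuous_fderiv (by norm_num)).clm_apply continuous_const) ?_ ?_
        · exact hcs.fderiv_apply ℝ v
        · exact fun x hx => (hV x (hn x (tsupport_fderiv_apply_subset ℝ v hx))).continuousAt
      · exact integrable_smul_of_tsupport hk.continuous hcs
          (fun x hx => (hV x (hn x hx)).continuousAt)
      · exact fun x _ => hk.differentiable (by norm_num) x
      · exact fun x hx => (hV x (hn x hx)).differentiableAt (by norm_num)
    obtain ⟨i1, e1⟩ := hone 1 hV
    obtain ⟨i2, e2⟩ := hone Complex.I hW
    simp only [smul_add]
    rw [integral_add i1 i2, e1, e2, sub_eq_add_neg]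
  have hleft : Tendsto
      (fun n => ∫ x, puncturedCutoff S n x • (fderiv ℝ V x 1 + fderiv ℝ W x Complex.I)) atTop
      (𝓝 (∫ x, (fderiv ℝ V x 1 + fderiv ℝ W x Complex.I))) := by
    refine tendsto_integral_of_dominated_convergence
      (fun x => (1 + S.card) * ‖fderiv ℝ V x 1 + fderiv ℝ W x Complex.I‖) ?_
      (hint.norm.const_mul _) ?_ ?_
    · exact fun n => (contDiff_puncturedCutoff S n).continuous.aestronglyMeasurable.smul hint.1
    · refine fun n => Eventually.of_forall fun x => ?_
      rw [norm_smul]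
      exact mul_le_mul_of_nonneg_right (abs_puncturedCutoff_le S n x) (norm_nonneg _)
    · have : ∀ᵐ x : ℂ, x ∉ S := measure_eq_zero_iff_ae_notMem.1 (S.finite_toSet.measure_zero _)
      filter_upwards [this] with x hx
      simpa using (tendsto_puncturedCutoff S hx).smul_const
        (fderiv ℝ V x 1 + fderiv ℝ W x Complex.I)
  have hright := (tendsto_integral_fderiv_puncturedCutoff S c 1 (by simp)
      (fun x hx => (hV x hx).continuousAt) hVc hVi).neg.sub
    (tendsto_integral_fderiv_puncturedCutoff S c Complex.I (by simp)
      (fun x hx => (hW x hx).continuousAt) hWc hWi)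
  have h := tendsto_nhds_unique hleft (hright.congr' (hparts.mono fun n hn => hn.symm))
  have hflux : ∀ v : ℂ, Integrable fun t : ℂ => fderiv ℝ cutoff t v * (v / t).re := by
    intro v
    refine integrable_smul_of_tsupport (G := fun t : ℂ => (v / t).re) (continuous_fderiv_cutoff v)
      (cutoff.hasCompactSupport.fderiv_apply ℝ v) fun t ht => ?_
    have ht0 : t ≠ 0 := by
      rintro rfl
      refine notMem_tsupport_iff_eventuallyEq.2 ?_ ht
      filter_upwards [Metric.ball_mem_nhds (0 : ℂ) one_pos] with s hs
      simp [fderiv_cutoff_of_lt_one (by simpa using hs)]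
    exact Complex.continuous_re.continuousAt.comp (continuousAt_const.div continuousAt_id ht0)
  have h2 := integral_fderiv_cutoff_mul
  rw [integral_add (hflux 1) (hflux Complex.I)] at h2
  have h3 := congrArg (fun r : ℝ => (r : ℂ)) h2
  push_cast at h3
  rw [h, ← h3, Finset.mul_sum, neg_neg, sub_neg_eq_add, ← Finset.sum_add_distrib]
  refine Finset.sum_congr rfl fun e _ => ?_
  ring

end Divergence

/-! ### Analysis on a smooth affine curve `y ^ 2 = F x` -/

namespace AffineCurve

open Filter

variable {F : ℂ[X]} {V : Type*} [NormedAddCommGroup V] [NormedSpace ℝ V]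

theorem mem_xChart_source (q : AffineCurve F) (hq : q.1.2 ≠ 0) : q ∈ (xChart q hq).source := by
  change 0 < (q.1.2 / q.1.2).re
  rw [div_self hq]
  simp

theorem chart_eq_xChart (hF : IsSmooth F) {q : AffineCurve F} (hq : q.1.2 ≠ 0) :
    chart hF q = xChart q hq := dif_neg hq

theorem xChart_symm_self (q : AffineCurve F) (hq : q.1.2 ≠ 0) :
    (xChart q hq).symm q.1.1 = q := (xChart q hq).left_inv (mem_xChart_source q hq)

theorem mem_xChart_target (q : AffineCurve F) (hq : q.1.2 ≠ 0) :
    q.1.1 ∈ (xChart q hq).target := (xChart q hq).map_source (mem_xChart_source q hq)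

/-- Near `q`, the curve is parametrized by the coordinate `x`, whatever chart `e` is used to
describe it: the change of coordinates from `e` to `x` is `t ↦ x (e⁻¹ t)`. -/
theorem eventually_xChart_symm (e : OpenPartialHomeomorph (AffineCurve F) ℂ) {q : AffineCurve F}
    (he : q ∈ e.source) (hq : q.1.2 ≠ 0) :
    ∀ᶠ t in 𝓝 (e q), (xChart q hq).symm (e.symm t).1.1 = e.symm t := by
  have h1 : ContinuousAt e.symm (e q) := e.continuousAt_symm (e.map_source he)
  have h2 : ∀ᶠ r in 𝓝 (e.symm (e q)), r ∈ (xChart q hq).source := by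
    rw [e.left_inv he]
    exact (xChart q hq).open_source.mem_nhds (mem_xChart_source q hq)
  filter_upwards [h1.eventually h2] with t ht
  exact (xChart q hq).left_inv ht

theorem analyticAt_chart_symm (hF : IsSmooth F) (p : AffineCurve F) {t : ℂ}
    (ht : t ∈ (chart hF p).target) :
    AnalyticAt ℂ (fun t => ((chart hF p).symm t).1.1) t :=
  (contDiff_fst.comp_contDiffOn (contDiffOn_chart_symm hF p)).contDiffAt
    ((chart hF p).open_target.mem_nhds ht) |>.analyticAt

/-- The Jacobian of the change from the preferred coordinate at `p` to the coordinate `x` at `q`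
vanishes to the same order as `y`. -/
theorem exists_norm_snd_eq (hF : IsSmooth F) (p : AffineCurve F) :
    ∃ k : AffineCurve F → ℝ, Continuous k ∧ (∀ q, 0 ≤ k q) ∧
      ∀ q ∈ (chart hF p).source, q.1.2 ≠ 0 →
        ‖q.1.2‖ = k q * ‖deriv (fun t => ((chart hF p).symm t).1.1) (chart hF p q)‖ := by
  by_cases h : p.1.2 = 0
  · -- in the coordinate `y`, differentiating `F (x y) = y ^ 2` gives `F' x * x' = 2 * y`
    refine ⟨fun q => ‖F.derivative.eval q.1.1‖ / 2, ?_, fun q => by positivity, ?_⟩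
    · have : Continuous fun q : AffineCurve F => F.derivative.eval q.1.1 :=
        F.derivative.continuous.comp (by fun_prop)
      fun_prop
    · intro q hq _
      set a := fun t => ((chart hF p).symm t).1.1 with ha
      have htgt := (chart hF p).map_source hq
      have had := (analyticAt_chart_symm hF p htgt).differentiableAt
      have hc : chart hF p = yChart p (hF.deriv_ne_zero p h) := dif_pos h
      have hcq : chart hF p q = q.1.2 := by rw [hc]; rfl
      have haq : a (chart hF p q) = q.1.1 := by
        simp only [ha]
        rw [(chart hF p).left_inv hq]
      have e1 : (fun t => F.eval (a t)) =ᶠ[𝓝 (chart hF p q)] fun t => t ^ 2 := by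
        filter_upwards [(chart hF p).open_target.mem_nhds htgt] with t ht
        rw [← ((chart hF p).symm t).2]
        have : chart hF p ((chart hF p).symm t) = t := (chart hF p).right_inv ht
        rw [hc] at this ⊢
        exact congrArg (· ^ 2) this
      have e2 : HasDerivAt (fun t => F.eval (a t))
          (F.derivative.eval q.1.1 * deriv a (chart hF p q)) (chart hF p q) := by
        have := (F.hasDerivAt (a (chart hF p q))).comp _ had.hasDerivAt
        rwa [haq] at this
      have e3 := e1.deriv_eq
      rw [e2.deriv] at e3
      have e4 : ‖F.derivative.eval q.1.1‖ * ‖deriv a (chart hF p q)‖ = 2 * ‖q.1.2‖ := by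
        rw [← norm_mul, e3]
        simp [hcq]
      linarith
  · refine ⟨fun q => ‖q.1.2‖, by fun_prop, fun q => by positivity, ?_⟩
    intro q hq _
    have htgt := (chart hF p).map_source hq
    have e1 : (fun t => ((chart hF p).symm t).1.1) = id := by
      rw [chart_eq_xChart hF h]
      rfl
    rw [e1]
    simp

/-- A function is of class `C²` in the preferred coordinates of a smooth affine curve. -/
def SmoothInCharts (hF : IsSmooth F) (η : AffineCurve F → V) : Prop :=
  ∀ p, ContDiffOn ℝ 2 (η ∘ (chart hF p).symm) (chart hF p).target

theorem SmoothInCharts.contDiffAt {hF : IsSmooth F} {η : AffineCurve F → V}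
    (hη : SmoothInCharts hF η) (q : AffineCurve F) (hq : q.1.2 ≠ 0) :
    ContDiffAt ℝ 2 (η ∘ (xChart q hq).symm) q.1.1 := by
  have := hη q
  rw [chart_eq_xChart hF hq] at this
  exact this.contDiffAt ((xChart q hq).open_target.mem_nhds (mem_xChart_target q hq))

theorem comp_symm_eventuallyEq {W : Type*} (η : AffineCurve F → W)
    (e : OpenPartialHomeomorph (AffineCurve F) ℂ) {q : AffineCurve F}
    (he : q ∈ e.source) (hq : q.1.2 ≠ 0) :
    η ∘ e.symm =ᶠ[𝓝 (e q)] (η ∘ (xChart q hq).symm) ∘ fun t => (e.symm t).1.1 := by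
  filter_upwards [eventually_xChart_symm e he hq] with t ht
  simp only [Function.comp_apply, ht]

/-- The first two derivatives of a smooth function with respect to the coordinate `x` blow up at
most like `1 / |y|` and `1 / |y|²` at the branch points. -/
theorem SmoothInCharts.exists_local_bound {hF : IsSmooth F} {η : AffineCurve F → V}
    (hη : SmoothInCharts hF η) (p : AffineCurve F) :
    ∃ C : ℝ, ∀ᶠ q in 𝓝 p, ∀ hq : q.1.2 ≠ 0,
      ‖q.1.2‖ * ‖fderiv ℝ (η ∘ (xChart q hq).symm) q.1.1‖ ≤ C ∧
      ‖q.1.2‖ ^ 2 * ‖Δ (η ∘ (xChart q hq).symm) q.1.1‖ ≤ C := by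
  obtain ⟨k, hk, hk0, hkq⟩ := exists_norm_snd_eq hF p
  set e := chart hF p with he
  set h := η ∘ e.symm with hh
  have hp : p ∈ e.source := mem_chart_source hF p
  have hcd : ContDiffAt ℝ 2 h (e p) :=
    (hη p).contDiffAt (e.open_target.mem_nhds (e.map_source hp))
  have hec : ContinuousAt e p := e.continuousAt hp
  have h1 : ContinuousAt (fun q => k q * ‖fderiv ℝ h (e q)‖) p :=
    hk.continuousAt.mul ((hcd.fderiv_right (m := 0) (by norm_num)).continuousAt.comp hec).norm
  have h2 : ContinuousAt (fun q => k q ^ 2 * ‖Δ h (e q)‖) p :=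
    (hk.continuousAt.pow 2).mul
      (ContinuousAt.comp (g := Δ h) (f := e) (continuousAt_laplacian hcd) hec).norm
  refine ⟨max (k p * ‖fderiv ℝ h (e p)‖ + 1) (k p ^ 2 * ‖Δ h (e p)‖ + 1), ?_⟩
  filter_upwards [h1.eventually_lt_const (lt_add_one _), h2.eventually_lt_const (lt_add_one _),
    e.open_source.mem_nhds hp] with q hq1 hq2 hqs hq
  have hM := hη.contDiffAt q hq
  have hev := comp_symm_eventuallyEq η e hqs hq
  have ha := analyticAt_chart_symm hF p (e.map_source hqs)
  have haq : ((chart hF p).symm (e q)).1.1 = q.1.1 := by rw [← he, e.left_inv hqs]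
  rw [← haq] at hM
  have hd1 := norm_fderiv_comp_holomorphic (hM.differentiableAt (by norm_num)) ha.differentiableAt
  have hd2 := laplacian_comp_holomorphic hM ha
  rw [← hev.fderiv_eq, haq] at hd1
  rw [← (InnerProductSpace.laplacian_congr_nhds hev).eq_of_nhds, haq] at hd2
  have hkk := hkq q hqs hq
  constructor
  · refine le_max_of_le_left (le_trans (le_of_eq ?_) hq1.le)
    rw [hd1, hkk]
    ring
  · refine le_max_of_le_right (le_trans (le_of_eq ?_) hq2.le)
    rw [hd2, hkk, norm_smul, norm_pow, norm_norm]
    ring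

theorem isCompact_norm_fst_le (R : ℝ) : IsCompact {q : AffineCurve F | ‖q.1.1‖ ≤ R} := by
  have hcl : IsClosed {p : ℂ × ℂ | p.2 ^ 2 = F.eval p.1} :=
    isClosed_eq (by fun_prop) (F.continuous.comp continuous_fst)
  have hemb : Topology.IsClosedEmbedding (Subtype.val : AffineCurve F → ℂ × ℂ) :=
    hcl.isClosedEmbedding_subtypeVal
  obtain ⟨M, hM⟩ := (isCompact_closedBall (0 : ℂ) R).exists_bound_of_continuousOn
    (f := fun x => F.eval x) F.continuous.continuousOn
  have hK : IsCompact (Metric.closedBall (0 : ℂ) R ×ˢ Metric.closedBall (0 : ℂ) (1 + M)) :=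
    (isCompact_closedBall _ _).prod (isCompact_closedBall _ _)
  refine (hemb.isCompact_preimage hK).of_isClosed_subset
    (isClosed_le (by fun_prop) continuous_const) fun q hq => ?_
  have h1 : ‖q.1.1‖ ≤ R := hq
  refine ⟨by simpa using h1, ?_⟩
  have h2 := hM q.1.1 (by simpa using h1)
  rw [← q.2, norm_pow] at h2
  have : ‖q.1.2‖ ≤ 1 + M := by nlinarith [norm_nonneg q.1.2]
  simpa using this

/-- The bounds of `SmoothInCharts.exists_local_bound` are uniform over bounded parts of the
curve. -/
theorem SmoothInCharts.exists_bound {hF : IsSmooth F} {η : AffineCurve F → V}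
    (hη : SmoothInCharts hF η) (R : ℝ) :
    ∃ C : ℝ, 0 ≤ C ∧ ∀ q : AffineCurve F, ‖q.1.1‖ ≤ R → ∀ hq : q.1.2 ≠ 0,
      ‖q.1.2‖ * ‖fderiv ℝ (η ∘ (xChart q hq).symm) q.1.1‖ ≤ C ∧
      ‖q.1.2‖ ^ 2 * ‖Δ (η ∘ (xChart q hq).symm) q.1.1‖ ≤ C := by
  have key := (isCompact_norm_fst_le (F := F) R).induction_on
    (p := fun s => ∃ C : ℝ, ∀ q ∈ s, ∀ hq : q.1.2 ≠ 0,
      ‖q.1.2‖ * ‖fderiv ℝ (η ∘ (xChart q hq).symm) q.1.1‖ ≤ C ∧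
      ‖q.1.2‖ ^ 2 * ‖Δ (η ∘ (xChart q hq).symm) q.1.1‖ ≤ C)
    ⟨0, by simp⟩
    (fun s t hst ⟨C, hC⟩ => ⟨C, fun q hq => hC q (hst hq)⟩)
    (fun s t ⟨C, hC⟩ ⟨C', hC'⟩ => ⟨max C C', fun q hq hy => by
      rcases hq with hq | hq
      · exact ⟨le_max_of_le_left (hC q hq hy).1, le_max_of_le_left (hC q hq hy).2⟩
      · exact ⟨le_max_of_le_right (hC' q hq hy).1, le_max_of_le_right (hC' q hq hy).2⟩⟩)
    (fun p _ => by
      obtain ⟨C, hC⟩ := hη.exists_local_bound p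
      exact ⟨_, mem_nhdsWithin_of_mem_nhds hC, C, fun q hq => hq⟩)
  obtain ⟨C, hC⟩ := key
  exact ⟨max C 0, le_max_right _ _, fun q hq hy =>
    ⟨le_max_of_le_left (hC q hq hy).1, le_max_of_le_left (hC q hq hy).2⟩⟩

/-- The Laplacian with respect to `x` at `q` may be computed in the chart at any nearby point. -/
theorem eventually_laplacian_xChart_eq (η : AffineCurve F → V) (p : AffineCurve F)
    (hp : p.1.2 ≠ 0) : ∀ᶠ q in 𝓝 p, ∀ hq : q.1.2 ≠ 0,
      Δ (η ∘ (xChart q hq).symm) q.1.1 = Δ (η ∘ (xChart p hp).symm) q.1.1 := by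
  filter_upwards [(xChart p hp).open_source.mem_nhds (mem_xChart_source p hp)] with q hqs hq
  exact (InnerProductSpace.laplacian_congr_nhds
    (comp_symm_eventuallyEq η (xChart p hp) hqs hq)).eq_of_nhds.symm

end AffineCurve

/-! ### The function `4 |F| / u` -/

section Factor

open Filter

/-- The function `x ↦ 4 |F x| / u(x, x̄)`. -/
noncomputable def factor (F : ℂ[X]) (u : MvPolynomial (Fin 2) ℂ) (x : ℂ) : ℝ :=
  4 * ‖F.eval x‖ / (evalConj u x).re

variable {F : ℂ[X]} {u : MvPolynomial (Fin 2) ℂ} (hu : ∀ x, 0 < evalConj u x)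

include hu

theorem factor_nonneg (x : ℂ) : 0 ≤ factor F u x :=
  div_nonneg (by positivity) (re_evalConj_pos hu x).le

theorem factor_eq_zero_iff {x : ℂ} : factor F u x = 0 ↔ F.eval x = 0 := by
  have := (re_evalConj_pos hu x).ne'
  simp [factor, this]

theorem log_factor {x : ℂ} (hx : F.eval x ≠ 0) : Real.log (factor F u x)
    = Real.log 4 + Real.log ‖F.eval x‖ - Real.log (evalConj u x).re := by
  have h := norm_ne_zero_iff.2 hx
  rw [factor, Real.log_div (by positivity) (re_evalConj_pos hu x).ne',
    Real.log_mul (by norm_num) h]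

theorem contDiffAt_log_factor {n : ℕ∞} {x : ℂ} (hx : F.eval x ≠ 0) :
    ContDiffAt ℝ n (fun x => Real.log (factor F u x)) x := by
  have hF : ContDiffAt ℝ n (fun x => F.eval x) x :=
    (F.differentiable.contDiff (n := n)).contDiffAt.restrict_scalars ℝ
  refine ContDiffAt.log (ContDiffAt.div (contDiffAt_const.mul (hF.norm ℝ hx))
    (contDiff_re_evalConj u).contDiffAt (re_evalConj_pos hu x).ne') ?_
  exact fun h => hx ((factor_eq_zero_iff hu).1 h)

/-- `log |F|` is harmonic, so only `log u` contributes to the Laplacian of `log (4 |F| / u)`. -/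
theorem laplacian_log_factor {x : ℂ} (hx : F.eval x ≠ 0) :
    Δ (fun x => Real.log (factor F u x)) x = -Δ (fun x => Real.log (evalConj u x).re) x := by
  have hh : InnerProductSpace.HarmonicAt (fun x => Real.log ‖F.eval x‖) x :=
    (F.differentiable.analyticAt x).harmonicAt_log_norm hx
  have hh' := (InnerProductSpace.harmonicAt_const (x := x) (Real.log 4)).add hh
  have e : (fun x => Real.log (factor F u x)) =ᶠ[𝓝 x]
      ((fun _ => Real.log 4) + fun x => Real.log ‖F.eval x‖)
        - fun x => Real.log (evalConj u x).re := by
    filter_upwards [(isOpen_ne_fun F.continuous continuous_const).mem_nhds hx] with y hy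
    exact log_factor hu hy
  rw [(InnerProductSpace.laplacian_congr_nhds e).eq_of_nhds,
    hh'.1.laplacian_sub (contDiff_log_evalConj hu (n := 2)).contDiffAt, hh'.2.eq_of_nhds]
  simp

/-- On the curve `y ^ 2 = F x`, `4 |F x| / u = 4 |y|² / u` is smooth also at the branch points. -/
theorem contDiffAt_factor_chart_symm (hF : AffineCurve.IsSmooth F) (p : AffineCurve F) {t : ℂ}
    (ht : t ∈ (AffineCurve.chart hF p).target) :
    ContDiffAt ℝ ∞ (fun t => factor F u ((AffineCurve.chart hF p).symm t).1.1) t := by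
  have h1 : ContDiffAt ℝ ∞ (fun t => ((AffineCurve.chart hF p).symm t).1) t :=
    (((AffineCurve.contDiffOn_chart_symm hF p).contDiffAt
      ((AffineCurve.chart hF p).open_target.mem_nhds ht)).of_le (by simp)).restrict_scalars ℝ
  have e : (fun t => factor F u ((AffineCurve.chart hF p).symm t).1.1)
      = fun t => 4 * ‖((AffineCurve.chart hF p).symm t).1.2‖ ^ 2
        / (evalConj u ((AffineCurve.chart hF p).symm t).1.1).re := by
    funext t
    rw [factor, ← ((AffineCurve.chart hF p).symm t).2, norm_pow]
  rw [e]
  have h2 : ContDiffAt ℝ ∞ (fun t => (evalConj u ((AffineCurve.chart hF p).symm t).1.1).re) t :=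
    (contDiff_re_evalConj u).contDiffAt.comp t (contDiff_fst.contDiffAt.comp t h1)
  exact (contDiffAt_const.mul ((contDiff_snd.contDiffAt.comp t h1).norm_sq ℝ)).div h2
    (re_evalConj_pos hu _).ne'

end Factor

namespace HyperellipticData

open Filter

variable {g : ℕ} (D : HyperellipticData g)

/-! ### Smooth functions on the hyperelliptic curve -/

instance isManifold_real : IsManifold 𝓘(ℝ, ℂ) ∞ D.Curve := by
  refine isManifold_of_contDiffOn _ _ _ fun e e' he he' => ?_
  have h : (e.symm ≫ₕ e') ∈ contDiffGroupoid ω 𝓘(ℂ, ℂ) :=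
    (contDiffGroupoid ω 𝓘(ℂ, ℂ)).compatible he he'
  rw [contDiffGroupoid, mem_groupoid_of_pregroupoid] at h
  have h1 : ContDiffOn ℂ ω (e.symm ≫ₕ e') (e.symm ≫ₕ e').source := by
    simpa [contDiffPregroupoid] using! h.1
  simpa using! (h1.restrict_scalars ℝ).of_le (by simp)

variable {V : Type} [NormedAddCommGroup V] [NormedSpace ℝ V]

theorem contMDiffAt_of_comp_symm {n : ℕ∞} {v : D.Curve → V} (P : D.Curve)
    (h : ContDiffAt ℝ n (v ∘ (chartAt ℂ P).symm) (chartAt ℂ P P)) :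
    ContMDiffAt 𝓘(ℝ, ℂ) 𝓘(ℝ, V) n v P := by
  rw [contMDiffAt_iff]
  refine ⟨?_, ?_⟩
  · have h1 : ContinuousAt ((v ∘ (chartAt ℂ P).symm) ∘ chartAt ℂ P) P :=
      ContinuousAt.comp h.continuousAt ((chartAt ℂ P).continuousAt (mem_chart_source ℂ P))
    refine h1.congr ?_
    filter_upwards [(chartAt ℂ P).open_source.mem_nhds (mem_chart_source ℂ P)] with Q hQ
    simp [(chartAt ℂ P).left_inv hQ]
  · simpa using! h.contDiffWithinAt

theorem smoothInCharts_ι₀ {η : D.Curve → V} (hη : ContMDiff 𝓘(ℝ, ℂ) 𝓘(ℝ, V) ∞ η) :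
    AffineCurve.SmoothInCharts D.isSmooth_f (η ∘ D.ι₀) := by
  intro p
  have h1 : D.chart₀ p ∈ IsManifold.maximalAtlas 𝓘(ℝ, ℂ) ∞ D.Curve :=
    IsManifold.subset_maximalAtlas (Or.inl ⟨p, rfl⟩)
  have h2 := hη.comp_contMDiffOn (contMDiffOn_symm_of_mem_maximalAtlas h1)
  exact (contMDiffOn_iff_contDiffOn.1 h2).of_le (by norm_cast)

theorem smoothInCharts_ι₁ {η : D.Curve → V} (hη : ContMDiff 𝓘(ℝ, ℂ) 𝓘(ℝ, V) ∞ η) :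
    AffineCurve.SmoothInCharts D.isSmooth_gPoly (η ∘ D.ι₁) := by
  intro p
  have h1 : D.chart₁ p ∈ IsManifold.maximalAtlas 𝓘(ℝ, ℂ) ∞ D.Curve :=
    IsManifold.subset_maximalAtlas (Or.inr ⟨p, rfl⟩)
  have h2 := hη.comp_contMDiffOn (contMDiffOn_symm_of_mem_maximalAtlas h1)
  exact (contMDiffOn_iff_contDiffOn.1 h2).of_le (by norm_cast)

/-! ### The solution -/

/-- The function `φ` on the hyperelliptic curve, equal to `4 |f| / u` on `C₀` and to `4 |g| / ũ`
on `C₀'`. -/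
noncomputable def phi (A : Matrix (Fin (g + 2)) (Fin (g + 2)) ℂ) (P : D.Curve) : ℝ :=
  Sum.elim (fun p : D.C₀ => factor D.f (matPoly A) p.1.1)
    (fun q : D.C₁ => factor D.gPoly (matPolyRev A) q.1.1) (D.rep P)

variable {A : Matrix (Fin (g + 2)) (Fin (g + 2)) ℂ}

theorem phi_ι₀ (p : D.C₀) : D.phi A (D.ι₀ p) = factor D.f (matPoly A) p.1.1 := by
  rw [phi, D.rep_ι₀]
  rfl

theorem factor_flip {z : ℂ} (hz : z ≠ 0) :
    factor D.gPoly (matPolyRev A) z = factor D.f (matPoly A) z⁻¹ := by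
  have h1 := D.eval_gPoly (inv_ne_zero hz)
  rw [one_div, inv_inv] at h1
  have h0 : ‖z‖ ≠ 0 := norm_ne_zero_iff.2 hz
  rw [factor, factor, h1, re_evalConj_matPolyRev A hz]
  have : 2 * (g + 2 - 1) = 2 * g + 2 := by omega
  rw [this, norm_div, norm_pow, norm_inv, inv_pow, div_inv_eq_mul]
  field_simp

theorem rep_ι₁ (q : D.C₁) : D.rep (D.ι₁ q) = .inr q ∨
    ∃ p, D.rep (D.ι₁ q) = .inl p ∧ q.1.1 ≠ 0 ∧ p.1.1 = q.1.1⁻¹ := by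
  have h := D.mk_rep (D.ι₁ q)
  rcases hr : D.rep (D.ι₁ q) with p | q'
  · rw [hr] at h
    obtain ⟨h1, h2⟩ := D.ι₀_eq_ι₁'.1 h
    exact Or.inr ⟨p, rfl, h1, by rw [h2, one_div]⟩
  · rw [hr] at h
    exact Or.inl (congrArg _ (D.ι₁_injective h))

theorem phi_ι₁ (q : D.C₁) : D.phi A (D.ι₁ q) = factor D.gPoly (matPolyRev A) q.1.1 := by
  rcases D.rep_ι₁ q with h | ⟨p, h, h1, h2⟩
  · rw [phi, h]
    rfl
  · rw [phi, h, D.factor_flip h1, ← h2]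
    rfl

/-- Every point of the curve lies on `C₀`, or is a point `(0, w)` of `C₀'` with `w ≠ 0`; in the
second case it is represented by that point. -/
theorem exists_rep (P : D.Curve) : (∃ p, P = D.ι₀ p) ∨
    ∃ q : D.C₁, P = D.ι₁ q ∧ D.rep P = .inr q ∧ q.1.1 = 0 ∧ q.1.2 ≠ 0 := by
  by_cases h : ∃ p, P = D.ι₀ p
  · exact Or.inl h
  obtain ⟨q, hq⟩ := (D.ι_surjective P).resolve_left fun ⟨p, hp⟩ => h ⟨p, hp.symm⟩
  have hrep : D.rep P = .inr q := by
    rcases D.rep_ι₁ q with h' | ⟨p, h', -⟩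
    · rw [← hq, h']
    · have := D.mk_rep P
      rw [← hq, h'] at this
      exact (h ⟨p, by rw [← hq, ← this]; rfl⟩).elim
  have hz : q.1.1 = 0 := by
    by_contra hz
    refine h ⟨⟨(1 / q.1.1, q.1.2 / q.1.1 ^ (g + 1)), D.flip_mem₁ hz q.2⟩, ?_⟩
    rw [← hq, eq_comm]
    exact D.ι₀_eq_ι₁'.2 ⟨hz, rfl⟩
  refine Or.inr ⟨q, hq.symm, hrep, hz, fun hw => ?_⟩
  have := q.2
  rw [hz, hw] at this
  exact D.lead_ne_zero (by simpa [gPoly, Polynomial.eval_prod] using this.symm)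

theorem eval_f_eq_zero_iff {x : ℂ} : D.f.eval x = 0 ↔ ∃ k, x = D.root k := by
  simp [f, Polynomial.eval_prod, D.lead_ne_zero, Finset.prod_eq_zero_iff, sub_eq_zero]

theorem mem_range_weierstrassPoint {p : D.C₀} :
    D.ι₀ p ∈ Set.range D.weierstrassPoint ↔ p.1.2 = 0 := by
  constructor
  · rintro ⟨k, hk⟩
    rw [← D.ι₀_injective hk]
  · intro hp
    have h0 : D.f.eval p.1.1 = 0 := by rw [← p.2, hp]; simp
    obtain ⟨k, hk⟩ := D.eval_f_eq_zero_iff.1 h0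
    exact ⟨k, congrArg D.ι₀ (Subtype.ext (Prod.ext hk.symm hp.symm))⟩

theorem ι₁_notMem_range_weierstrassPoint {q : D.C₁} (hq : q.1.1 = 0) :
    D.ι₁ q ∉ Set.range D.weierstrassPoint := by
  rintro ⟨k, hk⟩
  exact (D.ι₀_eq_ι₁'.1 hk).1 hq

variable (hA : A.PosDef)

include hA

theorem phi_nonneg (P : D.Curve) : 0 ≤ D.phi A P := by
  rcases D.exists_rep P with ⟨p, rfl⟩ | ⟨q, rfl, -⟩
  · rw [phi_ι₀]
    exact factor_nonneg (evalConj_matPoly_pos hA) _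
  · rw [phi_ι₁]
    exact factor_nonneg (evalConj_matPolyRev_pos hA) _

theorem phi_eq_zero_iff {P : D.Curve} :
    D.phi A P = 0 ↔ P ∈ Set.range D.weierstrassPoint := by
  rcases D.exists_rep P with ⟨p, rfl⟩ | ⟨q, rfl, -, hz, hw⟩
  · rw [phi_ι₀, factor_eq_zero_iff (evalConj_matPoly_pos hA), mem_range_weierstrassPoint, ← p.2]
    simp
  · rw [phi_ι₁, factor_eq_zero_iff (evalConj_matPolyRev_pos hA), ← q.2]
    simp [hw, D.ι₁_notMem_range_weierstrassPoint hz]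

theorem contDiffAt_phi_comp_symm (P : D.Curve) :
    ContDiffAt ℝ ∞ (D.phi A ∘ (chartAt ℂ P).symm) (chartAt ℂ P P) := by
  have ht := (chartAt ℂ P).map_source (mem_chart_source ℂ P)
  have hP : chartAt ℂ P = Sum.elim D.chart₀ D.chart₁ (D.rep P) := rfl
  rcases hr : D.rep P with p | q
  · rw [hP, hr] at ht ⊢
    have e : D.phi A ∘ (Sum.elim D.chart₀ D.chart₁ (.inl p)).symm
      = fun t => factor D.f (matPoly A) ((AffineCurve.chart D.isSmooth_f p).symm t).1.1 :=
      funext fun t => D.phi_ι₀ _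
    rw [e]
    exact contDiffAt_factor_chart_symm (evalConj_matPoly_pos hA) _ p ht
  · rw [hP, hr] at ht ⊢
    have e : D.phi A ∘ (Sum.elim D.chart₀ D.chart₁ (.inr q)).symm
      = fun t => factor D.gPoly (matPolyRev A)
        ((AffineCurve.chart D.isSmooth_gPoly q).symm t).1.1 :=
      funext fun t => D.phi_ι₁ _
    rw [e]
    exact contDiffAt_factor_chart_symm (evalConj_matPolyRev_pos hA) _ q ht

theorem contMDiff_phi : ContMDiff 𝓘(ℝ, ℂ) 𝓘(ℝ, ℝ) ∞ (D.phi A) := fun P =>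
  D.contMDiffAt_of_comp_symm P (D.contDiffAt_phi_comp_symm hA P)

theorem contMDiffOn_log_phi : ContMDiffOn 𝓘(ℝ, ℂ) 𝓘(ℝ, ℝ) ∞ (fun P => Real.log (D.phi A P))
    (Set.range D.weierstrassPoint)ᶜ := by
  intro P hP
  refine (D.contMDiffAt_of_comp_symm P ?_).contMDiffWithinAt
  refine ContDiffAt.log (D.contDiffAt_phi_comp_symm hA P) ?_
  rw [(chartAt ℂ P).left_inv (mem_chart_source ℂ P)]
  exact fun h => hP ((D.phi_eq_zero_iff hA).1 h)

omit hA

theorem laplace_ι₀ (H : Matrix (Fin g) (Fin g) ℂ) (v : D.Curve → V) (p : D.C₀)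
    (hp : p.1.2 ≠ 0) : D.laplace H v (D.ι₀ p) = ((evalConj (matPoly H) p.1.1).re / ‖p.1.2‖ ^ 2)⁻¹ •
      Δ ((v ∘ D.ι₀) ∘ (AffineCurve.xChart p hp).symm) p.1.1 := by
  have h1 : D.density H (D.ι₀ p) = (evalConj (matPoly H) p.1.1).re / ‖p.1.2‖ ^ 2 := by
    rw [density, D.rep_ι₀]
    exact if_neg hp
  have h2 : D.chart₀ p (D.ι₀ p) = p.1.1 := by
    rw [chart₀, OpenPartialHomeomorph.lift_openEmbedding_apply, AffineCurve.chart_eq_xChart _ hp]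
    rfl
  rw [laplace, h1, D.chartAt_ι₀, h2]
  congr 2
  rw [chart₀, AffineCurve.chart_eq_xChart _ hp]
  rfl

theorem laplace_ι₁ (H : Matrix (Fin g) (Fin g) ℂ) (v : D.Curve → V) {q : D.C₁}
    (hr : D.rep (D.ι₁ q) = .inr q) (hq : q.1.2 ≠ 0) :
    D.laplace H v (D.ι₁ q) = ((evalConj (matPolyRev H) q.1.1).re / ‖q.1.2‖ ^ 2)⁻¹ •
      Δ ((v ∘ D.ι₁) ∘ (AffineCurve.xChart q hq).symm) q.1.1 := by
  have h1 : D.density H (D.ι₁ q) = (evalConj (matPolyRev H) q.1.1).re / ‖q.1.2‖ ^ 2 := by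
    rw [density, hr]
    exact if_neg hq
  have h0 : chartAt ℂ (D.ι₁ q) = D.chart₁ q := by
    change Sum.elim D.chart₀ D.chart₁ (D.rep (D.ι₁ q)) = _
    rw [hr]
    rfl
  have h2 : D.chart₁ q (D.ι₁ q) = q.1.1 := by
    rw [chart₁, OpenPartialHomeomorph.lift_openEmbedding_apply, AffineCurve.chart_eq_xChart _ hq]
    rfl
  rw [laplace, h1, h0, h2]
  congr 2
  rw [chart₁, AffineCurve.chart_eq_xChart _ hq]
  rfl

/-- The mean field equation holds pointwise away from the Weierstrass points. -/
theorem laplace_log_phi_add_exp (hg : 1 ≤ g) {H : Matrix (Fin g) (Fin g) ℂ} (hH : H.PosDef)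
    (hA : A.PosDef) (hsol : SolvesPDE (matPoly H) (matPoly A)) {P : D.Curve}
    (hP : P ∉ Set.range D.weierstrassPoint) :
    D.laplace H (fun Q => Real.log (D.phi A Q)) P + Real.exp (Real.log (D.phi A P)) = 0 := by
  have : NeZero g := ⟨by omega⟩
  have hpos : 0 < D.phi A P := lt_of_le_of_ne (D.phi_nonneg hA P) fun h =>
    hP ((D.phi_eq_zero_iff hA).1 h.symm)
  rw [Real.exp_log hpos]
  have key : ∀ {F : ℂ[X]} {y x s u : ℂ} {l : ℝ}, 0 < s.re → 0 < u.re → y ≠ 0 → y ^ 2 = F.eval x →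
      l = -(4 * s.re / u.re) → (s.re / ‖y‖ ^ 2)⁻¹ • l + 4 * ‖F.eval x‖ / u.re = 0 := by
    rintro F y x s u l hs hu hy hyF rfl
    have := norm_ne_zero_iff.2 hy
    rw [← hyF, norm_pow, smul_eq_mul]
    field_simp
    ring
  rcases D.exists_rep P with ⟨p, rfl⟩ | ⟨q, rfl, hr, hz, hw⟩
  · have hy : p.1.2 ≠ 0 := fun h => hP (D.mem_range_weierstrassPoint.2 h)
    have hx : D.f.eval p.1.1 ≠ 0 := by rw [← p.2]; exact pow_ne_zero 2 hy
    rw [D.laplace_ι₀ H _ p hy, phi_ι₀]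
    refine key (re_evalConj_pos (evalConj_matPoly_pos hH) _)
      (re_evalConj_pos (evalConj_matPoly_pos hA) _) hy p.2 ?_
    have e : ((fun Q => Real.log (D.phi A Q)) ∘ D.ι₀) ∘ (AffineCurve.xChart p hy).symm
        = fun x => Real.log (factor D.f (matPoly A) x) := funext fun x => by
      simp only [Function.comp_apply, phi_ι₀]
      rfl
    rw [e, laplacian_log_factor (evalConj_matPoly_pos hA) hx,
      laplacian_log_evalConj hsol (evalConj_matPoly_pos hA)]
  · have hx : D.gPoly.eval q.1.1 ≠ 0 := by rw [← q.2]; exact pow_ne_zero 2 hw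
    rw [D.laplace_ι₁ H _ hr hw, phi_ι₁]
    refine key (re_evalConj_pos (evalConj_matPolyRev_pos hH) _)
      (re_evalConj_pos (evalConj_matPolyRev_pos hA) _) hw q.2 ?_
    have e : ((fun Q => Real.log (D.phi A Q)) ∘ D.ι₁) ∘ (AffineCurve.xChart q hw).symm
        = fun x => Real.log (factor D.gPoly (matPolyRev A) x) := funext fun x => by
      simp only [Function.comp_apply, phi_ι₁]
      rfl
    rw [e, laplacian_log_factor (evalConj_matPolyRev_pos hA) hx,
      laplacian_log_evalConj_matPolyRev hg hA hsol]

end HyperellipticData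

/-! ### Asymptotics at the branch points and at infinity -/

namespace HyperellipticData

open Filter MeasureTheory Asymptotics

variable {g : ℕ} (D : HyperellipticData g)

theorem eval_root (k : Fin (2 * g + 2)) : D.f.eval (D.root k) = 0 :=
  D.eval_f_eq_zero_iff.2 ⟨k, rfl⟩

theorem deriv_root_ne_zero (k : Fin (2 * g + 2)) : D.f.derivative.eval (D.root k) ≠ 0 :=
  D.isSmooth_f _ (D.eval_root k)

theorem tendsto_sub_div_eval (k : Fin (2 * g + 2)) :
    Tendsto (fun x => (x - D.root k) / D.f.eval x) (𝓝[≠] D.root k)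
      (𝓝 (D.f.derivative.eval (D.root k))⁻¹) := by
  have h := (hasDerivAt_iff_tendsto_slope.1 (D.f.hasDerivAt (D.root k))).inv₀
    (D.deriv_root_ne_zero k)
  refine h.congr fun x => ?_
  simp [slope_def_field, D.eval_root]

theorem eventually_eval_ne_zero (k : Fin (2 * g + 2)) :
    ∀ᶠ x in 𝓝[≠] D.root k, D.f.eval x ≠ 0 := by
  have h := (D.f.hasDerivAt (D.root k)).eventually_ne (D.deriv_root_ne_zero k) (c := 0)
  exact h

/-- The logarithmic derivative of `f` has a simple pole with residue `1` at each root. -/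
theorem tendsto_sub_mul_logDeriv (k : Fin (2 * g + 2)) :
    Tendsto (fun x => (x - D.root k) * (D.f.derivative.eval x / D.f.eval x)) (𝓝[≠] D.root k)
      (𝓝 1) := by
  have h1 : Tendsto (fun x => D.f.derivative.eval x) (𝓝[≠] D.root k)
      (𝓝 (D.f.derivative.eval (D.root k))) :=
    (D.f.derivative.continuous.tendsto _).mono_left nhdsWithin_le_nhds
  have h2 := h1.mul (D.tendsto_sub_div_eval k)
  rw [mul_inv_cancel₀ (D.deriv_root_ne_zero k)] at h2
  refine h2.congr fun x => ?_
  ring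

theorem tendsto_norm_eval (k : Fin (2 * g + 2)) :
    Tendsto (fun x => ‖D.f.eval x‖) (𝓝[≠] D.root k) (𝓝[>] 0) := by
  refine tendsto_nhdsWithin_iff.2 ⟨?_, (D.eventually_eval_ne_zero k).mono fun x hx =>
    norm_pos_iff.2 hx⟩
  have := (D.f.continuous.norm.tendsto (D.root k)).mono_left
    (nhdsWithin_le_nhds (s := {D.root k}ᶜ))
  simpa [D.eval_root] using this

theorem tendsto_sqrt_norm_eval (k : Fin (2 * g + 2)) :
    Tendsto (fun x => √‖D.f.eval x‖) (𝓝[≠] D.root k) (𝓝 0) := by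
  have := (Real.continuous_sqrt.tendsto 0).comp
    ((D.tendsto_norm_eval k).mono_right nhdsWithin_le_nhds)
  rwa [Real.sqrt_zero] at this

variable {A : Matrix (Fin (g + 2)) (Fin (g + 2)) ℂ} (hA : A.PosDef)

include hA

/-- The logarithmic singularity of `log φ` is killed by `√|f|`. -/
theorem tendsto_sqrt_mul_log_factor (k : Fin (2 * g + 2)) :
    Tendsto (fun x => √‖D.f.eval x‖ * Real.log (factor D.f (matPoly A) x)) (𝓝[≠] D.root k)
      (𝓝 0) := by
  have hp := evalConj_matPoly_pos hA
  have h1 := (tendsto_log_mul_rpow_nhdsGT_zero (r := 1 / 2) (by norm_num)).comp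
    (D.tendsto_norm_eval k)
  have h3 : Tendsto (fun x => Real.log 4 - Real.log (evalConj (matPoly A) x).re) (𝓝[≠] D.root k)
      (𝓝 (Real.log 4 - Real.log (evalConj (matPoly A) (D.root k)).re)) :=
    (((contDiff_log_evalConj hp (n := 0)).continuous.tendsto _).mono_left
      nhdsWithin_le_nhds).const_sub _
  have h4 := h1.add ((D.tendsto_sqrt_norm_eval k).mul h3)
  rw [zero_mul, add_zero] at h4
  refine h4.congr' ?_
  filter_upwards [D.eventually_eval_ne_zero k] with x hx
  rw [log_factor hp hx, Real.sqrt_eq_rpow]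
  simp only [Function.comp_apply]
  ring

theorem fderiv_log_factor {x : ℂ} (hx : D.f.eval x ≠ 0) (v : ℂ) :
    fderiv ℝ (fun x => Real.log (factor D.f (matPoly A) x)) x v
      = (D.f.derivative.eval x / D.f.eval x * v).re
        - fderiv ℝ (fun x => Real.log (evalConj (matPoly A) x).re) x v := by
  have hp := evalConj_matPoly_pos hA
  -- `log |f|` is locally the real part of a branch of `log f`
  have e : (fun x => Real.log (factor D.f (matPoly A) x)) =ᶠ[𝓝 x] fun y =>
      (Real.log 4 + Real.log ‖D.f.eval x‖ + (Complex.log (D.f.eval y / D.f.eval x)).re)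
        - Real.log (evalConj (matPoly A) y).re := by
    filter_upwards [(isOpen_ne_fun D.f.continuous continuous_const).mem_nhds hx] with y hy
    rw [log_factor hp hy, Complex.log_re, norm_div, Real.log_div (norm_ne_zero_iff.2 hy)
      (norm_ne_zero_iff.2 hx)]
    ring
  have h1 : HasDerivAt (fun y => Complex.log (D.f.eval y / D.f.eval x))
      (D.f.derivative.eval x / D.f.eval x) x := by
    have := ((D.f.hasDerivAt x).div_const (D.f.eval x)).clog (by
      rw [div_self hx]; exact Complex.one_mem_slitPlane)
    simpa [div_self hx] using this
  have h2 : HasFDerivAt (𝕜 := ℝ) (fun y => (Complex.log (D.f.eval y / D.f.eval x)).re) _ x :=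
    Complex.reCLM.hasFDerivAt.comp x (h1.hasFDerivAt.restrictScalars ℝ)
  have h3 := ((contDiff_log_evalConj hp (n := 1)).differentiable (by norm_num) x).hasFDerivAt
  rw [e.fderiv_eq, ((h2.const_add _).fun_sub h3).fderiv]
  simp [mul_comm]

/-- Near a branch point `e`, the gradient of `log φ` is asymptotic to that of `log ‖x - e‖`. -/
theorem tendsto_sub_mul_fderiv_log_factor (k : Fin (2 * g + 2)) (v : ℂ) :
    Tendsto (fun x => (x - D.root k) *
      ((fderiv ℝ (fun x => Real.log (factor D.f (matPoly A) x)) x v : ℝ)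
        - ((v / (x - D.root k)).re : ℂ))) (𝓝[≠] D.root k) (𝓝 0) := by
  have hp := evalConj_matPoly_pos hA
  have h1 : Tendsto (fun x => ‖v‖ * ‖(x - D.root k) * (D.f.derivative.eval x / D.f.eval x) - 1‖
      + ‖x - D.root k‖ * ‖fderiv ℝ (fun x => Real.log (evalConj (matPoly A) x).re) x v‖)
      (𝓝[≠] D.root k) (𝓝 0) := by
    have e1 := ((D.tendsto_sub_mul_logDeriv k).sub_const 1).norm.const_mul ‖v‖
    have e2 : Continuous fun x => ‖x - D.root k‖ *
        ‖fderiv ℝ (fun x => Real.log (evalConj (matPoly A) x).re) x v‖ := by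
      have := ((contDiff_log_evalConj hp (n := 1)).continuous_fderiv (by norm_num)).clm_apply
        (continuous_const (y := v))
      fun_prop
    have e3 := e1.add ((e2.tendsto (D.root k)).mono_left nhdsWithin_le_nhds)
    simpa using e3
  refine squeeze_zero_norm' ?_ h1
  filter_upwards [D.eventually_eval_ne_zero k, self_mem_nhdsWithin] with x hx hne
  have hxe : x - D.root k ≠ 0 := sub_ne_zero.2 hne
  rw [D.fderiv_log_factor hA hx]
  have e1 : ((D.f.derivative.eval x / D.f.eval x * v).re
        - fderiv ℝ (fun x => Real.log (evalConj (matPoly A) x).re) x v : ℝ)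
      - (v / (x - D.root k)).re
      = (v * ((x - D.root k) * (D.f.derivative.eval x / D.f.eval x) - 1) / (x - D.root k)).re
        - fderiv ℝ (fun x => Real.log (evalConj (matPoly A) x).re) x v := by
    have : v * ((x - D.root k) * (D.f.derivative.eval x / D.f.eval x) - 1) / (x - D.root k)
        = D.f.derivative.eval x / D.f.eval x * v - v / (x - D.root k) := by
      field_simp
    rw [this, Complex.sub_re]
    ring
  rw [← Complex.ofReal_sub, e1, norm_mul, Complex.norm_real]
  have h0 := norm_pos_iff.2 hxe
  calc ‖x - D.root k‖ * _ ≤ ‖x - D.root k‖ * (‖v * ((x - D.root k) *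
        (D.f.derivative.eval x / D.f.eval x) - 1) / (x - D.root k)‖ + _) := by
        gcongr
        exact (norm_sub_le _ _).trans (add_le_add_left (Complex.abs_re_le_norm _) _)
    _ = _ := by
        rw [norm_div, norm_mul]
        field_simp

omit hA in
theorem log_factor_eq_inv {x : ℂ} (hx : x ≠ 0) : Real.log (factor D.f (matPoly A) x)
    = Real.log (factor D.gPoly (matPolyRev A) x⁻¹) := by
  rw [D.factor_flip (inv_ne_zero hx), inv_inv]

omit hA in
theorem gPoly_eval_zero : D.gPoly.eval 0 ≠ 0 := by
  simpa [gPoly, Polynomial.eval_prod] using D.lead_ne_zero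

omit hA in
theorem tendsto_inv_cocompact : Tendsto (fun x : ℂ => x⁻¹) (cocompact ℂ) (𝓝 0) := by
  rw [← Metric.cobounded_eq_cocompact]
  exact tendsto_inv₀_cobounded

omit hA in
theorem eventually_ne_zero_cocompact : ∀ᶠ x : ℂ in cocompact ℂ, x ≠ 0 :=
  (isCompact_singleton (x := (0 : ℂ))).compl_mem_cocompact

omit hA in
theorem eventually_gPoly_inv : ∀ᶠ x : ℂ in cocompact ℂ, D.gPoly.eval x⁻¹ ≠ 0 :=
  tendsto_inv_cocompact.eventually
    ((isOpen_ne_fun D.gPoly.continuous continuous_const).mem_nhds D.gPoly_eval_zero)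

theorem isBigO_log_factor_cocompact :
    (fun x => Real.log (factor D.f (matPoly A) x)) =O[cocompact ℂ] fun _ => (1 : ℝ) := by
  have h1 : ContinuousAt (fun x => Real.log (factor D.gPoly (matPolyRev A) x)) 0 :=
    (contDiffAt_log_factor (evalConj_matPolyRev_pos hA) D.gPoly_eval_zero (n := 0)).continuousAt
  have h2 := h1.tendsto.comp (tendsto_inv_cocompact)
  refine (h2.isBigO_one ℝ).congr' ?_ EventuallyEq.rfl
  filter_upwards [eventually_ne_zero_cocompact] with x hx
  exact (D.log_factor_eq_inv hx).symm

theorem isBigO_fderiv_log_factor_cocompact :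
    (fun x => fderiv ℝ (fun x => Real.log (factor D.f (matPoly A) x)) x) =O[cocompact ℂ]
      fun x => ‖x‖⁻¹ ^ 2 := by
  have hp := evalConj_matPolyRev_pos hA
  have h1 : ContinuousAt (fderiv ℝ (fun x => Real.log (factor D.gPoly (matPolyRev A) x))) 0 :=
    ((contDiffAt_log_factor hp D.gPoly_eval_zero (n := 1)).fderiv_right (m := 0)
      (by norm_num)).continuousAt
  have h2 := ((h1.tendsto.comp (tendsto_inv_cocompact)).isBigO_one ℝ).norm_left.mul
    (isBigO_refl (fun x : ℂ => ‖x‖⁻¹ ^ 2) (cocompact ℂ))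
  refine IsBigO.of_norm_left ?_
  refine h2.congr' ?_ (by simp)
  filter_upwards [eventually_ne_zero_cocompact, D.eventually_gPoly_inv] with x hx hgx
  have e : (fun x => Real.log (factor D.f (matPoly A) x)) =ᶠ[𝓝 x]
      (fun x => Real.log (factor D.gPoly (matPolyRev A) x)) ∘ fun y => y⁻¹ := by
    filter_upwards [isOpen_ne.mem_nhds hx] with y hy
    exact D.log_factor_eq_inv hy
  rw [e.fderiv_eq, norm_fderiv_comp_holomorphic
    ((contDiffAt_log_factor hp hgx (n := 1)).differentiableAt (by norm_num))
    (differentiableAt_inv hx)]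
  simp [mul_comm]

omit hA

/-! ### Integrability with respect to the area measure -/

/-- The density `σ_H(x, x̄) / |f x|` of the area measure in the coordinate `x`. -/
noncomputable def weight (H : Matrix (Fin g) (Fin g) ℂ) (x : ℂ) : ℝ :=
  (evalConj (matPoly H) x).re / ‖D.f.eval x‖

variable {H : Matrix (Fin g) (Fin g) ℂ}

theorem weight_nonneg [NeZero g] (hH : H.PosDef) (x : ℂ) : 0 ≤ D.weight H x :=
  div_nonneg (re_evalConj_pos (evalConj_matPoly_pos hH) x).le (norm_nonneg _)

theorem measurable_weight : Measurable (D.weight H) :=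
  (contDiff_re_evalConj _ (n := 0)).continuous.measurable.div D.f.continuous.norm.measurable

theorem measurable_log_factor :
    Measurable fun x => Real.log (factor D.f (matPoly A) x) :=
  Real.measurable_log.comp ((measurable_const.mul D.f.continuous.norm.measurable).div
    (contDiff_re_evalConj _ (n := 0)).continuous.measurable)

theorem isBigO_weight_cocompact (hg : 1 ≤ g) :
    D.weight H =O[cocompact ℂ] fun x => ‖x‖⁻¹ ^ 4 := by
  have h1 : ContinuousAt (fun z => (evalConj (matPolyRev H) z).re / ‖D.gPoly.eval z‖) 0 :=
    (contDiff_re_evalConj _ (n := 0)).continuous.continuousAt.div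
      D.gPoly.continuous.norm.continuousAt (norm_ne_zero_iff.2 D.gPoly_eval_zero)
  have h2 := ((h1.tendsto.comp (tendsto_inv_cocompact)).isBigO_one ℝ).mul
    (isBigO_refl (fun x : ℂ => ‖x‖⁻¹ ^ 4) (cocompact ℂ))
  refine h2.congr' ?_ (by simp)
  filter_upwards [eventually_ne_zero_cocompact] with x hx
  have e1 := D.eval_gPoly hx
  have h0 : ‖x‖ ≠ 0 := norm_ne_zero_iff.2 hx
  rw [one_div] at e1
  simp only [Function.comp_apply, weight]
  rw [e1, re_evalConj_matPolyRev H (inv_ne_zero hx), inv_inv, norm_div, norm_pow, norm_inv]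
  obtain ⟨m, rfl⟩ : ∃ m, g = m + 1 := ⟨g - 1, by omega⟩
  have e2 : 2 * (m + 1 - 1) = 2 * m := by omega
  rw [e2]
  have e3 : ‖x‖⁻¹ ^ 4 = ‖x‖ ^ (2 * m) / ‖x‖ ^ (2 * (m + 1) + 2) := by
    field_simp
    ring
  rw [e3, inv_pow]
  field_simp

include hA in
/-- `log φ` and the constants are integrable with respect to the area measure. -/
theorem integrable_log_mul_weight (hg : 1 ≤ g) :
    Integrable fun x => (1 + |Real.log (factor D.f (matPoly A) x)|) * D.weight H x := by
  have hp := evalConj_matPoly_pos hA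
  have hm : Measurable fun x => (1 + |Real.log (factor D.f (matPoly A) x)|) * D.weight H x :=
    (measurable_const.add (measurable_norm.comp D.measurable_log_factor)).mul D.measurable_weight
  have hloc : LocallyIntegrable
      fun x => (1 + |Real.log (factor D.f (matPoly A) x)|) * D.weight H x := by
    intro x
    by_cases hx : D.f.eval x = 0
    · -- at a simple zero `e`, `log |f| / |f|` is dominated by `|f|^(-3/2)`, hence by the locally
      -- integrable function `‖x - e‖^(-3/2)`
      obtain ⟨k, rfl⟩ := D.eval_f_eq_zero_iff.1 hx
      have hint : IntegrableAtFilter (fun x : ℂ => ‖x - D.root k‖ ^ (-(3 / 2) : ℝ))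
          (𝓝 (D.root k)) := by
        have h1 : IntegrableOn (fun y : ℂ => ‖y‖ ^ (-(3 / 2) : ℝ)) (Metric.ball 0 1) :=
          integrableOn_ball_of_norm_le_rpow (μ := volume) (C := 1) (α := 3 / 2) (by simp)
            (by rw [Complex.finrank_real_complex]; norm_num)
            (Eventually.of_forall fun y => by
              rw [Real.norm_of_nonneg (by positivity), one_mul])
            (measurable_norm.pow_const _).aestronglyMeasurable
        refine ⟨Metric.ball (D.root k) 1, Metric.ball_mem_nhds _ one_pos, ?_⟩
        have h2 := (integrable_indicator_iff (Metric.isOpen_ball.measurableSet)).2 h1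
        have h3 := h2.comp_sub_right (D.root k)
        rw [← integrable_indicator_iff Metric.isOpen_ball.measurableSet]
        refine h3.congr (Eventually.of_forall fun y => ?_)
        simp only [Set.indicator, Metric.mem_ball, dist_eq_norm, sub_zero]
      refine IsBigO.integrableAtFilter ?_ ⟨Set.univ, univ_mem, hm.aestronglyMeasurable⟩ hint
      have hne : (fun x => (1 + |Real.log (factor D.f (matPoly A) x)|) * D.weight H x)
          =O[𝓝[≠] D.root k] fun x => ‖x - D.root k‖ ^ (-(3 / 2) : ℝ) := by
        have b1 : (fun x => √‖D.f.eval x‖ * (1 + |Real.log (factor D.f (matPoly A) x)|))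
            =O[𝓝[≠] D.root k] fun _ => (1 : ℝ) := by
          have h3 := (D.tendsto_sqrt_norm_eval k).add (D.tendsto_sqrt_mul_log_factor hA k).abs
          refine (h3.isBigO_one ℝ).congr_left fun x => ?_
          rw [abs_mul, abs_of_nonneg (Real.sqrt_nonneg _)]
          ring
        have b2 : (fun x => (evalConj (matPoly H) x).re) =O[𝓝[≠] D.root k] fun _ => (1 : ℝ) :=
          (((contDiff_re_evalConj (matPoly H) (n := 0)).continuous.tendsto
            (D.root k)).mono_left nhdsWithin_le_nhds).isBigO_one ℝ
        have b3 : (fun x => ‖D.f.eval x‖⁻¹ ^ (3 / 2 : ℝ)) =O[𝓝[≠] D.root k]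
            fun x => ‖x - D.root k‖⁻¹ ^ (3 / 2 : ℝ) := by
          have h1 : (fun x => ‖D.f.eval x‖⁻¹) =O[𝓝[≠] D.root k]
              fun x => ‖x - D.root k‖⁻¹ := by
            have h2 := ((D.tendsto_sub_div_eval k).isBigO_one ℝ).norm_left.mul
              (isBigO_refl (fun x => ‖x - D.root k‖⁻¹) (𝓝[≠] D.root k))
            refine h2.congr' ?_ (by simp)
            filter_upwards [self_mem_nhdsWithin] with x hx
            have := norm_ne_zero_iff.2 (sub_ne_zero.2 hx)
            rw [norm_div]
            field_simp
          exact h1.rpow (by norm_num) (Eventually.of_forall fun x => by positivity)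
        refine ((b1.mul b2).mul b3).congr' ?_ ?_
        · filter_upwards [D.eventually_eval_ne_zero k] with x hx
          have h0 := norm_pos_iff.2 hx
          rw [weight, Real.sqrt_eq_rpow, Real.inv_rpow h0.le]
          have : ‖D.f.eval x‖ ^ (3 / 2 : ℝ) = ‖D.f.eval x‖ ^ (1 / 2 : ℝ) * ‖D.f.eval x‖ := by
            nth_rw 3 [← Real.rpow_one ‖D.f.eval x‖]
            rw [← Real.rpow_add h0]
            norm_num
          rw [this]
          have := (Real.rpow_pos_of_pos h0 (1 / 2)).ne'
          field_simp
        · refine Eventually.of_forall fun x => ?_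
          simp only [one_mul]
          rw [Real.rpow_neg (norm_nonneg _), Real.inv_rpow (norm_nonneg _)]
      have h0 : (fun x => (1 + |Real.log (factor D.f (matPoly A) x)|) * D.weight H x)
          =O[pure (D.root k)] fun x => ‖x - D.root k‖ ^ (-(3 / 2) : ℝ) := by
        rw [isBigO_pure]
        intro
        simp [weight, D.eval_root]
      rw [← pure_sup_nhdsNE]
      exact h0.sup hne
    · have hc : ContinuousAt
          (fun x => (1 + |Real.log (factor D.f (matPoly A) x)|) * D.weight H x) x := by
        refine (continuousAt_const.add
          (contDiffAt_log_factor hp hx (n := 0)).continuousAt.abs).mul ?_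
        exact (contDiff_re_evalConj _ (n := 0)).continuous.continuousAt.div
          D.f.continuous.norm.continuousAt (norm_ne_zero_iff.2 hx)
      exact hc.tendsto.integrableAtFilter ⟨Set.univ, univ_mem, hm.aestronglyMeasurable⟩
        (volume.finiteAt_nhds x)
  refine hloc.integrable_of_isBigO_cocompact (g := fun x : ℂ => (1 + ‖x‖) ^ (-3 : ℝ)) ?_
    (Integrable.integrableAtFilter
      (integrable_one_add_norm (by rw [Complex.finrank_real_complex]; norm_num)) _)
  have h1 : (fun x => 1 + |Real.log (factor D.f (matPoly A) x)|) =O[cocompact ℂ]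
      fun _ => (1 : ℝ) :=
    (isBigO_refl _ _).add (D.isBigO_log_factor_cocompact hA).abs_left
  refine ((h1.mul (D.isBigO_weight_cocompact hg)).congr_right fun x => one_mul _).trans ?_
  refine IsBigO.of_bound 8 ?_
  have : ∀ᶠ x : ℂ in cocompact ℂ, 1 ≤ ‖x‖ :=
    (tendsto_norm_cocompact_atTop (E := ℂ)).eventually_ge_atTop 1
  filter_upwards [this] with x hx
  rw [Real.norm_of_nonneg (by positivity), Real.norm_of_nonneg (by positivity),
    Real.rpow_neg (by positivity)]
  have e : (1 + ‖x‖) ^ (3 : ℝ) = (1 + ‖x‖) ^ 3 := by norm_cast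
  rw [e, inv_pow, ← div_eq_mul_inv, ← one_div, div_le_div_iff₀ (by positivity) (by positivity)]
  have h3 : (1 + ‖x‖) ^ 3 ≤ (2 * ‖x‖) ^ 3 := by gcongr; linarith
  have h4 : ‖x‖ ^ 3 * 1 ≤ ‖x‖ ^ 3 * ‖x‖ := by gcongr
  nlinarith

end HyperellipticData

/-! ### Integration over the two sheets -/

namespace HyperellipticData

open Filter MeasureTheory Asymptotics

variable {g : ℕ} (D : HyperellipticData g)

/-- The point `(x, √(f x))` of `C₀`. -/
noncomputable def upperPoint (x : ℂ) : D.C₀ := ⟨(x, (D.f.eval x) ^ ((2 : ℂ)⁻¹)),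
  Complex.cpow_nat_inv_pow (D.f.eval x) (n := 2) two_ne_zero⟩

/-- The point `(x, -y)` of `C₀`, for `p = (x, y)`. -/
def conjPoint (p : D.C₀) : D.C₀ := ⟨(p.1.1, -p.1.2), by rw [neg_sq]; exact p.2⟩

theorem upperSheet_eq (x : ℂ) : D.upperSheet x = D.ι₀ (D.upperPoint x) := rfl

theorem lowerSheet_eq (x : ℂ) : D.lowerSheet x = D.ι₀ (D.conjPoint (D.upperPoint x)) := rfl

theorem snd_upperPoint_ne_zero {x : ℂ} (hx : D.f.eval x ≠ 0) : (D.upperPoint x).1.2 ≠ 0 := by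
  intro h
  have := (D.upperPoint x).2
  rw [h, zero_pow two_ne_zero] at this
  exact hx this.symm

theorem snd_conjPoint_ne_zero {p : D.C₀} (hp : p.1.2 ≠ 0) : (D.conjPoint p).1.2 ≠ 0 :=
  neg_ne_zero.2 hp

/-- The complement of the branch points in the affine curve `C₀`, as an open subset of the
hyperelliptic curve. It has full measure. -/
def unbranched : Set D.Curve := D.ι₀ '' {p | p.1.2 ≠ 0}

theorem isOpen_unbranched : IsOpen D.unbranched :=
  D.isOpenEmbedding_ι₀.isOpenMap _ (isOpen_ne_fun (by fun_prop) continuous_const)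

theorem ae_eval_ne_zero : ∀ᵐ x : ℂ, D.f.eval x ≠ 0 := by
  have h : ({x : ℂ | D.f.eval x = 0}).Finite := by
    refine (Set.finite_range D.root).subset fun x hx => ?_
    obtain ⟨k, rfl⟩ := D.eval_f_eq_zero_iff.1 hx
    exact ⟨k, rfl⟩
  exact measure_eq_zero_iff_ae_notMem.1 (h.measure_zero _)

theorem upperSheet_mem_unbranched {x : ℂ} (hx : D.f.eval x ≠ 0) :
    D.upperSheet x ∈ D.unbranched := ⟨_, D.snd_upperPoint_ne_zero hx, rfl⟩

theorem lowerSheet_mem_unbranched {x : ℂ} (hx : D.f.eval x ≠ 0) :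
    D.lowerSheet x ∈ D.unbranched :=
  ⟨_, D.snd_conjPoint_ne_zero (D.snd_upperPoint_ne_zero hx), rfl⟩

variable {H : Matrix (Fin g) (Fin g) ℂ}

/-- The area measure in the coordinate `x`. -/
noncomputable def planeArea (H : Matrix (Fin g) (Fin g) ℂ) : Measure ℂ :=
  volume.withDensity fun x => ENNReal.ofReal (D.weight H x)

theorem area_eq : D.area H = (D.planeArea H).map D.upperSheet + (D.planeArea H).map D.lowerSheet :=
  rfl

theorem ae_mem_unbranched : ∀ᵐ P ∂(D.area H), P ∈ D.unbranched := by
  have h : ∀ᵐ x ∂(D.planeArea H), D.f.eval x ≠ 0 :=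
    (withDensity_absolutelyContinuous _ _).ae_le D.ae_eval_ne_zero
  rw [area_eq, ae_add_measure_iff]
  constructor
  · refine (ae_map_iff (p := (· ∈ D.unbranched)) D.measurable_upperSheet.aemeasurable
      D.isOpen_unbranched.measurableSet).2 ?_
    exact h.mono fun x hx => D.upperSheet_mem_unbranched hx
  · refine (ae_map_iff (p := (· ∈ D.unbranched)) D.measurable_lowerSheet.aemeasurable
      D.isOpen_unbranched.measurableSet).2 ?_
    exact h.mono fun x hx => D.lowerSheet_mem_unbranched hx

variable {V : Type} [NormedAddCommGroup V] [NormedSpace ℝ V]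

omit [NormedSpace ℝ V] in
theorem aestronglyMeasurable_area [SecondCountableTopology V] {h : D.Curve → V}
    (hc : ContinuousOn h D.unbranched) : AEStronglyMeasurable h (D.area H) := by
  have := hc.aestronglyMeasurable (μ := D.area H) D.isOpen_unbranched.measurableSet
  rwa [Measure.restrict_eq_self_of_ae_mem D.ae_mem_unbranched] at this

theorem integrable_planeArea_iff [NeZero g] (hH : H.PosDef) {h : ℂ → V} :
    Integrable h (D.planeArea H) ↔ Integrable fun x => D.weight H x • h x := by
  rw [planeArea, integrable_withDensity_iff_integrable_smul'
    (D.measurable_weight.ennreal_ofReal) (by simp)]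
  simp only [ENNReal.toReal_ofReal (D.weight_nonneg hH _)]

theorem integral_planeArea [NeZero g] (hH : H.PosDef) (h : ℂ → V) :
    ∫ x, h x ∂(D.planeArea H) = ∫ x, D.weight H x • h x := by
  rw [planeArea, integral_withDensity_eq_integral_toReal_smul
    (D.measurable_weight.ennreal_ofReal) (by simp)]
  simp only [ENNReal.toReal_ofReal (D.weight_nonneg hH _)]

theorem integrable_area_iff [NeZero g] (hH : H.PosDef) {h : D.Curve → V}
    (hm : AEStronglyMeasurable h (D.area H)) :
    Integrable h (D.area H) ↔ (Integrable fun x => D.weight H x • h (D.upperSheet x)) ∧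
      Integrable fun x => D.weight H x • h (D.lowerSheet x) := by
  rw [area_eq] at hm ⊢
  rw [integrable_add_measure,
    integrable_map_measure (hm.mono_measure (Measure.le_add_right le_rfl))
      D.measurable_upperSheet.aemeasurable,
    integrable_map_measure (hm.mono_measure (Measure.le_add_left le_rfl))
      D.measurable_lowerSheet.aemeasurable,
    D.integrable_planeArea_iff hH, D.integrable_planeArea_iff hH]
  rfl

theorem integral_area [NeZero g] (hH : H.PosDef) {h : D.Curve → V}
    (hi : Integrable h (D.area H)) :
    ∫ P, h P ∂(D.area H) = ∫ x, (D.weight H x • h (D.upperSheet x)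
      + D.weight H x • h (D.lowerSheet x)) := by
  obtain ⟨h1, h2⟩ := (D.integrable_area_iff hH hi.1).1 hi
  rw [integral_add h1 h2, ← D.integral_planeArea hH, ← D.integral_planeArea hH]
  rw [area_eq] at hi ⊢
  obtain ⟨h3, h4⟩ := integrable_add_measure.1 hi
  rw [integral_add_measure h3 h4, integral_map D.measurable_upperSheet.aemeasurable h3.1,
    integral_map D.measurable_lowerSheet.aemeasurable h4.1]

/-! ### Derivatives of test functions -/

/-- The point of `C₀'` glued to a point of `C₀` with `x ≠ 0`. -/
noncomputable def flipPoint (p : D.C₀) (hx : p.1.1 ≠ 0) : D.C₁ :=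
  ⟨(1 / p.1.1, p.1.2 / p.1.1 ^ (g + 1)), D.flip_mem₀ hx p.2⟩

theorem ι₁_flipPoint (p : D.C₀) (hx : p.1.1 ≠ 0) : D.ι₁ (D.flipPoint p hx) = D.ι₀ p :=
  (D.ι₀_eq_ι₁.2 ⟨hx, rfl⟩).symm

theorem snd_flipPoint_ne_zero {p : D.C₀} (hx : p.1.1 ≠ 0) (hy : p.1.2 ≠ 0) :
    (D.flipPoint p hx).1.2 ≠ 0 := div_ne_zero hy (pow_ne_zero _ hx)

/-- In the coordinates `x` and `z = 1 / x`, the two affine curves are related by inversion. -/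
theorem comp_xChart_symm_eventuallyEq {W : Type*} (η : D.Curve → W) {p : D.C₀} (hx : p.1.1 ≠ 0)
    (hy : p.1.2 ≠ 0) :
    (η ∘ D.ι₀) ∘ (AffineCurve.xChart p hy).symm =ᶠ[𝓝 p.1.1]
      ((η ∘ D.ι₁) ∘ (AffineCurve.xChart (D.flipPoint p hx)
        (D.snd_flipPoint_ne_zero hx hy)).symm) ∘ fun x => x⁻¹ := by
  set q := D.flipPoint p hx with hq
  have hw := D.snd_flipPoint_ne_zero hx hy
  set e := AffineCurve.xChart p hy
  set e' := AffineCurve.xChart q hw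
  have h1 : ContinuousAt (fun t => D.ι₀ (e.symm t)) p.1.1 :=
    D.continuous_ι₀.continuousAt.comp
      (e.continuousAt_symm (AffineCurve.mem_xChart_target p hy))
  have h2 : D.ι₁ '' e'.source ∈ 𝓝 (D.ι₀ (e.symm p.1.1)) := by
    refine (D.isOpenEmbedding_ι₁.isOpenMap _ e'.open_source).mem_nhds
      ⟨q, AffineCurve.mem_xChart_source q hw, ?_⟩
    rw [AffineCurve.xChart_symm_self p hy, hq, ι₁_flipPoint]
  filter_upwards [h1.eventually h2] with t ht
  obtain ⟨q', hq', hqt⟩ := ht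
  have h3 := (D.ι₀_eq_ι₁.1 hqt.symm).2
  have h4 : q'.1.1 = t⁻¹ := by rw [h3, ← one_div]; rfl
  have h5 : e'.symm t⁻¹ = q' := by rw [← h4]; exact e'.left_inv hq'
  simp only [Function.comp_apply, h5, hqt]

theorem norm_flipPoint_le_one {p : D.C₀} (hx : 1 ≤ ‖p.1.1‖) (hx0 : p.1.1 ≠ 0) :
    ‖(D.flipPoint p hx0).1.1‖ ≤ 1 := by
  change ‖1 / p.1.1‖ ≤ 1
  rw [norm_div, norm_one]
  exact (div_le_one (norm_pos_iff.2 hx0)).2 hx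

variable {η : D.Curve → V} (hη : ContMDiff 𝓘(ℝ, ℂ) 𝓘(ℝ, V) ∞ η)

include hη

theorem norm_fderiv_flip {p : D.C₀} (hx : p.1.1 ≠ 0) (hy : p.1.2 ≠ 0) :
    ‖fderiv ℝ ((η ∘ D.ι₀) ∘ (AffineCurve.xChart p hy).symm) p.1.1‖ = ‖p.1.1‖⁻¹ ^ 2 *
      ‖fderiv ℝ ((η ∘ D.ι₁) ∘ (AffineCurve.xChart (D.flipPoint p hx)
        (D.snd_flipPoint_ne_zero hx hy)).symm) (D.flipPoint p hx).1.1‖ := by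
  have h1 := (D.smoothInCharts_ι₁ hη).contDiffAt (D.flipPoint p hx)
    (D.snd_flipPoint_ne_zero hx hy)
  have e : (D.flipPoint p hx).1.1 = p.1.1⁻¹ := one_div _
  rw [e] at h1 ⊢
  rw [(D.comp_xChart_symm_eventuallyEq η hx hy).fderiv_eq,
    norm_fderiv_comp_holomorphic (h1.differentiableAt (by norm_num)) (differentiableAt_inv hx)]
  simp

theorem laplacian_flip {p : D.C₀} (hx : p.1.1 ≠ 0) (hy : p.1.2 ≠ 0) :
    Δ ((η ∘ D.ι₀) ∘ (AffineCurve.xChart p hy).symm) p.1.1 = ‖p.1.1‖⁻¹ ^ 4 •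
      Δ ((η ∘ D.ι₁) ∘ (AffineCurve.xChart (D.flipPoint p hx)
        (D.snd_flipPoint_ne_zero hx hy)).symm) (D.flipPoint p hx).1.1 := by
  have h1 := (D.smoothInCharts_ι₁ hη).contDiffAt (D.flipPoint p hx)
    (D.snd_flipPoint_ne_zero hx hy)
  have e : (D.flipPoint p hx).1.1 = p.1.1⁻¹ := one_div _
  rw [e] at h1 ⊢
  rw [(InnerProductSpace.laplacian_congr_nhds
    (D.comp_xChart_symm_eventuallyEq η hx hy)).eq_of_nhds,
    laplacian_comp_holomorphic h1 (analyticAt_inv hx)]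
  congr 1
  simp only [deriv_inv, norm_neg, norm_inv, norm_pow]
  ring

theorem exists_bound_norm : ∃ C : ℝ, ∀ P, ‖η P‖ ≤ C := by
  have hc : Continuous η := hη.continuous
  obtain ⟨C, hC⟩ := (AffineCurve.isCompact_norm_fst_le (F := D.f) 1).exists_bound_of_continuousOn
    (hc.comp D.continuous_ι₀).continuousOn
  obtain ⟨C', hC'⟩ := (AffineCurve.isCompact_norm_fst_le (F := D.gPoly)
    1).exists_bound_of_continuousOn (hc.comp D.continuous_ι₁).continuousOn
  refine ⟨max C C', fun P => ?_⟩
  rcases D.exists_rep P with ⟨p, rfl⟩ | ⟨q, rfl, -, hz, -⟩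
  · by_cases hx : ‖p.1.1‖ ≤ 1
    · exact le_max_of_le_left (hC p hx)
    · have hx0 : p.1.1 ≠ 0 := by
        intro h
        simp [h] at hx
      refine le_max_of_le_right ?_
      rw [← D.ι₁_flipPoint p hx0]
      exact hC' (D.flipPoint p hx0) (D.norm_flipPoint_le_one (not_le.1 hx).le hx0)
  · exact le_max_of_le_right (hC' q (by simp [hz]))

/-- `Δ_H η` is bounded, for a smooth function `η`. -/
theorem exists_bound_laplace (hg : 1 ≤ g) (hH : H.PosDef) :
    ∃ C : ℝ, ∀ P ∈ D.unbranched, ‖D.laplace H η P‖ ≤ C := by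
  have : NeZero g := ⟨by omega⟩
  have hp := evalConj_matPoly_pos hH
  have hpr := evalConj_matPolyRev_pos hH
  obtain ⟨C, hC0, hC⟩ := (D.smoothInCharts_ι₀ hη).exists_bound 1
  obtain ⟨C', hC0', hC'⟩ := (D.smoothInCharts_ι₁ hη).exists_bound 1
  obtain ⟨M, hM⟩ := (isCompact_closedBall (0 : ℂ) 1).exists_bound_of_continuousOn
    (f := fun x => (evalConj (matPoly H) x).re⁻¹)
    ((contDiff_re_evalConj _ (n := 0)).continuous.inv₀
      fun x => (re_evalConj_pos hp x).ne').continuousOn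
  obtain ⟨M', hM'⟩ := (isCompact_closedBall (0 : ℂ) 1).exists_bound_of_continuousOn
    (f := fun x => (evalConj (matPolyRev H) x).re⁻¹)
    ((contDiff_re_evalConj _ (n := 0)).continuous.inv₀
      fun x => (re_evalConj_pos hpr x).ne').continuousOn
  have alg : ∀ a w s d : ℝ, a ≠ 0 → s ≠ 0 →
      (w * a ^ (g + 1)) ^ 2 / (a ^ (2 * (g - 1)) * s) * (a⁻¹ ^ 4 * d) = s⁻¹ * (w ^ 2 * d) := by
    intro a w s d ha hs
    obtain ⟨m, rfl⟩ : ∃ m, g = m + 1 := ⟨g - 1, by omega⟩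
    simp only [Nat.add_sub_cancel]
    rw [inv_pow]
    field_simp
    ring
  refine ⟨max (M * C) (M' * C'), ?_⟩
  rintro _ ⟨p, hy, rfl⟩
  have hy : p.1.2 ≠ 0 := hy
  have hs := re_evalConj_pos hp p.1.1
  rw [D.laplace_ι₀ H η p hy, norm_smul, inv_div, Real.norm_of_nonneg (by positivity)]
  by_cases hx : ‖p.1.1‖ ≤ 1
  · refine le_max_of_le_left ?_
    have h1 := hM p.1.1 (by simpa using hx)
    rw [Real.norm_of_nonneg (by positivity)] at h1
    calc _ = (evalConj (matPoly H) p.1.1).re⁻¹ * (‖p.1.2‖ ^ 2 *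
          ‖Δ ((η ∘ D.ι₀) ∘ (AffineCurve.xChart p hy).symm) p.1.1‖) := by ring
      _ ≤ M * C := mul_le_mul h1 (hC p hx hy).2 (by positivity) (h1.trans' (by positivity))
  · have hx1 := (not_le.1 hx).le
    have hx0 : p.1.1 ≠ 0 := by
      intro h
      simp [h] at hx
    have hw := D.snd_flipPoint_ne_zero hx0 hy
    have hz := D.norm_flipPoint_le_one hx1 hx0
    refine le_max_of_le_right ?_
    rw [D.laplacian_flip hη hx0 hy, norm_smul, Real.norm_of_nonneg (by positivity)]
    have h1 := hM' (D.flipPoint p hx0).1.1 (by simpa using hz)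
    have h2 := hC' (D.flipPoint p hx0) hz hw
    have hsr := re_evalConj_pos hpr (D.flipPoint p hx0).1.1
    rw [Real.norm_of_nonneg (inv_nonneg.2 hsr.le)] at h1
    have hn0 : ‖p.1.1‖ ≠ 0 := norm_ne_zero_iff.2 hx0
    have e1 : (D.flipPoint p hx0).1.1 = p.1.1⁻¹ := one_div _
    have e2 : ‖p.1.2‖ = ‖(D.flipPoint p hx0).1.2‖ * ‖p.1.1‖ ^ (g + 1) := by
      change _ = ‖p.1.2 / p.1.1 ^ (g + 1)‖ * _
      rw [norm_div, norm_pow]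
      field_simp
    have e3 : (evalConj (matPolyRev H) (D.flipPoint p hx0).1.1).re
        = ‖p.1.1‖⁻¹ ^ (2 * (g - 1)) * (evalConj (matPoly H) p.1.1).re := by
      rw [e1, re_evalConj_matPolyRev H (inv_ne_zero hx0), inv_inv, norm_inv]
    have e4 : (evalConj (matPoly H) p.1.1).re = ‖p.1.1‖ ^ (2 * (g - 1)) *
        (evalConj (matPolyRev H) (D.flipPoint p hx0).1.1).re := by
      rw [e3, inv_pow]
      field_simp
    have hM0 : 0 ≤ M' := h1.trans' (inv_nonneg.2 hsr.le)
    refine le_trans (le_of_eq ?_) (mul_le_mul h1 h2.2 (by positivity) hM0)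
    rw [e2, e4]
    exact alg _ _ _ _ hn0 hsr.ne'

/-- `D.laplace` uses a different chart at each point, but the coordinate `x` is common to all points
with `y ≠ 0`. -/
theorem continuousOn_laplace [NeZero g] (hH : H.PosDef) :
    ContinuousOn (D.laplace H η) D.unbranched := by
  rintro _ ⟨p, hy, rfl⟩
  have hy : p.1.2 ≠ 0 := hy
  refine ContinuousAt.continuousWithinAt ?_
  rw [← D.isOpenEmbedding_ι₀.continuousAt_iff]
  have h1 : (fun q : D.C₀ => ((evalConj (matPoly H) q.1.1).re / ‖q.1.2‖ ^ 2)⁻¹ •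
      Δ ((η ∘ D.ι₀) ∘ (AffineCurve.xChart p hy).symm) q.1.1) =ᶠ[𝓝 p] D.laplace H η ∘ D.ι₀ := by
    filter_upwards [AffineCurve.eventually_laplacian_xChart_eq (η ∘ D.ι₀) p hy,
      (isOpen_ne_fun (f := fun q : D.C₀ => q.1.2) (by fun_prop) continuous_const).mem_nhds hy]
      with q hq hqy
    rw [Function.comp_apply, D.laplace_ι₀ H η q hqy, hq hqy]
  refine ContinuousAt.congr ?_ h1
  have h2 : ContinuousAt (fun q : D.C₀ => q.1.1) p := by fun_prop
  have h3 : ContinuousAt (fun q : D.C₀ => (evalConj (matPoly H) q.1.1).re) p :=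
    ((contDiff_re_evalConj (matPoly H) (n := 0)).continuous.comp (by fun_prop)).continuousAt
  have h4 : ContinuousAt (fun q : D.C₀ => ‖q.1.2‖ ^ 2) p := by fun_prop
  have h5 : ‖p.1.2‖ ^ 2 ≠ 0 := pow_ne_zero 2 (norm_ne_zero_iff.2 hy)
  refine ((h3.div h4 h5).inv₀
    (div_ne_zero (re_evalConj_pos (evalConj_matPoly_pos hH) _).ne' h5)).smul ?_
  exact ContinuousAt.comp (g := Δ ((η ∘ D.ι₀) ∘ (AffineCurve.xChart p hy).symm))
    (continuousAt_laplacian ((D.smoothInCharts_ι₀ hη).contDiffAt p hy)) h2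

end HyperellipticData

/-! ### Green's identity for the pair `(log φ, η)` -/

section Green

/-- The component of the vector field `Ψ ∇N - N ∇Ψ` in the direction `v`. -/
noncomputable def greenField (Ψ : ℂ → ℝ) (N : ℂ → ℂ) (v x : ℂ) : ℂ :=
  Ψ x • fderiv ℝ N x v - fderiv ℝ Ψ x v • N x

variable {Ψ : ℂ → ℝ} {N : ℂ → ℂ} {x : ℂ}

theorem contDiffAt_greenField (hΨ : ContDiffAt ℝ 2 Ψ x) (hN : ContDiffAt ℝ 2 N x) (v : ℂ) :
    ContDiffAt ℝ 1 (greenField Ψ N v) x := by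
  have h1 := (hN.fderiv_right (m := 1) (by norm_num)).clm_apply (contDiffAt_const (c := v))
  have h2 := (hΨ.fderiv_right (m := 1) (by norm_num)).clm_apply (contDiffAt_const (c := v))
  exact ((hΨ.of_le (by norm_num)).smul h1).sub (h2.smul (hN.of_le (by norm_num)))

theorem divergence_greenField (hΨ : ContDiffAt ℝ 2 Ψ x) (hN : ContDiffAt ℝ 2 N x) :
    fderiv ℝ (greenField Ψ N 1) x 1 + fderiv ℝ (greenField Ψ N Complex.I) x Complex.I
      = Ψ x • Δ N x - Δ Ψ x • N x := by
  have h : ∀ v, fderiv ℝ (greenField Ψ N v) x v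
      = Ψ x • fderiv ℝ (fun y => fderiv ℝ N y v) x v
        - fderiv ℝ (fun y => fderiv ℝ Ψ y v) x v • N x := by
    intro v
    have h1 : DifferentiableAt ℝ (fun y => fderiv ℝ N y v) x :=
      ((hN.fderiv_right (m := 1) (by norm_num)).clm_apply
        (contDiffAt_const (c := v))).differentiableAt (by norm_num)
    have h2 : DifferentiableAt ℝ (fun y => fderiv ℝ Ψ y v) x :=
      ((hΨ.fderiv_right (m := 1) (by norm_num)).clm_apply
        (contDiffAt_const (c := v))).differentiableAt (by norm_num)
    have h3 := (hΨ.differentiableAt (by norm_num)).hasFDerivAt.smul h1.hasFDerivAt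
    have h4 := h2.hasFDerivAt.smul (hN.differentiableAt (by norm_num)).hasFDerivAt
    have h5 : greenField Ψ N v = (Ψ • fun y => fderiv ℝ N y v)
        - ((fun y => fderiv ℝ Ψ y v) • N) := rfl
    rw [h5, (h3.sub h4).fderiv]
    simp
    ring
  rw [h, h, laplacian_eq_sum_fderiv hN, laplacian_eq_sum_fderiv hΨ, smul_add, add_smul]
  abel

end Green

namespace HyperellipticData

open Filter MeasureTheory Asymptotics

variable {g : ℕ} (D : HyperellipticData g)

/-! ### The trace of a test function -/

/-- The trace `x ↦ η(x, y) + η(x, -y)` of a function under the double cover `x : C₀ → ℂ`. -/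
noncomputable def sheetSum (η : D.Curve → ℂ) (x : ℂ) : ℂ := η (D.upperSheet x) + η (D.lowerSheet x)

/-- The trace in terms of the coordinates `x` at a point `(x₀, y₀)` with `y₀ ≠ 0` and at
`(x₀, -y₀)`. The principal square root may jump from one of these branches to the other, but the sum
of the two does not change. -/
theorem sheetSum_eq (η : D.Curve → ℂ) {p : D.C₀} (hp : p.1.2 ≠ 0) :
    D.sheetSum η = (η ∘ D.ι₀) ∘ (AffineCurve.xChart p hp).symm
      + (η ∘ D.ι₀) ∘ (AffineCurve.xChart (D.conjPoint p) (D.snd_conjPoint_ne_zero hp)).symm := by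
  funext x
  set s := (AffineCurve.xChart p hp).symm x with hs
  set s' := (AffineCurve.xChart (D.conjPoint p) (D.snd_conjPoint_ne_zero hp)).symm x with hs'
  have h1 : s.1.1 = x := rfl
  have h1' : s'.1.1 = x := rfl
  have h2 : s'.1.2 = -s.1.2 := by
    change -p.1.2 * (D.f.eval x / (-p.1.2) ^ 2) ^ ((2 : ℂ)⁻¹)
      = -(p.1.2 * (D.f.eval x / p.1.2 ^ 2) ^ ((2 : ℂ)⁻¹))
    rw [neg_sq]
    ring
  have h3 : (D.upperPoint x).1.2 ^ 2 = s.1.2 ^ 2 := by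
    rw [(D.upperPoint x).2, s.2, h1]
    rfl
  change η (D.ι₀ (D.upperPoint x)) + η (D.ι₀ (D.conjPoint (D.upperPoint x)))
    = η (D.ι₀ s) + η (D.ι₀ s')
  rcases sq_eq_sq_iff_eq_or_eq_neg.1 h3 with h | h
  · have e1 : D.upperPoint x = s := Subtype.ext (Prod.ext h1.symm h)
    have e2 : D.conjPoint (D.upperPoint x) = s' :=
      Subtype.ext (Prod.ext h1'.symm (by rw [h2, ← h]; rfl))
    rw [e1] at e2 ⊢
    rw [e2]
  · have e1 : D.upperPoint x = s' := Subtype.ext (Prod.ext h1'.symm (by rw [h2, ← h]))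
    have e2 : D.conjPoint (D.upperPoint x) = s :=
      Subtype.ext (Prod.ext h1.symm (by
        change -(D.upperPoint x).1.2 = _
        rw [h, neg_neg]))
    rw [e2, e1, add_comm]

/-- The two sheets meet at the branch points, whence the factor `2`. -/
theorem sheetSum_root (η : D.Curve → ℂ) (k : Fin (2 * g + 2)) :
    D.sheetSum η (D.root k) = 2 * η (D.weierstrassPoint k) := by
  have h1 : D.upperPoint (D.root k) = ⟨(D.root k, 0), by simp [D.eval_root]⟩ :=
    Subtype.ext (Prod.ext rfl (by simp [upperPoint, D.eval_root]))
  have h2 : D.conjPoint (D.upperPoint (D.root k)) = D.upperPoint (D.root k) := by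
    rw [h1]
    exact Subtype.ext (Prod.ext rfl (by simp [conjPoint]))
  rw [sheetSum, upperSheet_eq, lowerSheet_eq, h2, h1]
  exact (two_mul (η (D.weierstrassPoint k))).symm

theorem norm_snd_upperPoint (x : ℂ) : ‖(D.upperPoint x).1.2‖ = √‖D.f.eval x‖ := by
  rw [← show (D.upperPoint x).1.2 ^ 2 = D.f.eval x from (D.upperPoint x).2, norm_pow,
    Real.sqrt_sq (norm_nonneg _)]

theorem tendsto_sheetSum {η : D.Curve → ℂ} (hη : Continuous η) (k : Fin (2 * g + 2)) :
    Tendsto (D.sheetSum η) (𝓝 (D.root k)) (𝓝 (D.sheetSum η (D.root k))) := by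
  have hsq : Tendsto (fun x => (D.upperPoint x).1.2) (𝓝 (D.root k))
      (𝓝 (D.upperPoint (D.root k)).1.2) := by
    have h0 : (D.upperPoint (D.root k)).1.2 = 0 := by simp [upperPoint, D.eval_root]
    rw [h0, tendsto_zero_iff_norm_tendsto_zero]
    simp only [D.norm_snd_upperPoint]
    have h2 : Continuous fun x => √‖D.f.eval x‖ :=
      Real.continuous_sqrt.comp D.f.continuous.norm
    simpa [D.eval_root] using h2.tendsto (D.root k)
  have hup : Tendsto D.upperPoint (𝓝 (D.root k)) (𝓝 (D.upperPoint (D.root k))) :=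
    tendsto_subtype_rng.2 (tendsto_id.prodMk_nhds hsq)
  have hlow : Tendsto (fun x => D.conjPoint (D.upperPoint x)) (𝓝 (D.root k))
      (𝓝 (D.conjPoint (D.upperPoint (D.root k)))) :=
    tendsto_subtype_rng.2 (tendsto_id.prodMk_nhds hsq.neg)
  have hc : Continuous (η ∘ D.ι₀) := hη.comp D.continuous_ι₀
  exact ((hc.tendsto _).comp hup).add ((hc.tendsto _).comp hlow)

section Trace

variable {η : D.Curve → ℂ} (hη : ContMDiff 𝓘(ℝ, ℂ) 𝓘(ℝ, ℂ) ∞ η)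

include hη

theorem contDiffAt_sheetSum {x : ℂ} (hx : D.f.eval x ≠ 0) :
    ContDiffAt ℝ 2 (D.sheetSum η) x := by
  rw [D.sheetSum_eq η (D.snd_upperPoint_ne_zero hx)]
  exact ((D.smoothInCharts_ι₀ hη).contDiffAt (D.upperPoint x) _).add
    ((D.smoothInCharts_ι₀ hη).contDiffAt (D.conjPoint (D.upperPoint x)) _)

theorem norm_fderiv_sheetSum_le {x : ℂ} (hx : D.f.eval x ≠ 0) :
    ‖fderiv ℝ (D.sheetSum η) x‖ ≤
      ‖fderiv ℝ ((η ∘ D.ι₀) ∘ (AffineCurve.xChart (D.upperPoint x)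
        (D.snd_upperPoint_ne_zero hx)).symm) (D.upperPoint x).1.1‖ +
      ‖fderiv ℝ ((η ∘ D.ι₀) ∘ (AffineCurve.xChart (D.conjPoint (D.upperPoint x))
        (D.snd_conjPoint_ne_zero (D.snd_upperPoint_ne_zero hx))).symm)
        (D.conjPoint (D.upperPoint x)).1.1‖ := by
  rw [D.sheetSum_eq η (D.snd_upperPoint_ne_zero hx)]
  have h1 := (D.smoothInCharts_ι₀ hη).contDiffAt (D.upperPoint x) (D.snd_upperPoint_ne_zero hx)
  have h2 := (D.smoothInCharts_ι₀ hη).contDiffAt (D.conjPoint (D.upperPoint x))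
    (D.snd_conjPoint_ne_zero (D.snd_upperPoint_ne_zero hx))
  have h3 := (h1.differentiableAt (by norm_num)).hasFDerivAt.add
    (h2.differentiableAt (by norm_num)).hasFDerivAt
  have h4 : (D.upperPoint x).1.1 = x := rfl
  have h5 := h3.fderiv
  rw [h4] at h5
  rw [h5]
  exact norm_add_le _ _

/-- The gradient of the trace of a smooth function blows up at most like `1 / √|f|` at the branch
points. -/
theorem exists_sqrt_mul_norm_fderiv_sheetSum_le (R : ℝ) : ∃ C : ℝ, ∀ x, ‖x‖ ≤ R →
    D.f.eval x ≠ 0 → √‖D.f.eval x‖ * ‖fderiv ℝ (D.sheetSum η) x‖ ≤ C := by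
  obtain ⟨C, -, hC⟩ := (D.smoothInCharts_ι₀ hη).exists_bound R
  refine ⟨C + C, fun x hxR hx => ?_⟩
  have h1 := (hC (D.upperPoint x) hxR (D.snd_upperPoint_ne_zero hx)).1
  have h2 := (hC (D.conjPoint (D.upperPoint x)) hxR
    (D.snd_conjPoint_ne_zero (D.snd_upperPoint_ne_zero hx))).1
  have e2 : ‖(D.conjPoint (D.upperPoint x)).1.2‖ = √‖D.f.eval x‖ := by
    rw [← D.norm_snd_upperPoint]
    exact norm_neg _
  rw [D.norm_snd_upperPoint] at h1
  rw [e2] at h2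
  refine (mul_le_mul_of_nonneg_left (D.norm_fderiv_sheetSum_le hη hx)
    (Real.sqrt_nonneg _)).trans ?_
  rw [mul_add]
  exact add_le_add h1 h2

/-- The trace of a smooth function has bounded gradient in the coordinate `1 / x` near infinity. -/
theorem isBigO_fderiv_sheetSum_cocompact :
    (fun x => fderiv ℝ (D.sheetSum η) x) =O[cocompact ℂ] fun x => ‖x‖⁻¹ ^ 2 := by
  obtain ⟨C, hC0, hC⟩ := (D.smoothInCharts_ι₁ hη).exists_bound 1
  have hg0 : 0 < ‖D.gPoly.eval 0‖ := norm_pos_iff.2 D.gPoly_eval_zero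
  have h1 : ∀ᶠ x : ℂ in cocompact ℂ, ‖D.gPoly.eval 0‖ / 2 < ‖D.gPoly.eval x⁻¹‖ :=
    tendsto_inv_cocompact.eventually
      ((D.gPoly.continuous.norm.tendsto 0).eventually_const_lt (half_lt_self hg0))
  have h2 : ∀ᶠ x : ℂ in cocompact ℂ, 1 ≤ ‖x‖ :=
    (tendsto_norm_cocompact_atTop (E := ℂ)).eventually_ge_atTop 1
  set B := C / √(‖D.gPoly.eval 0‖ / 2) with hB
  refine IsBigO.of_bound (B + B) ?_
  filter_upwards [h1, h2] with x hx hx1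
  have hx0 : x ≠ 0 := norm_pos_iff.1 (by linarith)
  have hfx : D.f.eval x ≠ 0 := by
    intro h
    have := D.eval_gPoly hx0
    rw [h, zero_div, one_div] at this
    rw [this, norm_zero] at hx
    linarith
  have key : ∀ (p : D.C₀) (hy : p.1.2 ≠ 0), p.1.1 = x →
      ‖fderiv ℝ ((η ∘ D.ι₀) ∘ (AffineCurve.xChart p hy).symm) p.1.1‖ ≤ ‖x‖⁻¹ ^ 2 * B := by
    rintro p hy rfl
    rw [D.norm_fderiv_flip hη hx0 hy]
    refine mul_le_mul_of_nonneg_left ?_ (by positivity)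
    have h3 := (hC (D.flipPoint p hx0) (D.norm_flipPoint_le_one hx1 hx0)
      (D.snd_flipPoint_ne_zero hx0 hy)).1
    rw [hB, le_div_iff₀ (Real.sqrt_pos.2 (by positivity)), mul_comm]
    refine le_trans (mul_le_mul_of_nonneg_right ?_ (norm_nonneg _)) h3
    refine Real.sqrt_le_iff.2 ⟨norm_nonneg _, ?_⟩
    have h4 : (D.flipPoint p hx0).1.2 ^ 2 = D.gPoly.eval p.1.1⁻¹ := by
      rw [(D.flipPoint p hx0).2, ← one_div]
      rfl
    rw [← norm_pow, h4]
    exact hx.le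
  have h5 := D.norm_fderiv_sheetSum_le hη hfx
  have h6 := key (D.upperPoint x) (D.snd_upperPoint_ne_zero hfx) rfl
  have h7 := key (D.conjPoint (D.upperPoint x))
    (D.snd_conjPoint_ne_zero (D.snd_upperPoint_ne_zero hfx)) rfl
  rw [Real.norm_of_nonneg (by positivity : 0 ≤ ‖x‖⁻¹ ^ 2)]
  linarith

variable {H : Matrix (Fin g) (Fin g) ℂ}

/-- `Δ_H η dA_H`, summed over the two sheets, is the Laplacian of the trace of `η`. -/
theorem weight_smul_laplace_add [NeZero g] (hH : H.PosDef) {x : ℂ} (hx : D.f.eval x ≠ 0) :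
    D.weight H x • D.laplace H η (D.upperSheet x) + D.weight H x • D.laplace H η (D.lowerSheet x)
      = Δ (D.sheetSum η) x := by
  have hy := D.snd_upperPoint_ne_zero hx
  have h1 := (D.smoothInCharts_ι₀ hη).contDiffAt (D.upperPoint x) hy
  have h2 := (D.smoothInCharts_ι₀ hη).contDiffAt (D.conjPoint (D.upperPoint x))
    (D.snd_conjPoint_ne_zero hy)
  have h3 := h1.laplacian_add h2
  have hs := (re_evalConj_pos (evalConj_matPoly_pos hH) x).ne'
  have hn := norm_ne_zero_iff.2 hx
  have hsq := Real.sq_sqrt (norm_nonneg (D.f.eval x))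
  have e1 : ‖(D.upperPoint x).1.2‖ ^ 2 = ‖D.f.eval x‖ := by rw [D.norm_snd_upperPoint, hsq]
  have e2 : ‖(D.conjPoint (D.upperPoint x)).1.2‖ ^ 2 = ‖D.f.eval x‖ := by
    rw [← e1]
    exact congrArg (· ^ 2) (norm_neg _)
  have e3 : (D.upperPoint x).1.1 = x := rfl
  have e4 : (D.conjPoint (D.upperPoint x)).1.1 = x := rfl
  rw [e3] at h3
  rw [D.sheetSum_eq η hy, h3, upperSheet_eq, lowerSheet_eq, D.laplace_ι₀ H η _ hy,
    D.laplace_ι₀ H η _ (D.snd_conjPoint_ne_zero hy), e1, e2, e3, e4, weight, smul_smul, smul_smul,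
    mul_inv_cancel₀ (div_ne_zero hs hn), one_smul, one_smul]

end Trace

/-! ### The distributional equation -/

section Distribution

variable {H : Matrix (Fin g) (Fin g) ℂ} {A : Matrix (Fin (g + 2)) (Fin (g + 2)) ℂ}

theorem phi_upperSheet (x : ℂ) : D.phi A (D.upperSheet x) = factor D.f (matPoly A) x :=
  D.phi_ι₀ _

theorem phi_lowerSheet (x : ℂ) : D.phi A (D.lowerSheet x) = factor D.f (matPoly A) x :=
  D.phi_ι₀ _

theorem unbranched_subset : D.unbranched ⊆ (Set.range D.weierstrassPoint)ᶜ := by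
  rintro _ ⟨p, hp, rfl⟩ h
  exact hp (D.mem_range_weierstrassPoint.1 h)

theorem integrable_log_phi (hg : 1 ≤ g) (hH : H.PosDef) (hA : A.PosDef) :
    Integrable (fun P => 1 + |Real.log (D.phi A P)|) (D.area H) ∧
      Integrable (fun P => Real.log (D.phi A P)) (D.area H) := by
  have : NeZero g := ⟨by omega⟩
  have hc : ContinuousOn (fun P => Real.log (D.phi A P)) D.unbranched :=
    (D.contMDiffOn_log_phi hA).continuousOn.mono D.unbranched_subset
  have h1 : Integrable (fun P => 1 + |Real.log (D.phi A P)|) (D.area H) := by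
    have hm : AEStronglyMeasurable (fun P => 1 + |Real.log (D.phi A P)|) (D.area H) :=
      D.aestronglyMeasurable_area (continuousOn_const.add hc.abs)
    refine (D.integrable_area_iff hH hm).2 ?_
    have := D.integrable_log_mul_weight hA hg (H := H)
    simp only [phi_upperSheet, phi_lowerSheet, smul_eq_mul, mul_comm (D.weight H _)]
    exact ⟨this, this⟩
  refine ⟨h1, h1.mono' (D.aestronglyMeasurable_area hc) (Eventually.of_forall fun P => ?_)⟩
  rw [Real.norm_eq_abs]
  linarith [abs_nonneg (Real.log (D.phi A P))]

theorem exp_log_phi_le (hA : A.PosDef) : ∃ C : ℝ, ∀ P, Real.exp (Real.log (D.phi A P)) ≤ C := by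
  obtain ⟨C, hC⟩ := D.exists_bound_norm (D.contMDiff_phi hA)
  refine ⟨max C 1, fun P => ?_⟩
  rcases (D.phi_nonneg hA P).eq_or_lt with h | h
  · rw [← h]
    simp
  · rw [Real.exp_log h]
    exact le_max_of_le_left ((le_abs_self _).trans (hC P))

/-- `log φ` solves the mean field equation in the sense of distributions. -/
theorem solvesMeanField_log_phi (hg : 1 ≤ g) (hH : H.PosDef) (hA : A.PosDef)
    (hsol : SolvesPDE (matPoly H) (matPoly A)) :
    D.SolvesMeanField H (fun P => Real.log (D.phi A P)) := by
  have : NeZero g := ⟨by omega⟩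
  have hp := evalConj_matPoly_pos hA
  obtain ⟨hi1, hi⟩ := D.integrable_log_phi hg hH hA
  have hc : ContinuousOn (fun P => Real.log (D.phi A P)) D.unbranched :=
    (D.contMDiffOn_log_phi hA).continuousOn.mono D.unbranched_subset
  refine ⟨hi, fun η hη => ?_⟩
  have hcl := D.continuousOn_laplace hη hH
  obtain ⟨C, hC⟩ := D.exists_bound_laplace hη hg hH
  obtain ⟨C', hC'⟩ := D.exists_bound_norm hη
  obtain ⟨C'', hC''⟩ := D.exp_log_phi_le hA
  have hint1 : Integrable (fun P => Real.log (D.phi A P) • D.laplace H η P) (D.area H) := by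
    refine (hi.norm.mul_const C).mono' (D.aestronglyMeasurable_area (hc.smul hcl)) ?_
    filter_upwards [D.ae_mem_unbranched] with P hP
    rw [norm_smul]
    exact mul_le_mul_of_nonneg_left (hC P hP) (norm_nonneg _)
  have hint2 : Integrable (fun P => Real.exp (Real.log (D.phi A P)) • η P) (D.area H) := by
    refine (hi1.mul_const (C'' * C')).mono' (D.aestronglyMeasurable_area
      ((Real.continuous_exp.comp_continuousOn hc).smul hη.continuous.continuousOn))
      (Eventually.of_forall fun P => ?_)
    have h0 : 0 ≤ C'' := (Real.exp_pos _).le.trans (hC'' P)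
    have h0' : 0 ≤ C' := (norm_nonneg _).trans (hC' P)
    rw [norm_smul, Real.norm_of_nonneg (Real.exp_pos _).le]
    calc _ ≤ C'' * C' := mul_le_mul (hC'' P) (hC' P) (norm_nonneg _) h0
      _ ≤ (1 + |Real.log (D.phi A P)|) * (C'' * C') := by
        refine le_mul_of_one_le_left (by positivity) ?_
        linarith [abs_nonneg (Real.log (D.phi A P))]
  refine ⟨hint1, hint2, ?_⟩
  set Ψ : ℂ → ℝ := fun x => Real.log (factor D.f (matPoly A) x) with hΨ
  set N := D.sheetSum η with hN
  have hΨd : ∀ {x}, D.f.eval x ≠ 0 → ContDiffAt ℝ 2 Ψ x := fun hx =>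
    contDiffAt_log_factor hp hx (n := 2)
  have hNd : ∀ {x}, D.f.eval x ≠ 0 → ContDiffAt ℝ 2 N x := fun hx => D.contDiffAt_sheetSum hη hx
  -- the integrand in the coordinate `x` is the divergence of `Ψ ∇N - N ∇Ψ`
  have hdiv : ∀ {x}, D.f.eval x ≠ 0 →
      (D.weight H x • (Real.log (D.phi A (D.upperSheet x)) • D.laplace H η (D.upperSheet x))
        + D.weight H x • (Real.log (D.phi A (D.lowerSheet x)) • D.laplace H η (D.lowerSheet x)))
      + (D.weight H x • (Real.exp (Real.log (D.phi A (D.upperSheet x))) • η (D.upperSheet x))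
        + D.weight H x • (Real.exp (Real.log (D.phi A (D.lowerSheet x))) • η (D.lowerSheet x)))
      = fderiv ℝ (greenField Ψ N 1) x 1 + fderiv ℝ (greenField Ψ N Complex.I) x Complex.I := by
    intro x hx
    have hpos : 0 < factor D.f (matPoly A) x := lt_of_le_of_ne (factor_nonneg hp x)
      fun h => hx ((factor_eq_zero_iff hp).1 h.symm)
    have hw : D.weight H x * factor D.f (matPoly A) x = -Δ Ψ x := by
      rw [hΨ, laplacian_log_factor hp hx, laplacian_log_evalConj hsol hp, weight, factor]
      have := norm_ne_zero_iff.2 hx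
      have := (re_evalConj_pos hp x).ne'
      field_simp
    rw [divergence_greenField (hΨd hx) (hNd hx), hN, ← D.weight_smul_laplace_add hη hH hx]
    simp only [phi_upperSheet, phi_lowerSheet, Real.exp_log hpos]
    rw [smul_smul _ (factor _ _ _), smul_smul _ (factor _ _ _), hw, sheetSum]
    simp only [hΨ]
    module
  have hi2 : Integrable fun x => fderiv ℝ (greenField Ψ N 1) x 1
      + fderiv ℝ (greenField Ψ N Complex.I) x Complex.I := by
    obtain ⟨a1, a2⟩ := (D.integrable_area_iff hH hint1.1).1 hint1
    obtain ⟨b1, b2⟩ := (D.integrable_area_iff hH hint2.1).1 hint2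
    refine ((a1.add a2).add (b1.add b2)).congr ?_
    filter_upwards [D.ae_eval_ne_zero] with x hx
    exact hdiv hx
  have hval : ∫ P, Real.log (D.phi A P) • D.laplace H η P ∂(D.area H)
      + ∫ P, Real.exp (Real.log (D.phi A P)) • η P ∂(D.area H)
      = ∫ x, (fderiv ℝ (greenField Ψ N 1) x 1
        + fderiv ℝ (greenField Ψ N Complex.I) x Complex.I) := by
    obtain ⟨a1, a2⟩ := (D.integrable_area_iff hH hint1.1).1 hint1
    obtain ⟨b1, b2⟩ := (D.integrable_area_iff hH hint2.1).1 hint2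
    rw [D.integral_area hH hint1, D.integral_area hH hint2]
    refine (integral_add (a1.add a2) (b1.add b2)).symm.trans (integral_congr_ae ?_)
    filter_upwards [D.ae_eval_ne_zero] with x hx
    exact hdiv hx
  set S : Finset ℂ := Finset.univ.image D.root with hS
  have hSf : ∀ x ∉ S, D.f.eval x ≠ 0 := fun x hx h => by
    obtain ⟨k, rfl⟩ := D.eval_f_eq_zero_iff.1 h
    exact hx (Finset.mem_image_of_mem _ (Finset.mem_univ k))
  -- near a branch point the vector field looks like `-N ∇ log ‖x - e‖`
  have hnear : ∀ v : ℂ, ∀ e ∈ S, Tendsto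
      (fun x => (x - e) * (greenField Ψ N v x - -N e * (v / (x - e)).re)) (𝓝[≠] e) (𝓝 0) := by
    intro v e he
    obtain ⟨k, -, rfl⟩ := Finset.mem_image.1 he
    obtain ⟨B, hB⟩ := D.exists_sqrt_mul_norm_fderiv_sheetSum_le hη (‖D.root k‖ + 1)
    have hball : ∀ᶠ x in 𝓝[≠] D.root k, ‖x‖ ≤ ‖D.root k‖ + 1 := by
      have : ∀ᶠ x in 𝓝 (D.root k), ‖x‖ < ‖D.root k‖ + 1 :=
        (continuous_norm.tendsto _).eventually_lt_const (lt_add_one _)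
      exact (this.filter_mono nhdsWithin_le_nhds).mono fun x hx => hx.le
    -- `(x - e) / f` is bounded, `√|f| Ψ` tends to `0`, and `√|f| ∇N` is bounded
    have t1 : Tendsto (fun x => (x - D.root k) * (Ψ x • fderiv ℝ N x v)) (𝓝[≠] D.root k)
        (𝓝 0) := by
      have u1 := (((D.tendsto_sub_div_eval k).norm).mul
        (D.tendsto_sqrt_mul_log_factor hA k).norm).mul_const (B * ‖v‖)
      rw [norm_zero, mul_zero, zero_mul] at u1
      refine squeeze_zero_norm' ?_ u1
      filter_upwards [hball, D.eventually_eval_ne_zero k] with x hx hfx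
      have hb := hB x hx hfx
      have hn := norm_pos_iff.2 hfx
      have hs : 0 < √‖D.f.eval x‖ := Real.sqrt_pos.2 hn
      rw [norm_mul, norm_smul, norm_div, norm_mul, Real.norm_of_nonneg hs.le]
      have hb2 : ‖fderiv ℝ N x v‖ ≤ B / √‖D.f.eval x‖ * ‖v‖ := by
        refine (ContinuousLinearMap.le_opNorm _ _).trans ?_
        refine mul_le_mul_of_nonneg_right ?_ (norm_nonneg _)
        rw [le_div_iff₀ hs, mul_comm]
        exact hb
      calc ‖x - D.root k‖ * (‖Ψ x‖ * ‖fderiv ℝ N x v‖)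
          ≤ ‖x - D.root k‖ * (‖Ψ x‖ * (B / √‖D.f.eval x‖ * ‖v‖)) := by gcongr
        _ = ‖x - D.root k‖ / (√‖D.f.eval x‖ * √‖D.f.eval x‖)
            * (√‖D.f.eval x‖ * ‖Ψ x‖) * (B * ‖v‖) := by field_simp
        _ = _ := by rw [Real.mul_self_sqrt hn.le]
    have t2 := D.tendsto_sub_mul_fderiv_log_factor hA k v
    have t3 : Tendsto N (𝓝[≠] D.root k) (𝓝 (N (D.root k))) :=
      (D.tendsto_sheetSum hη.continuous k).mono_left nhdsWithin_le_nhds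
    have t4 : Tendsto (fun x => (N x - N (D.root k))
        * ((x - D.root k) * ((v / (x - D.root k)).re : ℂ))) (𝓝[≠] D.root k) (𝓝 0) := by
      have u1 := ((t3.sub_const (N (D.root k))).norm).mul_const ‖v‖
      rw [sub_self, norm_zero, zero_mul] at u1
      refine squeeze_zero_norm' ?_ u1
      filter_upwards [self_mem_nhdsWithin] with x hx
      have hn := norm_pos_iff.2 (sub_ne_zero.2 (show x ≠ D.root k from hx))
      rw [norm_mul, norm_mul, Complex.norm_real]
      refine mul_le_mul_of_nonneg_left ?_ (norm_nonneg _)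
      have := Complex.abs_re_le_norm (v / (x - D.root k))
      rw [norm_div, le_div_iff₀ hn, mul_comm] at this
      exact this
    have t5 := (t1.sub (t3.mul t2)).sub t4
    rw [mul_zero, sub_zero, sub_zero] at t5
    refine t5.congr fun x => ?_
    simp only [greenField, Complex.real_smul]
    ring
  -- the vector field is `O(‖x‖⁻²)` at infinity
  have hinf : ∀ v : ℂ, Tendsto (fun x => x * greenField Ψ N v x) (cocompact ℂ) (𝓝 0) := by
    intro v
    have o1 : (fun x => Ψ x • fderiv ℝ N x v) =O[cocompact ℂ] fun x => ‖x‖⁻¹ ^ 2 := by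
      have a1 : (fun x => fderiv ℝ N x v) =O[cocompact ℂ] fun x => fderiv ℝ N x :=
        IsBigO.of_bound ‖v‖ (Eventually.of_forall fun x => by
          rw [mul_comm]
          exact ContinuousLinearMap.le_opNorm _ _)
      refine ((D.isBigO_log_factor_cocompact hA).smul
        (a1.trans (D.isBigO_fderiv_sheetSum_cocompact hη))).congr_right fun x => ?_
      simp
    have o2 : (fun x => fderiv ℝ Ψ x v • N x) =O[cocompact ℂ] fun x => ‖x‖⁻¹ ^ 2 := by
      have a1 : (fun x => fderiv ℝ Ψ x v) =O[cocompact ℂ] fun x => fderiv ℝ Ψ x :=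
        IsBigO.of_bound ‖v‖ (Eventually.of_forall fun x => by
          rw [mul_comm]
          exact ContinuousLinearMap.le_opNorm _ _)
      have a2 : N =O[cocompact ℂ] fun _ => (1 : ℝ) :=
        IsBigO.of_bound (C' + C') (Eventually.of_forall fun x => by
          rw [norm_one, mul_one]
          exact (norm_add_le _ _).trans (add_le_add (hC' _) (hC' _)))
      refine ((a1.trans (D.isBigO_fderiv_log_factor_cocompact hA)).smul a2).congr_right
        fun x => ?_
      simp
    have o3 : (fun x => x * greenField Ψ N v x) =O[cocompact ℂ] fun x => ‖x‖⁻¹ := by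
      refine ((isBigO_refl (fun x : ℂ => x) (cocompact ℂ)).norm_right.mul (o1.sub o2)).congr'
        EventuallyEq.rfl ?_
      filter_upwards [eventually_ne_zero_cocompact] with x hx
      have := norm_ne_zero_iff.2 hx
      field_simp
    refine o3.trans_tendsto ?_
    exact tendsto_inv_atTop_zero.comp (tendsto_norm_cocompact_atTop (E := ℂ))
  rw [hval, integral_divergence_eq S (fun e => -N e)
    (fun x hx => contDiffAt_greenField (hΨd (hSf x hx)) (hNd (hSf x hx)) 1)
    (fun x hx => contDiffAt_greenField (hΨd (hSf x hx)) (hNd (hSf x hx)) Complex.I)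
    (hnear 1) (hnear Complex.I) (hinf 1) (hinf Complex.I) hi2, hS,
    Finset.sum_image fun _ _ _ _ h => D.root_injective h]
  simp only [hN, D.sheetSum_root, Finset.sum_neg_distrib, ← Finset.mul_sum]
  ring

end Distribution

end HyperellipticData

end MeanField

theorem theorem4p1 (g : ℕ) (hg : 1 ≤ g) (D : MeanField.HyperellipticData g)
    (H : Matrix (Fin g) (Fin g) ℂ) (hH : H.PosDef)
    (A : Matrix (Fin (g + 2)) (Fin (g + 2)) ℂ) (hA : A.PosDef)
    (u : MvPolynomial (Fin 2) ℂ) (hu : u = MeanField.matPoly A)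
    (hsol : MeanField.SolvesPDE (MeanField.matPoly H) u) :
    ∃ φ : D.Curve → ℝ,
      (∀ p : D.C₀, MeanField.evalConj u p.1.1 ≠ 0 ∧
        (φ (D.ι₀ p) : ℂ) = 4 * ‖D.f.eval p.1.1‖ / MeanField.evalConj u p.1.1) ∧
      (∀ q : D.C₁, MeanField.evalConj (MeanField.matPolyRev A) q.1.1 ≠ 0 ∧
        (φ (D.ι₁ q) : ℂ) =
          4 * ‖D.gPoly.eval q.1.1‖ / MeanField.evalConj (MeanField.matPolyRev A) q.1.1) ∧
      ContMDiff 𝓘(ℝ, ℂ) 𝓘(ℝ, ℝ) ∞ φ ∧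
      (∀ P, 0 ≤ φ P) ∧
      {P | φ P = 0} = Set.range D.weierstrassPoint ∧
      ContMDiffOn 𝓘(ℝ, ℂ) 𝓘(ℝ, ℝ) ∞ (fun P => Real.log (φ P))
        (Set.range D.weierstrassPoint)ᶜ ∧
      (∀ P ∉ Set.range D.weierstrassPoint,
        D.laplace H (fun Q => Real.log (φ Q)) P + Real.exp (Real.log (φ P)) = 0) ∧
      D.SolvesMeanField H (fun P => Real.log (φ P)) := by
  subst hu
  refine ⟨D.phi A, fun p => ⟨(MeanField.evalConj_matPoly_pos hA _).ne', ?_⟩,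
    fun q => ⟨(MeanField.evalConj_matPolyRev_pos hA _).ne', ?_⟩, D.contMDiff_phi hA,
    D.phi_nonneg hA, Set.ext fun P => D.phi_eq_zero_iff hA, D.contMDiffOn_log_phi hA,
    fun P hP => D.laplace_log_phi_add_exp hg hH hA hsol hP,
    D.solvesMeanField_log_phi hg hH hA hsol⟩
  · rw [D.phi_ι₀, MeanField.factor]
    push_cast
    rw [MeanField.ofReal_re_evalConj (MeanField.evalConj_matPoly_pos hA)]
  · rw [D.phi_ι₁, MeanField.factor]
    push_cast
    rw [MeanField.ofReal_re_evalConj (MeanField.evalConj_matPolyRev_pos hA)]
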